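/- Let $R>0$ and $\omega<R$ be real and let $f$ be analytic on $\{|s|<R\}\cup\{\operatorname{Re}s>\omega\}$. Write $L^\infty_\omega(\mathbb R_+)$ for the measurable $\phi:(0,\infty)\to\mathbb C$ with $e^{-\omega t}\phi(t)$ essentially bounded, $\mathcal L\phi(s)=\int_0^\infty e^{-st}\phi(t)\,dt$, and $C_W^\infty(\omega,\infty)$ for the smooth $h:(\omega,\infty)\to\mathbb C$ with $\sup_{n\ge0,\,s>\omega}\left|\frac{(s-\omega)^{n+1}}{n!}h^{(n)}(s)\right|<\infty$. Let $r$ be entire and $J\in L^\infty_\omega(\mathbb R_+)$. A solution of $f(\partial_t)\phi=J$ (with generalized initial condition $r$) is a $\phi\in L^\infty_\omega(\mathbb R_+)$ such that $f\,\mathcal L\phi-r\in C_W^\infty(\omega,\infty)$ and $\mathcal L^{-1}(f\,\mathcal L\phi-r)=J$. Assume that $(\mathcal LJ+r)/f$ and $\mathcal LJ/f$ (with removable singularities filled in) belong to $C_W^\infty(\omega,\infty)$. Suppose that $r/f$ (with $f$ continued to the left of $\operatorname{Re}s=\omega$) is meromorphic on $\mathbb C$ and that its poles are exactly the distinct points $\omega_0,\omega_1,\omega_2,\dots$,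 where $\operatorname{Re}\omega_i<\omega$, $|\omega_i|\le|\omega_{i+1}|$, and $\omega_i$ has order $r_i\ge1$. Suppose that for some $C$ and $q>0$ one has $|r(s)/f(s)|\le C|s|^{-q}$ for all $s$ with $\operatorname{Re}s\ge\omega$ and $|s|$ sufficiently large. Let $b_n>0$, $b_n\to\infty$, and for every $n\ge0$ let $\sigma_n$ be a piecewise $C^1$ curve in $\{\operatorname{Re}s\le\omega\}$ from $\omega+ib_n$ to $\omega-ib_n$, passing through no pole, which together with the segment $[\omega-ib_n,\omega+ib_n]$ encloses exactly the first $n$ poles (winding number $1$ about $\omega_i$ for $i<n$, and $0$ for $i\ge n$). Suppose that for every $t>0$ $$\lim_{n\to\infty}\int_{\sigma_n}e^{ts}\,\frac{r(s)}{f(s)}\,ds=0 .$$ Then $f(\partial_t)\phi=J$ has a solution $\phi$, unique up to equality almost everywhere, namely $\phi=\mathcal L^{-1}\big((\mathcal LJ+r)/f\big)$; also $\psi=\mathcal L^{-1}(\mathcal LJ/f)\in L^\infty_\omega(\mathbb R_+)$ exists. There are polynomials $P_i$ of degree exactly $r_i-1$, depending neither on $t$ nor on $\phi$, such that $$\phi(t)=\frac1{2\pi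 i}\int_{c-i\infty}^{c+i\infty}e^{st}\,\frac{\mathcal L J(s)}{f(s)}\,ds+\sum_{i=0}^\infty P_i(t)e^{\omega_it}\qquad(c>\omega)$$ in the following sense. Put $S_n(t)=\sum_{i<n}P_i(t)e^{\omega_it}$ and $B_{F,c,N}(t)=\frac1{2\pi i}\int_{c-iN}^{c+iN}e^{st}F(s)\,ds$. 1. For every $t>0$ at which (representatives of) $\phi$ and $\psi$ are of bounded variation near $t$, and every $c>\omega$, the limits $\lim_{N\to\infty}B_{\mathcal LJ/f,c,N}(t)$ and $\lim_{n\to\infty}S_n(t)$ exist and their sum is $\tfrac12(\phi(t^+)+\phi(t^-))$ (hence $\phi(t)$ where $\phi$ is continuous). 2. With no regularity assumption, for all $c>\omega$ and $T>0$: $B_{\mathcal LJ/f,c,N}\to\psi$ in $L^2(0,T)$ as $N\to\infty$, and $S_n\to\phi-\psi$ in measure on $(0,T)$ as $n\to\infty$. Moreover, for each $c>\omega$ and almost every $t>0$: if $\lim_N B_{\mathcal LJ/f,c,N}(t)$ and $\lim_n S_n(t)$ exist, then their sum is $\phi(t)$. 3. For every $t>0$ and every $c\ge\omega$, $S_n(t)-B_{r/f,c,b_n}(t)\to0$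 as $n\to\infty$; that is, the series and the Bromwich integral of $r/f$ (truncated at height $b_n$) are equiconvergent. 4. If $\mathcal LJ/f$ extends to a continuous function $F$ on $\{\operatorname{Re}s\ge\omega\}$ with $F(s)\to0$ as $|s|\to\infty$ there, then $B_{F,\omega,N}(t)-B_{\mathcal LJ/f,c,N}(t)\to0$ as $N\to\infty$ for all $t>0$ and $c>\omega$; so the line $\operatorname{Re}s=\omega$ may be used in the formula. -/

import Mathlib

open Set Filter Topology MeasureTheory

namespace NonlocalODE

noncomputable section

/-- The space `L^∞_ω(ℝ₊)` of exponentially bounded functions; only the values on `(0, ∞)` matter. -/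
def MemExpBdd (ω : ℝ) (φ : ℝ → ℂ) : Prop :=
  AEStronglyMeasurable φ (volume.restrict (Ioi (0 : ℝ))) ∧
    ∃ C : ℝ, ∀ᵐ t ∂(volume.restrict (Ioi (0 : ℝ))), ‖(Real.exp (-ω * t) : ℂ) * φ t‖ ≤ C

/-- The Widder space `C^∞_W(ω, ∞)`; only the values on `(ω, ∞)` matter. -/
def MemWidder (ω : ℝ) (h : ℝ → ℂ) : Prop :=
  ContDiffOn ℝ ((⊤ : ℕ∞) : WithTop ℕ∞) h (Ioi ω) ∧
    ∃ M : ℝ, ∀ (n : ℕ) (s : ℝ), ω < s →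
      ‖((s - ω) ^ (n + 1) / (n.factorial : ℝ)) • iteratedDeriv n h s‖ ≤ M

/-- The Laplace transform. -/
def laplace (φ : ℝ → ℂ) (s : ℂ) : ℂ :=
  ∫ t in Ioi (0 : ℝ), Complex.exp (-s * t) * φ t

/-- The quotient `g / f` (with its removable singularities on `(ω, ∞)` filled in) belongs to
the Widder space. -/
def QuotMemWidder (ω : ℝ) (g f : ℂ → ℂ) : Prop :=
  ∃ h : ℝ → ℂ, MemWidder ω h ∧ ∀ x : ℝ, ω < x → f x ≠ 0 → h x = g x / f x

/-- `φ = 𝓛⁻¹(g / f)`: `φ` is in `L^∞_ω(ℝ₊)` and its Laplace transform is `g / f`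
on `Re s > ω` (away from the zeros of `f`). -/
def IsInverseLaplaceQuot (ω : ℝ) (g f : ℂ → ℂ) (φ : ℝ → ℂ) : Prop :=
  MemExpBdd ω φ ∧ ∀ s : ℂ, ω < s.re → f s ≠ 0 → laplace φ s = g s / f s

/-- The class `Γ`, with its parameters `R = R_f` and `ω = ω_f`. -/
def ClassGamma (R ω : ℝ) (f : ℂ → ℂ) : Prop :=
  0 < R ∧ ω < R ∧ AnalyticOnNhd ℂ f ({s : ℂ | ‖s‖ < R} ∪ {s : ℂ | ω < s.re})

/-- `φ` is a solution of `f(∂_t) φ = J` with generalized initial condition `r`: the pair `(φ, r)`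
is in the domain `D_f` and `𝓛⁻¹(f 𝓛(φ) - r) = J`. -/
def IsSolution (ω : ℝ) (f r : ℂ → ℂ) (J φ : ℝ → ℂ) : Prop :=
  MemExpBdd ω φ ∧
    MemWidder ω (fun x : ℝ => f x * laplace φ x - r x) ∧
    (MemExpBdd ω J ∧ ∀ x : ℝ, ω < x → laplace J x = f x * laplace φ x - r x)

/-- The truncated Bromwich integral `(1 / 2πi) ∫_{c - iN}^{c + iN} e^{st} F(s) ds`. -/
def bromwich (F : ℂ → ℂ) (c N t : ℝ) : ℂ :=
  (1 / (2 * Real.pi * Complex.I)) *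
    ∫ y in (-N)..N, Complex.exp ((c + y * Complex.I) * t) * F (c + y * Complex.I) * Complex.I

/-- Piecewise continuously differentiable curves parametrized by `[0, 1]`. -/
def PiecewiseC1 (σ : ℝ → ℂ) : Prop :=
  ∃ (k : ℕ) (τ : ℕ → ℝ), Monotone τ ∧ τ 0 = 0 ∧ τ k = 1 ∧
    ∀ j < k, ContDiffOn ℝ 1 σ (Icc (τ j) (τ (j + 1)))

/-- The integral of `g` along the curve `σ : [0, 1] → ℂ`. -/
def contourIntegral (g : ℂ → ℂ) (σ : ℝ → ℂ) : ℂ :=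
  ∫ u in (0 : ℝ)..1, g (σ u) * deriv σ u

/-- The winding number about `a` of the closed curve formed by the vertical segment from
`c - ib` up to `c + ib`, followed by the curve `σ` from `c + ib` back to `c - ib`. -/
def windingNumber (c b : ℝ) (σ : ℝ → ℂ) (a : ℂ) : ℂ :=
  (1 / (2 * Real.pi * Complex.I)) *
    ((∫ y in (-b)..b, (c + y * Complex.I - a)⁻¹ * Complex.I) +
      contourIntegral (fun z => (z - a)⁻¹) σ)

/-- `σ` is a curve in the half-plane `Re s ≤ c` from `c + ib` to `c - ib`, which together with
the segment of the line `Re s = c` between these points encloses (once, counterclockwise)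
exactly the first `n` of the points `p 0, p 1, …` and passes through none of them. -/
def IsEnclosingCurve (c b : ℝ) (p : ℕ → ℂ) (n : ℕ) (σ : ℝ → ℂ) : Prop :=
  0 < b ∧ PiecewiseC1 σ ∧
    σ 0 = c + b * Complex.I ∧ σ 1 = c - b * Complex.I ∧
    (∀ u ∈ Icc (0 : ℝ) 1, (σ u).re ≤ c) ∧
    (∀ u ∈ Icc (0 : ℝ) 1, ∀ i, σ u ≠ p i) ∧
    (∀ i < n, windingNumber c b σ (p i) = 1) ∧
    (∀ i, n ≤ i → windingNumber c b σ (p i) = 0)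

/-- `r / f` is meromorphic on the plane and its poles are exactly the pairwise distinct points
`p i`, of orders `m i ≥ 1`, all to the left of `Re s = ω`, listed by increasing modulus. -/
def HasPoles (ω : ℝ) (f r : ℂ → ℂ) (p : ℕ → ℂ) (m : ℕ → ℕ) : Prop :=
  Meromorphic (fun s => r s / f s) ∧
    Function.Injective p ∧ Monotone (fun i => ‖p i‖) ∧
    (∀ i, (p i).re < ω) ∧ (∀ i, 1 ≤ m i) ∧
    (∀ i, meromorphicOrderAt (fun s => r s / f s) (p i) = ((-(m i : ℤ) : ℤ) : WithTop ℤ)) ∧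
    (∀ s, meromorphicOrderAt (fun s => r s / f s) s < 0 → ∃ i, s = p i)

/-- The partial sums of `∑ P_i(t) e^{p_i t}`. -/
def expSum (P : ℕ → Polynomial ℂ) (p : ℕ → ℂ) (n : ℕ) (t : ℝ) : ℂ :=
  ∑ i ∈ Finset.range n, (P i).eval (t : ℂ) * Complex.exp (p i * t)

/-- `φ` is of bounded variation in a neighbourhood of `t`. -/
def BVNear (φ : ℝ → ℂ) (t : ℝ) : Prop :=
  ∃ δ > 0, BoundedVariationOn φ (Icc (t - δ) (t + δ))

end

end NonlocalODE

/-! ### The Laplace transform of exponentially bounded functions -/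

namespace NonlocalODE

/-! By Widder's theorem the functions of `MemWidder` are exactly the Laplace transforms of
`MemExpBdd` functions. So the quotients (𝓛J + r)/f and 𝓛J/f invert to functions φ and ψ, and the
identity theorem carries the equality of transforms from the real ray to the half-plane. Being a
solution amounts to f 𝓛φ = 𝓛J + r, and uniqueness is the injectivity of the Laplace transform
(`IsSymbol.isSolution_iff`, `IsSymbol.ae_eq`).

Since r/f is the difference of the two quotients, its truncated Bromwich integral is that of 𝓛φ
minus that of 𝓛ψ. On the other hand, the residue of e^{ts} r/f at a pole is an exponential times a
polynomial in t, of degree one less than the order of the pole because the top coefficient of the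
principal part is nonzero. The residue theorem for the segment closed up by σ_n says that S_n(t)
minus the Bromwich integral of r/f on Re s = ω is 1/(2πi) times the integral along σ_n, which tends
to 0 (`tendsto_expSum_sub_bromwich`). The decay of r/f moves the line from ω to any c ≥ ω. The
series thus inherits the convergence of Bromwich inversion.

That convergence is Fourier inversion for e^{-ct}φ(t) extended by zero. Plancherel gives it in L² on
bounded intervals, hence in measure, and almost everywhere along subsequences; the Dirichlet–Jordan
theorem gives it pointwise, with the mean of the one-sided limits, where there is local bounded
variation.

Widder's theorem is proved by discretization: step functions with values (−1)ⁿ sⁿ⁺¹ h⁽ⁿ⁾(s)/n! at s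
= N + 1 are uniformly bounded, Taylor's formula shows that their Laplace transforms tend to h, and a
weak cluster point in a weighted L² space is the required function. -/

theorem integrableOn_pow_mul_exp_neg {a : ℝ} (ha : 0 < a) (k : ℕ) :
    IntegrableOn (fun t : ℝ => t ^ k * Real.exp (-a * t)) (Ioi 0) := by
  have := integrableOn_rpow_mul_exp_neg_mul_rpow (p := 1) (s := k) (b := a)
    (by have : (0 : ℝ) ≤ k := k.cast_nonneg
        linarith) one_pos ha
  simpa using this

theorem integral_pow_mul_exp_neg {a : ℝ} (ha : 0 < a) (k : ℕ) :
    ∫ t in Ioi (0 : ℝ), t ^ k * Real.exp (-a * t) = k.factorial / a ^ (k + 1) := by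
  have := Real.integral_rpow_mul_exp_neg_mul_Ioi (a := k + 1) (r := a) (by positivity) ha
  rw [Real.Gamma_nat_eq_factorial, ← Nat.cast_add_one, Real.rpow_natCast] at this
  rw [div_eq_inv_mul, ← inv_pow, ← one_div, ← this]
  simp

theorem MemExpBdd.exists_bound {ω : ℝ} {φ : ℝ → ℂ} (h : MemExpBdd ω φ) :
    ∃ C : ℝ, 0 ≤ C ∧
      ∀ᵐ t ∂(volume.restrict (Ioi (0 : ℝ))), ‖φ t‖ ≤ C * Real.exp (ω * t) := by
  obtain ⟨C, hC⟩ := h.2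
  refine ⟨max C 0, le_max_right _ _, hC.mono fun t ht => ?_⟩
  rw [norm_mul, Complex.norm_real, Real.norm_eq_abs, Real.abs_exp] at ht
  calc ‖φ t‖ = (Real.exp (-ω * t) * ‖φ t‖) * Real.exp (ω * t) := by
        rw [mul_right_comm, ← Real.exp_add]; simp
    _ ≤ _ := by gcongr; exact ht.trans (le_max_left _ _)

theorem aestronglyMeasurable_exp_mul {φ : ℝ → ℂ}
    (hφ : AEStronglyMeasurable φ (volume.restrict (Ioi (0 : ℝ)))) (s : ℂ) (k : ℕ) :
    AEStronglyMeasurable (fun t : ℝ => Complex.exp (-s * t) * ((-t : ℂ) ^ k * φ t))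
      (volume.restrict (Ioi (0 : ℝ))) :=
  (by fun_prop : Continuous fun t : ℝ => Complex.exp (-s * t)).aestronglyMeasurable.mul
    ((by fun_prop : Continuous fun t : ℝ => (-t : ℂ) ^ k).aestronglyMeasurable.mul hφ)

theorem norm_exp_mul_pow_le {ω C : ℝ} {φ : ℝ → ℂ} {t : ℝ} (ht : 0 < t)
    (h : ‖φ t‖ ≤ C * Real.exp (ω * t)) (s : ℂ) (k : ℕ) :
    ‖Complex.exp (-s * t) * ((-t : ℂ) ^ k * φ t)‖ ≤
      C * (t ^ k * Real.exp (-(s.re - ω) * t)) := by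
  rw [norm_mul, norm_mul, Complex.norm_exp, norm_pow, norm_neg, Complex.norm_real,
    Real.norm_of_nonneg ht.le]
  calc Real.exp ((-s * t).re) * (t ^ k * ‖φ t‖)
      ≤ Real.exp ((-s * t).re) * (t ^ k * (C * Real.exp (ω * t))) := by gcongr
    _ = C * (t ^ k * (Real.exp ((-s * t).re) * Real.exp (ω * t))) := by ring
    _ = _ := by
      rw [← Real.exp_add]
      congr 3
      simp
      ring

theorem MemExpBdd.integrableOn {ω : ℝ} {φ : ℝ → ℂ} (h : MemExpBdd ω φ) {s : ℂ}
    (hs : ω < s.re) (k : ℕ) :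
    IntegrableOn (fun t : ℝ => Complex.exp (-s * t) * ((-t : ℂ) ^ k * φ t)) (Ioi 0) := by
  obtain ⟨C, -, hC⟩ := h.exists_bound
  refine Integrable.mono' ((integrableOn_pow_mul_exp_neg (sub_pos.2 hs) k).const_mul C)
    (aestronglyMeasurable_exp_mul h.1 s k) ?_
  filter_upwards [hC, ae_restrict_mem measurableSet_Ioi] with t ht ht0
  exact norm_exp_mul_pow_le ht0 ht s k

theorem MemExpBdd.integrableOn_laplace {ω : ℝ} {φ : ℝ → ℂ} (h : MemExpBdd ω φ) {s : ℂ}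
    (hs : ω < s.re) : IntegrableOn (fun t : ℝ => Complex.exp (-s * t) * φ t) (Ioi 0) := by
  simpa using h.integrableOn hs 0

theorem MemExpBdd.hasDerivAt_laplace {ω : ℝ} {φ : ℝ → ℂ} (h : MemExpBdd ω φ) {s : ℂ}
    (hs : ω < s.re) (k : ℕ) :
    HasDerivAt (laplace fun t => (-t : ℂ) ^ k * φ t)
      (laplace (fun t => (-t : ℂ) ^ (k + 1) * φ t) s) s := by
  obtain ⟨C, hC0, hC⟩ := h.exists_bound
  -- Half the distance to the abscissa: on Re z > ω + a the differentiated integrand has an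
  -- integrable bound independent of z.
  set a := (s.re - ω) / 2 with ha
  have ha0 : 0 < a := by simp only [ha]; linarith
  have hopen : {z : ℂ | ω + a < z.re} ∈ 𝓝 s :=
    (isOpen_lt continuous_const Complex.continuous_re).mem_nhds (by
      simp only [mem_ofPred_eq, ha]; linarith)
  refine (hasDerivAt_integral_of_dominated_loc_of_deriv_le
    (F := fun (z : ℂ) (t : ℝ) => Complex.exp (-z * t) * ((-t : ℂ) ^ k * φ t))
    (F' := fun (z : ℂ) (t : ℝ) => Complex.exp (-z * t) * ((-t : ℂ) ^ (k + 1) * φ t))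
    (bound := fun t : ℝ => C * (t ^ (k + 1) * Real.exp (-a * t))) hopen
    (Eventually.of_forall fun z => aestronglyMeasurable_exp_mul h.1 z k) (h.integrableOn hs k)
    (aestronglyMeasurable_exp_mul h.1 s (k + 1)) ?_
    ((integrableOn_pow_mul_exp_neg ha0 (k + 1)).const_mul C) ?_).2
  · filter_upwards [hC, ae_restrict_mem measurableSet_Ioi] with t ht ht0 z hz
    refine (norm_exp_mul_pow_le ht0 ht z (k + 1)).trans ?_
    have ht0' : (0 : ℝ) < t := ht0
    gcongr
    have : ω + a < z.re := hz
    linarith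
  · refine Eventually.of_forall fun t z _ => ?_
    have h1 : HasDerivAt (fun z : ℂ => Complex.exp (-z * t)) (Complex.exp (-z * t) * (-1 * t)) z :=
      (((hasDerivAt_id z).neg).mul_const (t : ℂ)).cexp
    refine (h1.mul_const ((-t : ℂ) ^ k * φ t)).congr_deriv ?_
    ring

theorem MemExpBdd.differentiableOn_laplace {ω : ℝ} {φ : ℝ → ℂ} (h : MemExpBdd ω φ) :
    DifferentiableOn ℂ (laplace φ) {s | ω < s.re} := fun s hs => by
  simpa using (h.hasDerivAt_laplace hs 0).differentiableAt.differentiableWithinAt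

theorem isOpen_re_gt (ω : ℝ) : IsOpen {s : ℂ | ω < s.re} :=
  isOpen_lt continuous_const Complex.continuous_re

theorem MemExpBdd.analyticOnNhd_laplace {ω : ℝ} {φ : ℝ → ℂ} (h : MemExpBdd ω φ) :
    AnalyticOnNhd ℂ (laplace φ) {s | ω < s.re} :=
  h.differentiableOn_laplace.analyticOnNhd (isOpen_re_gt ω)

theorem MemExpBdd.iteratedDeriv_laplace {ω : ℝ} {φ : ℝ → ℂ} (h : MemExpBdd ω φ) (n : ℕ) :
    ∀ x : ℝ, ω < x → iteratedDeriv n (fun y : ℝ => laplace φ y) x =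
      laplace (fun t => (-t : ℂ) ^ n * φ t) x := by
  induction n with
  | zero => intro x _; simp
  | succ n ih =>
    intro x hx
    rw [iteratedDeriv_succ]
    have : iteratedDeriv n (fun y : ℝ => laplace φ y) =ᶠ[𝓝 x]
        fun y : ℝ => laplace (fun t => (-t : ℂ) ^ n * φ t) y :=
      (eventually_gt_nhds hx).mono fun y hy => ih y hy
    rw [this.deriv_eq]
    exact (h.hasDerivAt_laplace (s := x) (by simpa using hx) n).comp_ofReal.deriv

/-- The easy half of Widder's theorem: the n-th derivative is at most C times the integral of tⁿ
e^{-(s-ω)t}, that is n!/(s − ω)ⁿ⁺¹, which the Widder weight cancels exactly. -/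
theorem MemExpBdd.memWidder_laplace {ω : ℝ} {φ : ℝ → ℂ} (h : MemExpBdd ω φ) :
    MemWidder ω fun x : ℝ => laplace φ x := by
  constructor
  · have h1 : ContDiffOn ℂ ((⊤ : ℕ∞) : WithTop ℕ∞) (laplace φ) {s | ω < s.re} :=
      h.differentiableOn_laplace.contDiffOn (isOpen_re_gt ω)
    exact (h1.restrict_scalars ℝ).comp Complex.ofRealCLM.contDiff.contDiffOn
      fun x hx => by simpa using hx
  · obtain ⟨C, hC0, hC⟩ := h.exists_bound
    refine ⟨C, fun n s hs => ?_⟩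
    have hs' : 0 < s - ω := sub_pos.2 hs
    rw [h.iteratedDeriv_laplace n s hs, norm_smul, Real.norm_of_nonneg (by positivity)]
    have : ‖laplace (fun t => (-t : ℂ) ^ n * φ t) s‖ ≤
        ∫ t in Ioi (0 : ℝ), C * (t ^ n * Real.exp (-(s - ω) * t)) := by
      refine norm_integral_le_of_norm_le ((integrableOn_pow_mul_exp_neg hs' n).const_mul C) ?_
      filter_upwards [hC, ae_restrict_mem measurableSet_Ioi] with t ht ht0
      simpa using norm_exp_mul_pow_le ht0 ht s n
    rw [integral_const_mul, integral_pow_mul_exp_neg hs'] at this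
    calc _ ≤ (s - ω) ^ (n + 1) / n.factorial * (C * (n.factorial / (s - ω) ^ (n + 1))) := by
          gcongr
      _ = C := by field_simp

end NonlocalODE

/-! ### Weak compactness, and Taylor expansion under the Widder bounds -/

namespace NonlocalODE

/-- A bounded sequence in a Hilbert space has a weak cluster point. -/
theorem exists_weak_clusterPt {H : Type*} [NormedAddCommGroup H] [InnerProductSpace ℂ H]
    [CompleteSpace H] {v : ℕ → H} {B : ℝ} (hv : ∀ n, ‖v n‖ ≤ B) :
    ∃ (U : Ultrafilter ℕ) (x : H), ↑U ≤ (atTop : Filter ℕ) ∧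
      ∀ u : H, Tendsto (fun n => inner ℂ (v n) u) U (𝓝 (inner ℂ x u)) := by
  set U := Ultrafilter.of (atTop : Filter ℕ)
  let T : ℕ → WeakDual ℂ H := fun n =>
    WeakDual.toStrongDual.symm (InnerProductSpace.toDual ℂ H (v n))
  have hc := WeakDual.isCompact_closedBall (𝕜 := ℂ) (E := H) 0 B
  obtain ⟨x, -, hx⟩ := isCompact_iff_ultrafilter_le_nhds'.1 hc (U.map T) (by
    rw [Ultrafilter.mem_map]
    refine Filter.univ_mem' fun n => ?_
    simpa [T] using hv n)
  refine ⟨U, (InnerProductSpace.toDual ℂ H).symm (WeakDual.toStrongDual x),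
    Ultrafilter.of_le _, fun u => ?_⟩
  have h1 : Tendsto T U (𝓝 x) := hx
  have h2 := ((WeakDual.eval_continuous (𝕜 := ℂ) u).tendsto x).comp h1
  rw [InnerProductSpace.toDual_symm_apply]
  exact h2

/-- A uniformly bounded sequence of functions has a bounded cluster point for the weak topology
given by the test functions of the form `w * u` with `u` in `L²`. -/
theorem exists_weak_clusterPt_of_bounded {α : Type*} [MeasurableSpace α] {μ : Measure α}
    {φ : ℕ → α → ℂ} {M : ℝ} (hφ : ∀ n, AEStronglyMeasurable (φ n) μ) (hM : ∀ n x, ‖φ n x‖ ≤ M)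
    {w : α → ℝ} (hw : MemLp w 2 μ) (hw0 : ∀ x, 0 < w x) :
    ∃ g : α → ℂ, AEStronglyMeasurable g μ ∧ (∀ᵐ x ∂μ, ‖g x‖ ≤ M) ∧
      ∀ u : α → ℂ, MemLp u 2 μ → ∀ ℓ : ℂ,
        Tendsto (fun n => ∫ x, φ n x * (w x * u x) ∂μ) atTop (𝓝 ℓ) →
        ∫ x, g x * (w x * u x) ∂μ = ℓ := by
  have hwm : AEStronglyMeasurable (fun x => (w x : ℂ)) μ :=
    Complex.continuous_ofReal.comp_aestronglyMeasurable hw.1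
  -- The inner product is conjugate-linear in its first argument; conjugating here makes the pairing
  -- with `u` equal to ∫ φ_n w u.
  have hmem : ∀ n, MemLp (fun x => star (φ n x) * w x) 2 μ := fun n => by
    refine MemLp.of_le_mul (c := M) hw (((hφ n).star).mul hwm) (Eventually.of_forall fun x => ?_)
    rw [norm_mul, norm_star, Complex.norm_real]
    gcongr
    exact hM n x
  let v : ℕ → Lp ℂ 2 μ := fun n => (hmem n).toLp
  have hv : ∀ n, ‖v n‖ ≤ M * ‖hw.toLp‖ := fun n => by
    refine Lp.norm_le_mul_norm_of_ae_le_mul ?_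
    filter_upwards [(hmem n).coeFn_toLp, hw.coeFn_toLp] with x h1 h2
    rw [h1, h2, norm_mul, norm_star, Complex.norm_real]
    gcongr
    exact hM n x
  obtain ⟨U, y, hU, hy⟩ := exists_weak_clusterPt hv
  have hinner : ∀ (u : α → ℂ) (hu : MemLp u 2 μ) (n : ℕ),
      inner ℂ (v n) hu.toLp = ∫ x, φ n x * (w x * u x) ∂μ := fun u hu n => by
    rw [L2.inner_def]
    refine integral_congr_ae ?_
    filter_upwards [(hmem n).coeFn_toLp, hu.coeFn_toLp] with x h1 h2
    rw [h1, h2, RCLike.inner_apply]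
    simp
    ring
  have hinner' : ∀ (u : α → ℂ) (hu : MemLp u 2 μ),
      inner ℂ y hu.toLp = ∫ x, star (y x) * u x ∂μ := fun u hu => by
    rw [L2.inner_def]
    refine integral_congr_ae ?_
    filter_upwards [hu.coeFn_toLp] with x h2
    rw [h2, RCLike.inner_apply]
    simp [mul_comm]
  have hym : AEStronglyMeasurable y μ := (Lp.memLp y).1
  have hgw : ∀ x (z : ℂ), star (y x) / (w x : ℂ) * (w x * z) = star (y x) * z := fun x z => by
    have : (w x : ℂ) ≠ 0 := by exact_mod_cast (hw0 x).ne'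
    field_simp
  refine ⟨fun x => star (y x) / w x, (hym.star).div₀ hwm, ?_, fun u hu ℓ hℓ => ?_⟩
  · -- test against the phase of the cluster point on the set where it exceeds `M`
    set A : Set α := {x | M * w x < ‖y x‖} with hA
    have hAm : NullMeasurableSet A μ :=
      nullMeasurableSet_lt (hw.1.aemeasurable.const_mul M) hym.norm.aemeasurable
    let u : α → ℂ := A.indicator fun x => w x * (y x / ‖y x‖)
    have hum : AEStronglyMeasurable u μ :=
      (hwm.mul (hym.div₀ (Complex.continuous_ofReal.comp_aestronglyMeasurable
        hym.norm))).indicator₀ hAm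
    have hule : ∀ x, ‖u x‖ ≤ ‖w x‖ := fun x => by
      refine (norm_indicator_le_norm_self _ _).trans ?_
      rw [norm_mul, Complex.norm_real, norm_div, Complex.norm_real, norm_norm]
      exact mul_le_of_le_one_right (norm_nonneg _) (div_self_le_one _)
    have hu : MemLp u 2 μ := hw.of_le hum (Eventually.of_forall hule)
    have hw2 : Integrable (fun x => w x ^ 2) μ := (memLp_two_iff_integrable_sq hw.1).1 hw
    have hbound : ∀ n, ‖∫ x, φ n x * (w x * u x) ∂μ‖ ≤ ∫ x in A, M * w x ^ 2 ∂μ := fun n => by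
      have : ∫ x, φ n x * (w x * u x) ∂μ =
          ∫ x in A, φ n x * (w x * (w x * (y x / ‖y x‖))) ∂μ := by
        rw [← integral_indicator₀ hAm]
        congr 1 with x
        by_cases hx : x ∈ A <;> simp [u, hx]
      rw [this]
      refine norm_integral_le_of_norm_le (hw2.const_mul M).integrableOn
        (Eventually.of_forall fun x => ?_)
      rw [norm_mul, norm_mul, norm_mul, Complex.norm_real, norm_div, Complex.norm_real, norm_norm,
        Real.norm_of_nonneg (hw0 x).le, sq]
      have h1 := hM n x
      have h2 : ‖y x‖ / ‖y x‖ ≤ 1 := div_self_le_one _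
      have h3 := (hw0 x).le
      have h4 : 0 ≤ M := (norm_nonneg _).trans h1
      calc ‖φ n x‖ * (w x * (w x * (‖y x‖ / ‖y x‖)))
          ≤ M * (w x * (w x * 1)) := by gcongr
        _ = _ := by ring
    have hlim := hy hu.toLp
    simp_rw [hinner u hu] at hlim
    have hle : ‖inner ℂ y hu.toLp‖ ≤ ∫ x in A, M * w x ^ 2 ∂μ :=
      le_of_tendsto hlim.norm (Eventually.of_forall hbound)
    have heq : inner ℂ y hu.toLp = ((∫ x in A, w x * ‖y x‖ ∂μ : ℝ) : ℂ) := by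
      rw [hinner' u hu, ← integral_complex_ofReal, ← integral_indicator₀ hAm]
      congr 1 with x
      by_cases hx : x ∈ A
      · have hy0 : (‖y x‖ : ℂ) ≠ 0 := by
          by_contra h0
          have : ‖y x‖ = 0 := by exact_mod_cast h0
          have h2 : M * w x < ‖y x‖ := hx
          have h3 := (norm_nonneg _).trans (hM 0 x)
          have := mul_nonneg h3 (hw0 x).le
          linarith
        simp only [u, hx, indicator_of_mem]
        have : star (y x) * y x = (‖y x‖ : ℂ) ^ 2 := by
          rw [mul_comm]; exact Complex.mul_conj' _
        push_cast
        field_simp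
        linear_combination (w x : ℂ) * this
      · simp [u, hx]
    have hint1 : IntegrableOn (fun x => w x * ‖y x‖) A μ :=
      (hw.integrable_mul (Lp.memLp y).norm).integrableOn
    have hint2 : IntegrableOn (fun x => M * w x ^ 2) A μ := (hw2.const_mul M).integrableOn
    rw [heq, Complex.norm_real] at hle
    -- The limit inequality reads ∫_A w‖y‖ ≤ M ∫_A w², whereas w‖y‖ > M w² on A; so A is null.
    have hle' : ∫ x in A, (w x * ‖y x‖ - M * w x ^ 2) ∂μ ≤ 0 := by
      rw [integral_sub hint1 hint2]
      have := (le_abs_self _).trans hle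
      linarith
    have hpos : ∀ x ∈ A, 0 < w x * ‖y x‖ - M * w x ^ 2 := fun x hx => by
      have h2 : M * w x < ‖y x‖ := hx
      have := mul_lt_mul_of_pos_left h2 (hw0 x)
      nlinarith
    have hnn : 0 ≤ᵐ[μ.restrict A] fun x => w x * ‖y x‖ - M * w x ^ 2 := by
      filter_upwards [ae_restrict_mem₀ hAm] with x hx using (hpos x hx).le
    have hA0 : μ A = 0 := by
      by_contra hne
      have := (setIntegral_pos_iff_support_of_nonneg_ae hnn (hint1.sub hint2)).2
        ((pos_iff_ne_zero.2 hne).trans_le (measure_mono fun x hx => ⟨(hpos x hx).ne', hx⟩))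
      linarith
    filter_upwards [measure_eq_zero_iff_ae_notMem.1 hA0] with x hx
    rw [norm_div, norm_star, Complex.norm_real, Real.norm_of_nonneg (hw0 x).le,
      div_le_iff₀ (hw0 x)]
    exact not_lt.1 hx
  · simp_rw [hgw]
    have h1 := hy hu.toLp
    simp_rw [hinner u hu] at h1
    rw [← hinner' u hu]
    exact tendsto_nhds_unique h1 (hℓ.mono_left hU)

theorem hasDerivAt_iteratedDeriv_of_contDiffOn {h : ℝ → ℂ} {a : ℝ}
    (hh : ContDiffOn ℝ ((⊤ : ℕ∞) : WithTop ℕ∞) h (Ioi a)) (n : ℕ) {x : ℝ} (hx : a < x) :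
    HasDerivAt (iteratedDeriv n h) (iteratedDeriv (n + 1) h x) x := by
  have h1 := hh.differentiableOn_iteratedDerivWithin (m := n)
    (by exact_mod_cast ENat.natCast_lt_top n) (uniqueDiffOn_Ioi a)
  have h2 : DifferentiableOn ℝ (iteratedDeriv n h) (Ioi a) :=
    h1.congr fun y hy => (iteratedDerivWithin_of_isOpen isOpen_Ioi hy).symm
  rw [iteratedDeriv_succ]
  exact (h2.differentiableAt (Ioi_mem_nhds hx)).hasDerivAt

/-- When the centre u moves, the derivatives of consecutive terms telescope and only the one of
highest order survives. -/
theorem hasDerivAt_taylor_center {h : ℝ → ℂ} {a : ℝ}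
    (hh : ContDiffOn ℝ ((⊤ : ℕ∞) : WithTop ℕ∞) h (Ioi a)) (n : ℕ) (x : ℝ) {u : ℝ} (hu : a < u) :
    HasDerivAt (fun u => ∑ k ∈ Finset.range (n + 1),
        (((x - u) ^ k / k.factorial : ℝ) : ℂ) * iteratedDeriv k h u)
      ((((x - u) ^ n / n.factorial : ℝ) : ℂ) * iteratedDeriv (n + 1) h u) u := by
  induction n with
  | zero => simpa using hasDerivAt_iteratedDeriv_of_contDiffOn hh 0 hu
  | succ n ih =>
    have h1 : HasDerivAt (fun u : ℝ => (x - u) ^ (n + 1) / (n + 1).factorial)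
        (-((x - u) ^ n / n.factorial)) u := by
      have := (((hasDerivAt_id u).const_sub x).pow (n + 1)).div_const ((n + 1).factorial : ℝ)
      refine this.congr_deriv ?_
      rw [Nat.factorial_succ]
      push_cast
      have : (n.factorial : ℝ) ≠ 0 := by positivity
      have : (n + 1 : ℝ) ≠ 0 := by positivity
      simp
      field_simp
    have h2 := h1.ofReal_comp.mul (hasDerivAt_iteratedDeriv_of_contDiffOn hh (n + 1) hu)
    have h3 := ih.add h2
    simp_rw [Finset.sum_range_succ _ (n + 1)]
    refine h3.congr_deriv ?_
    push_cast
    ring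

/-- View the Taylor error at x as a function of the centre u. It vanishes at u = x, and the Widder
bound of order n + 1 dominates its derivative by that of (M/x)(1 − x/u)ⁿ⁺¹; at u = y this is
geometrically small. -/
theorem tendsto_taylor_of_widder {h : ℝ → ℂ} {M : ℝ}
    (hh : ContDiffOn ℝ ((⊤ : ℕ∞) : WithTop ℕ∞) h (Ioi 0))
    (hM : ∀ (n : ℕ) (s : ℝ), 0 < s → ‖(s ^ (n + 1) / n.factorial : ℝ) • iteratedDeriv n h s‖ ≤ M)
    {x y : ℝ} (hx : 0 < x) (hxy : x ≤ y) :
    Tendsto (fun n => ∑ k ∈ Finset.range n,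
      (((x - y) ^ k / k.factorial : ℝ) : ℂ) * iteratedDeriv k h y) atTop (𝓝 (h x)) := by
  rw [← tendsto_add_atTop_iff_nat 1, tendsto_iff_norm_sub_tendsto_zero]
  have hlim : Tendsto (fun n : ℕ => M / x * (1 - x / y) ^ (n + 1)) atTop (𝓝 0) := by
    rw [← mul_zero (M / x)]
    refine ((tendsto_add_atTop_iff_nat 1).2 (tendsto_pow_atTop_nhds_zero_of_lt_one ?_ ?_)).const_mul
      (M / x)
    · rw [sub_nonneg, div_le_one (hx.trans_le hxy)]; exact hxy
    · have := div_pos hx (hx.trans_le hxy); linarith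
  refine squeeze_zero (fun _ => norm_nonneg _) (fun n => ?_) hlim
  have hd : ∀ u ∈ Icc x y, HasDerivAt (fun u => ∑ k ∈ Finset.range (n + 1),
        (((x - u) ^ k / k.factorial : ℝ) : ℂ) * iteratedDeriv k h u - h x)
      ((((x - u) ^ n / n.factorial : ℝ) : ℂ) * iteratedDeriv (n + 1) h u) u :=
    fun u hu => (hasDerivAt_taylor_center hh n x (hx.trans_le hu.1)).sub_const _
  have hB : ∀ u ∈ Icc x y, HasDerivAt (fun u => M / x * (1 - x / u) ^ (n + 1))
      (M * (n + 1) * (u - x) ^ n / u ^ (n + 2)) u := fun u hu => by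
    have hu0 : u ≠ 0 := (hx.trans_le hu.1).ne'
    have h1 := ((((hasDerivAt_inv hu0).const_mul x).const_sub 1).pow (n + 1)).const_mul (M / x)
    refine h1.congr_deriv ?_
    have : 1 - x * u⁻¹ = (u - x) / u := by field_simp
    simp only [Nat.add_sub_cancel, this, div_pow]
    push_cast
    field_simp
    ring
  refine image_norm_le_of_norm_deriv_right_le_deriv_boundary'
    (fun u hu => (hd u hu).continuousAt.continuousWithinAt)
    (fun u hu => (hd u (Ico_subset_Icc_self hu)).hasDerivWithinAt) ?_
    (fun u hu => (hB u hu).continuousAt.continuousWithinAt)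
    (fun u hu => (hB u (Ico_subset_Icc_self hu)).hasDerivWithinAt) (fun u hu => ?_)
    (right_mem_Icc.2 hxy)
  · simp [Finset.sum_range_succ', hx.ne']
  · have hu0 : 0 < u := hx.trans_le hu.1
    have h1 := hM (n + 1) u hu0
    rw [norm_smul, Real.norm_of_nonneg (by positivity)] at h1
    rw [norm_mul, Complex.norm_real, norm_div, norm_pow, Real.norm_natCast, Real.norm_eq_abs,
      abs_sub_comm, abs_of_nonneg (sub_nonneg.2 hu.1)]
    have hux : 0 ≤ u - x := sub_nonneg.2 hu.1
    calc (u - x) ^ n / n.factorial * ‖iteratedDeriv (n + 1) h u‖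
        = (u - x) ^ n * (n + 1) / u ^ (n + 2) *
          (u ^ (n + 1 + 1) / (n + 1).factorial * ‖iteratedDeriv (n + 1) h u‖) := by
          rw [Nat.factorial_succ]
          push_cast
          field_simp
      _ ≤ (u - x) ^ n * (n + 1) / u ^ (n + 2) * M := by gcongr
      _ = _ := by ring

end NonlocalODE

/-! ### Widder's theorem -/

namespace NonlocalODE

theorem integral_exp_neg_mul_Icc {s : ℝ} (hs : s ≠ 0) (a b : ℝ) :
    ∫ t in a..b, Complex.exp (-s * t) = (Complex.exp (-s * a) - Complex.exp (-s * b)) / s := by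
  have := integral_exp_mul_complex (a := a) (b := b) (c := (-s : ℂ)) (by simpa using hs)
  rw [this, div_neg, ← neg_div, neg_sub]

/-- On each interval [n/N, (n+1)/N) the integrand is a constant times an exponential, so the
transform of a step function is a power series in e^{-s/N}. -/
theorem integral_exp_mul_step {c : ℕ → ℂ} {M : ℝ} (hc : ∀ n, ‖c n‖ ≤ M) {N s : ℝ} (hN : 0 < N)
    (hs : 0 < s) {S : ℂ}
    (hS : Tendsto (fun K => ∑ n ∈ Finset.range K, c n * (Real.exp (-s / N) : ℂ) ^ n) atTop (𝓝 S)) :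
    laplace (fun t => c ⌊N * t⌋₊) s = (1 - Real.exp (-s / N)) / s * S := by
  set F : ℝ → ℂ := fun t => Complex.exp (-s * t) * c ⌊N * t⌋₊ with hF
  have hmeas : Measurable fun t : ℝ => c ⌊N * t⌋₊ :=
    measurable_from_nat.comp (Nat.measurable_floor.comp (measurable_const_mul N))
  have hint : IntegrableOn F (Ioi 0) := by
    have h1 : MemExpBdd 0 (fun t => c ⌊N * t⌋₊) :=
      ⟨hmeas.aestronglyMeasurable, M, Eventually.of_forall fun t => by simpa using hc _⟩
    exact h1.integrableOn_laplace (s := s) (by simpa using hs)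
  have hpiece : ∀ n : ℕ, ∫ t in (n / N : ℝ)..((n + 1 : ℕ) / N : ℝ), F t =
      (1 - Real.exp (-s / N)) / s * (c n * (Real.exp (-s / N) : ℂ) ^ n) := fun n => by
    have hle : (n / N : ℝ) ≤ ((n + 1 : ℕ) / N : ℝ) := by gcongr; simp
    have h1 : ∫ t in (n / N : ℝ)..((n + 1 : ℕ) / N : ℝ), F t =
        ∫ t in (n / N : ℝ)..((n + 1 : ℕ) / N : ℝ), Complex.exp (-s * t) * c n := by
      rw [intervalIntegral.integral_of_le hle, intervalIntegral.integral_of_le hle,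
        integral_Ioc_eq_integral_Ioo, integral_Ioc_eq_integral_Ioo]
      refine setIntegral_congr_fun measurableSet_Ioo fun t ht => ?_
      have : ⌊N * t⌋₊ = n := by
        have h1 := (div_lt_iff₀' hN).1 ht.1
        have h2 := (lt_div_iff₀' hN).1 ht.2
        rw [Nat.floor_eq_iff ((Nat.cast_nonneg n).trans h1.le)]
        push_cast at h2
        exact ⟨h1.le, h2⟩
      simp only [hF, this]
    rw [h1, intervalIntegral.integral_mul_const, integral_exp_neg_mul_Icc hs.ne']
    have e1 : Complex.exp (-s * ((n / N : ℝ) : ℂ)) = (Real.exp (-s / N) : ℂ) ^ n := by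
      rw [← Complex.ofReal_pow, ← Real.exp_nat_mul, Complex.ofReal_exp]
      congr 1
      push_cast
      ring
    have e2 : Complex.exp (-s * (((n + 1 : ℕ) / N : ℝ) : ℂ)) = (Real.exp (-s / N) : ℂ) ^ (n + 1) := by
      rw [← Complex.ofReal_pow, ← Real.exp_nat_mul, Complex.ofReal_exp]
      congr 1
      push_cast
      ring
    rw [e1, e2]
    ring
  have hsum : ∀ K : ℕ, ∫ t in (0 : ℝ)..(K / N : ℝ), F t =
      (1 - Real.exp (-s / N)) / s * ∑ n ∈ Finset.range K, c n * (Real.exp (-s / N) : ℂ) ^ n := by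
    intro K
    have := intervalIntegral.sum_integral_adjacent_intervals (f := F) (μ := volume)
      (a := fun n : ℕ => (n / N : ℝ)) (n := K) (fun n _ => by
        rw [intervalIntegrable_iff_integrableOn_Ioc_of_le (by gcongr; simp)]
        exact hint.mono_set fun t ht => lt_of_le_of_lt (by positivity) ht.1)
    simp only [Nat.cast_zero, zero_div] at this
    rw [← this, Finset.mul_sum]
    exact Finset.sum_congr rfl fun n _ => hpiece n
  have hlim := intervalIntegral_tendsto_integral_Ioi (l := atTop) (b := fun K : ℕ => (K / N : ℝ)) 0
    hint (tendsto_natCast_atTop_atTop.atTop_div_const hN)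
  simp_rw [hsum] at hlim
  exact tendsto_nhds_unique hlim (hS.const_mul _)

theorem tendsto_mul_one_sub_exp (s : ℝ) :
    Tendsto (fun n : ℕ => ((n : ℝ) + 1) * (1 - Real.exp (-s / (n + 1)))) atTop (𝓝 s) := by
  have h1 : HasDerivAt (fun u : ℝ => 1 - Real.exp (-s * u)) s 0 := by
    have := (((hasDerivAt_id (0 : ℝ)).const_mul (-s)).exp).const_sub 1
    simpa using this
  have h2 := h1.tendsto_slope_zero_right.comp
    (tendsto_nhdsWithin_iff.2 ⟨tendsto_one_div_add_atTop_nhds_zero_nat (𝕜 := ℝ),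
      Eventually.of_forall fun n => by simp only [mem_Ioi]; positivity⟩)
  refine h2.congr fun n => ?_
  simp [div_eq_mul_inv]

/-- **Widder's theorem** at abscissa `0`. -/
theorem exists_laplace_eq_of_memWidder_zero {h : ℝ → ℂ} {M : ℝ}
    (hh : ContDiffOn ℝ ((⊤ : ℕ∞) : WithTop ℕ∞) h (Ioi 0))
    (hM : ∀ (n : ℕ) (s : ℝ), 0 < s →
      ‖(s ^ (n + 1) / n.factorial : ℝ) • iteratedDeriv n h s‖ ≤ M) :
    ∃ φ : ℝ → ℂ, AEStronglyMeasurable φ (volume.restrict (Ioi (0 : ℝ))) ∧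
      (∀ᵐ t ∂(volume.restrict (Ioi (0 : ℝ))), ‖φ t‖ ≤ M) ∧
      ∀ s : ℝ, 0 < s → laplace φ s = h s := by
  -- Bounded by M by the Widder condition at s = N + 1. The sum of c N n qⁿ is N + 1 times the
  -- Taylor series of h centred at N + 1, evaluated at (N + 1)(1 − q).
  let c : ℕ → ℕ → ℂ := fun N n =>
    (((-1) ^ n * ((N + 1 : ℝ) ^ (n + 1) / n.factorial) : ℝ) : ℂ) * iteratedDeriv n h (N + 1)
  have hc : ∀ N n, ‖c N n‖ ≤ M := fun N n => by
    have h1 := hM n (N + 1) (by positivity)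
    rw [norm_smul] at h1
    simpa [c, norm_mul, Real.norm_eq_abs, ← Complex.ofReal_natCast, ← Complex.ofReal_one,
      ← Complex.ofReal_add, Complex.norm_real, -Complex.ofReal_natCast, -Complex.ofReal_one,
      -Complex.ofReal_add] using h1
  have hw : MemLp (fun t : ℝ => (1 + t ^ 2)⁻¹) 2 (volume.restrict (Ioi (0 : ℝ))) := by
    have hcont : Continuous fun t : ℝ => (1 + t ^ 2)⁻¹ :=
      Continuous.inv₀ (by fun_prop) fun t => by positivity
    rw [memLp_two_iff_integrable_sq hcont.aestronglyMeasurable]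
    refine (integrable_inv_one_add_sq.integrableOn (s := Ioi 0)).mono'
      (hcont.pow 2).aestronglyMeasurable (Eventually.of_forall fun t => ?_)
    rw [Real.norm_of_nonneg (by positivity), sq]
    exact mul_le_of_le_one_left (by positivity) (inv_le_one_of_one_le₀ (by nlinarith [sq_nonneg t]))
  obtain ⟨φ, hφm, hφM, hφ⟩ := exists_weak_clusterPt_of_bounded
    (μ := volume.restrict (Ioi (0 : ℝ))) (φ := fun N t => c N ⌊((N : ℝ) + 1) * t⌋₊) (M := M)
    (fun N => ((measurable_from_nat (f := c N)).comp
      (Nat.measurable_floor.comp (measurable_const_mul ((N : ℝ) + 1)))).aestronglyMeasurable)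
    (fun N t => hc N _) hw (fun t => by positivity)
  refine ⟨φ, hφm, hφM, fun s hs => ?_⟩
  -- Chosen so that the weight (1 + t²)⁻¹ times `u` is the Laplace kernel e^{-st}.
  let u : ℝ → ℂ := fun t => (((1 + t ^ 2) * Real.exp (-s * t) : ℝ) : ℂ)
  have hu : MemLp u 2 (volume.restrict (Ioi (0 : ℝ))) := by
    have hcont : Continuous u := by fun_prop
    rw [memLp_two_iff_integrable_sq_norm hcont.aestronglyMeasurable]
    have h0 := integrableOn_pow_mul_exp_neg (a := 2 * s) (by positivity) 0
    have h2 := integrableOn_pow_mul_exp_neg (a := 2 * s) (by positivity) 2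
    have h4 := integrableOn_pow_mul_exp_neg (a := 2 * s) (by positivity) 4
    refine ((h0.add (h2.const_mul 2)).add h4).congr (Eventually.of_forall fun t => ?_)
    simp only [u, Complex.norm_real, Real.norm_eq_abs, sq_abs, Pi.add_apply]
    rw [mul_pow, sq (Real.exp _), ← Real.exp_add, show -s * t + -s * t = -(2 * s) * t by ring]
    ring
  have hwu : ∀ (g : ℝ → ℂ), ∫ t in Ioi (0 : ℝ), g t * (((1 + t ^ 2)⁻¹ : ℝ) * u t) =
      laplace g s := fun g => by
    refine integral_congr_ae (Eventually.of_forall fun t => ?_)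
    have : (1 + t ^ 2 : ℂ) ≠ 0 := by
      have : (1 + t ^ 2 : ℝ) ≠ 0 := by positivity
      exact_mod_cast this
    simp only [u]
    push_cast
    field_simp
  rw [← hwu]
  refine hφ u hu _ ?_
  simp_rw [hwu]
  -- With q = e^{-s/(N+1)} and x_N = (N + 1)(1 − q), the transform is (x_N/s) h(x_N), and x_N → s.
  have hval : ∀ N : ℕ, laplace (fun t => c N ⌊((N : ℝ) + 1) * t⌋₊) s =
      (((N + 1 : ℝ) * (1 - Real.exp (-s / (N + 1))) : ℝ) : ℂ) / s *
        h ((N + 1 : ℝ) * (1 - Real.exp (-s / (N + 1)))) := fun N => by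
    have hN : (0 : ℝ) < N + 1 := by positivity
    have hlt : Real.exp (-s / (N + 1)) < 1 := by
      rw [Real.exp_lt_one_iff]
      exact div_neg_of_neg_of_pos (by linarith) hN
    have hT := tendsto_taylor_of_widder hh hM
      (x := (N + 1 : ℝ) * (1 - Real.exp (-s / (N + 1)))) (y := N + 1)
      (mul_pos hN (by linarith))
      (mul_le_of_le_one_right hN.le (by linarith [Real.exp_pos (-s / (N + 1))]))
    have := integral_exp_mul_step (c := c N) (hc N) hN hs
      (S := (N + 1 : ℝ) * h ((N + 1 : ℝ) * (1 - Real.exp (-s / (N + 1))))) (by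
        refine (hT.const_mul ((N + 1 : ℝ) : ℂ)).congr fun K => ?_
        rw [Finset.mul_sum]
        refine Finset.sum_congr rfl fun n _ => ?_
        simp only [c]
        rw [show (N + 1 : ℝ) * (1 - Real.exp (-s / (N + 1))) - (N + 1) =
          -1 * (N + 1) * Real.exp (-s / (N + 1)) by ring, mul_pow, mul_pow]
        push_cast
        ring)
    rw [this]
    push_cast
    ring
  simp_rw [hval]
  have hlim := tendsto_mul_one_sub_exp s
  have hcont : ContinuousAt h s := (hh.continuousOn.continuousAt (Ioi_mem_nhds hs))
  have h1 := ((Complex.continuous_ofReal.tendsto _).comp hlim).div_const (s : ℂ)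
  have h2 := h1.mul (hcont.tendsto.comp hlim)
  rw [div_self (by exact_mod_cast hs.ne'), one_mul] at h2
  exact h2

theorem iteratedDeriv_comp_add_right (h : ℝ → ℂ) (a : ℝ) (n : ℕ) (x : ℝ) :
    iteratedDeriv n (fun y => h (y + a)) x = iteratedDeriv n h (x + a) := by
  simp [iteratedDeriv_comp_add_const]

/-- **Widder's theorem**. -/
theorem MemWidder.exists_laplace_eq {ω : ℝ} {h : ℝ → ℂ} (hh : MemWidder ω h) :
    ∃ φ : ℝ → ℂ, MemExpBdd ω φ ∧ ∀ s : ℝ, ω < s → laplace φ s = h s := by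
  obtain ⟨hsm, M, hM⟩ := hh
  obtain ⟨φ, hφm, hφM, hφ⟩ := exists_laplace_eq_of_memWidder_zero (h := fun x => h (x + ω)) (M := M)
    (hsm.comp (contDiff_id.add contDiff_const).contDiffOn fun x hx => by simpa using hx)
    (fun n s hs => by
      rw [iteratedDeriv_comp_add_right]
      simpa using hM n (s + ω) (by linarith))
  refine ⟨fun t => Real.exp (ω * t) * φ t, ⟨?_, M, ?_⟩, fun s hs => ?_⟩
  · exact (by fun_prop : Continuous fun t : ℝ => ((Real.exp (ω * t) : ℝ) : ℂ)).aestronglyMeasurable.mul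
      hφm
  · filter_upwards [hφM] with t ht
    rw [← mul_assoc, ← Complex.ofReal_mul, ← Real.exp_add]
    simpa using ht
  · have := hφ (s - ω) (by linarith)
    rw [sub_add_cancel] at this
    rw [← this]
    refine integral_congr_ae (Eventually.of_forall fun t => ?_)
    simp only
    rw [← mul_assoc, Complex.ofReal_exp, ← Complex.exp_add]
    push_cast
    ring_nf

end NonlocalODE

/-! ### Plancherel and Bromwich inversion in L² -/

namespace NonlocalODE

open scoped FourierTransform SchwartzMap

/-- The Plancherel transform is compatible with that of tempered distributions, and the Fourier
integral obeys the multiplication formula ∫ 𝓕θ · g = ∫ θ · 𝓕g; so both sides have the same integral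
against every test function. -/
theorem fourier_toLp_ae_eq {g : ℝ → ℂ} (h1 : Integrable g) (h2 : MemLp g 2) :
    (𝓕 h2.toLp : Lp (α := ℝ) ℂ 2 volume) =ᵐ[volume] 𝓕 g := by
  refine ae_eq_of_integral_contDiff_smul_eq ((Lp.memLp _).locallyIntegrable (by norm_num))
    (VectorFourier.fourierIntegral_continuous Real.continuous_fourierChar
      continuous_inner h1).locallyIntegrable fun η hη hηs => ?_
  have hc : HasCompactSupport (Complex.ofRealCLM ∘ η) := hηs.comp_left rfl
  have hs : ContDiff ℝ ((⊤ : ℕ∞) : WithTop ℕ∞) (Complex.ofRealCLM ∘ η) := by fun_prop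
  let θ : 𝓢(ℝ, ℂ) := hc.toSchwartzMap hs
  have e1 : ∫ x, η x • (𝓕 h2.toLp : Lp (α := ℝ) ℂ 2 volume) x =
      Lp.toTemperedDistribution (𝓕 h2.toLp : Lp (α := ℝ) ℂ 2 volume) θ := by
    simp [θ]
  rw [e1, ← Lp.fourier_toTemperedDistribution_eq, TemperedDistribution.fourier_apply,
    Lp.toTemperedDistribution_apply]
  have e2 : ∫ x, η x • 𝓕 g x = ∫ x, θ x * 𝓕 g x := by simp [θ]
  have e3 := VectorFourier.integral_bilin_fourierIntegral_eq_flip (.mul ℂ ℂ) (L := innerₗ ℝ)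
    Real.continuous_fourierChar continuous_inner (θ.integrable (μ := volume)) h1
  rw [e2]
  have e4 : ∫ x, (𝓕 θ) x • (h2.toLp : Lp (α := ℝ) ℂ 2 volume) x = ∫ x, (𝓕 θ) x * g x :=
    integral_congr_ae (h2.coeFn_toLp.mono fun x hx => by
      simp only [smul_eq_mul]
      rw [hx])
  rw [e4]
  simpa using! e3

theorem fourierInv_toLp_ae_eq {g : ℝ → ℂ} (h1 : Integrable g) (h2 : MemLp g 2) :
    (𝓕⁻ h2.toLp : Lp (α := ℝ) ℂ 2 volume) =ᵐ[volume] 𝓕⁻ g := by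
  have hcont : Continuous (𝓕⁻ g) := VectorFourier.fourierIntegral_continuous
    Real.continuous_fourierChar (L := -innerₗ ℝ) (continuous_inner.neg) h1
  refine ae_eq_of_integral_contDiff_smul_eq ((Lp.memLp _).locallyIntegrable (by norm_num))
    hcont.locallyIntegrable fun η hη hηs => ?_
  have hc : HasCompactSupport (Complex.ofRealCLM ∘ η) := hηs.comp_left rfl
  have hs : ContDiff ℝ ((⊤ : ℕ∞) : WithTop ℕ∞) (Complex.ofRealCLM ∘ η) := by fun_prop
  let θ : 𝓢(ℝ, ℂ) := hc.toSchwartzMap hs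
  have e1 : ∫ x, η x • (𝓕⁻ h2.toLp : Lp (α := ℝ) ℂ 2 volume) x =
      Lp.toTemperedDistribution (𝓕⁻ h2.toLp : Lp (α := ℝ) ℂ 2 volume) θ := by
    simp [θ]
  rw [e1, ← Lp.fourierInv_toTemperedDistribution_eq, TemperedDistribution.fourierInv_apply,
    Lp.toTemperedDistribution_apply]
  have e2 : ∫ x, η x • 𝓕⁻ g x = ∫ x, θ x * 𝓕⁻ g x := by simp [θ]
  have e3 := VectorFourier.integral_bilin_fourierIntegral_eq_flip (.mul ℂ ℂ) (L := -innerₗ ℝ)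
    Real.continuous_fourierChar (continuous_inner.neg) (θ.integrable (μ := volume)) h1
  rw [e2]
  have e4 : ∫ x, (𝓕⁻ θ) x • (h2.toLp : Lp (α := ℝ) ℂ 2 volume) x = ∫ x, (𝓕⁻ θ) x * g x :=
    integral_congr_ae (h2.coeFn_toLp.mono fun x hx => by
      simp only [smul_eq_mul]
      rw [hx])
  rw [e4]
  have hflip : (-innerₗ ℝ).flip = -innerₗ ℝ := by
    ext; simp
  rw [hflip] at e3
  simpa [SchwartzMap.fourierInv_coe] using! e3

theorem tendsto_eLpNorm_indicator_compl_Ioc {F : ℝ → ℂ} (hF : MemLp F 2) :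
    Tendsto (fun A : ℝ => eLpNorm ((Ioc (-A) A)ᶜ.indicator F) 2) atTop (𝓝 0) := by
  have hfin := lintegral_rpow_enorm_lt_top_of_eLpNorm_lt_top (by norm_num) (by norm_num) hF.2
  simp_rw [eLpNorm_eq_lintegral_rpow_enorm_toReal (p := 2) (by norm_num) (by norm_num)]
  have key : Tendsto (fun A : ℝ => ∫⁻ x, ‖(Ioc (-A) A)ᶜ.indicator F x‖ₑ ^ (2 : ENNReal).toReal)
      atTop (𝓝 (∫⁻ _ : ℝ, 0)) := by
    refine tendsto_lintegral_filter_of_dominated_convergence'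
      (fun x => ‖F x‖ₑ ^ (2 : ENNReal).toReal)
      (Eventually.of_forall fun A => ?_) (Eventually.of_forall fun A => ?_) hfin.ne ?_
    · exact ((hF.1.indicator measurableSet_Ioc.compl).enorm).pow_const _
    · refine Eventually.of_forall fun x => ?_
      gcongr
      exact enorm_indicator_le_enorm_self _ _
    · refine Eventually.of_forall fun x => tendsto_const_nhds.congr' ?_
      filter_upwards [eventually_gt_atTop |x|] with A hA
      have : x ∈ Ioc (-A) A := ⟨(abs_lt.1 hA).1, (abs_lt.1 hA).2.le⟩
      simp [this]
  rw [lintegral_zero] at key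
  have := (ENNReal.continuous_rpow_const (y := 1 / (2 : ENNReal).toReal)).tendsto 0 |>.comp key
  simpa [Function.comp_def] using this

/-- The truncated Fourier inversion formula holds in `L²`. -/
theorem tendsto_eLpNorm_truncated_fourierInv {g : ℝ → ℂ} (h1 : Integrable g) (h2 : MemLp g 2) :
    Tendsto (fun A : ℝ => eLpNorm (fun t => 𝓕⁻ ((Ioc (-A) A).indicator (𝓕 g)) t - g t) 2)
      atTop (𝓝 0) := by
  have hF : MemLp (𝓕 g) 2 := (memLp_congr_ae (fourier_toLp_ae_eq h1 h2)).1 (Lp.memLp _)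
  have hcont : Continuous (𝓕 g) := VectorFourier.fourierIntegral_continuous
    Real.continuous_fourierChar continuous_inner h1
  refine (tendsto_eLpNorm_indicator_compl_Ioc hF).congr fun A => ?_
  have hi1 : Integrable ((Ioc (-A) A).indicator (𝓕 g)) :=
    (hcont.integrableOn_Ioc).integrable_indicator measurableSet_Ioc
  have hi2 : MemLp ((Ioc (-A) A).indicator (𝓕 g)) 2 := hF.indicator measurableSet_Ioc
  have hg : h2.toLp = 𝓕⁻ hF.toLp := by
    have : hF.toLp = 𝓕 h2.toLp :=
      Lp.ext (hF.coeFn_toLp.trans (fourier_toLp_ae_eq h1 h2).symm)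
    rw [this, FourierTransform.fourierInv_fourier_eq]
  -- The inversion error is the inverse transform of the truncation error of 𝓕 g, so Plancherel
  -- turns its norm into the tail of a square-integrable function.
  have e1 : eLpNorm (fun t => 𝓕⁻ ((Ioc (-A) A).indicator (𝓕 g)) t - g t) 2 =
      eLpNorm ((𝓕⁻ (hi2.toLp - hF.toLp) : Lp (α := ℝ) ℂ 2 volume)) 2 := by
    refine eLpNorm_congr_ae ?_
    have : (𝓕⁻ (hi2.toLp - hF.toLp) : Lp (α := ℝ) ℂ 2 volume) = 𝓕⁻ hi2.toLp - h2.toLp := by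
      rw [hg]
      exact (Lp.fourierTransformₗᵢ ℝ ℂ).symm.map_sub _ _
    rw [this]
    filter_upwards [Lp.coeFn_sub (𝓕⁻ hi2.toLp : Lp (α := ℝ) ℂ 2 volume) h2.toLp,
      fourierInv_toLp_ae_eq hi1 hi2, h2.coeFn_toLp] with t ht1 ht2 ht3
    rw [ht1, Pi.sub_apply, ht2, ht3]
  have e2 : eLpNorm ((𝓕⁻ (hi2.toLp - hF.toLp) : Lp (α := ℝ) ℂ 2 volume)) 2 =
      eLpNorm ((hi2.toLp - hF.toLp : Lp (α := ℝ) ℂ 2 volume)) 2 := by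
    rw [← Lp.enorm_def, ← Lp.enorm_def, ← ofReal_norm, ← ofReal_norm]
    congr 1
    exact (Lp.fourierTransformₗᵢ ℝ ℂ).symm.norm_map _
  rw [e1, e2]
  have e3 : (hi2.toLp - hF.toLp : Lp (α := ℝ) ℂ 2 volume) =ᵐ[volume]
      -((Ioc (-A) A)ᶜ.indicator (𝓕 g)) := by
    filter_upwards [Lp.coeFn_sub hi2.toLp hF.toLp, hi2.coeFn_toLp, hF.coeFn_toLp] with t a b c
    rw [a, Pi.sub_apply, b, c]
    by_cases ht : t ∈ Ioc (-A) A <;> simp [ht]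
  rw [eLpNorm_congr_ae e3, eLpNorm_neg]

/-- The function `e^{-ct} φ(t)`, extended by zero to the line. -/
noncomputable def expDamp (c : ℝ) (φ : ℝ → ℂ) : ℝ → ℂ :=
  (Ioi (0 : ℝ)).indicator fun t => Real.exp (-c * t) * φ t

theorem MemExpBdd.integrable_expDamp {ω c : ℝ} (hc : ω < c) {φ : ℝ → ℂ} (h : MemExpBdd ω φ) :
    Integrable (expDamp c φ) := by
  have := h.integrableOn_laplace (s := c) (by simpa using hc)
  refine (integrable_indicator_iff measurableSet_Ioi).2 (this.congr ?_)
  exact Eventually.of_forall fun t => by simp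

theorem MemExpBdd.memLp_expDamp {ω c : ℝ} (hc : ω < c) {φ : ℝ → ℂ} (h : MemExpBdd ω φ) :
    MemLp (expDamp c φ) 2 := by
  obtain ⟨C, hC0, hC⟩ := h.exists_bound
  have hint := h.integrable_expDamp hc
  rw [memLp_two_iff_integrable_sq_norm hint.1]
  refine (hint.norm.const_mul C).mono' (hint.1.norm.pow 2) ?_
  rw [ae_restrict_iff' measurableSet_Ioi] at hC
  filter_upwards [hC] with t ht
  rw [norm_pow, norm_norm, sq]
  gcongr
  by_cases h0 : t ∈ Ioi (0 : ℝ)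
  · rw [expDamp, indicator_of_mem h0, norm_mul, Complex.norm_real, Real.norm_eq_abs, Real.abs_exp]
    have h0' : (0 : ℝ) < t := h0
    calc Real.exp (-c * t) * ‖φ t‖ ≤ Real.exp (-c * t) * (C * Real.exp (ω * t)) := by
          gcongr; exact ht h0
      _ = C * Real.exp (-(c - ω) * t) := by
          rw [mul_left_comm, ← Real.exp_add]
          ring_nf
      _ ≤ C * 1 := by
          gcongr
          rw [Real.exp_le_one_iff]
          nlinarith
      _ = C := mul_one C
  · simp [expDamp, h0, hC0]

/-- Frequency ξ is height 2πξ on the line Re s = c; hence truncation at height N is truncation at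
frequency N/(2π). -/
theorem fourier_expDamp (c : ℝ) (φ : ℝ → ℂ) (ξ : ℝ) :
    𝓕 (expDamp c φ) ξ = laplace φ (c + 2 * Real.pi * ξ * Complex.I) := by
  rw [Real.fourier_real_eq_integral_exp_smul, laplace, ← integral_indicator measurableSet_Ioi]
  congr 1 with t
  by_cases h0 : t ∈ Ioi (0 : ℝ)
  · rw [expDamp, indicator_of_mem h0, indicator_of_mem h0, smul_eq_mul, ← mul_assoc,
      Complex.ofReal_exp, ← Complex.exp_add]
    push_cast
    ring_nf
  · simp [expDamp, h0]

/-- The truncated Bromwich integral is a truncated inverse Fourier integral. -/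
theorem bromwich_eq_fourierInv {F : ℂ → ℂ} {c : ℝ} {φ : ℝ → ℂ}
    (hF : ∀ᵐ y : ℝ, F (c + y * Complex.I) = laplace φ (c + y * Complex.I)) {N : ℝ} (hN : 0 ≤ N)
    (t : ℝ) :
    bromwich F c N t = Real.exp (c * t) *
      𝓕⁻ ((Ioc (-(N / (2 * Real.pi))) (N / (2 * Real.pi))).indicator (𝓕 (expDamp c φ))) t := by
  have hpi : (0 : ℝ) < 2 * Real.pi := by positivity
  have hA : -(N / (2 * Real.pi)) ≤ N / (2 * Real.pi) := by
    have : 0 ≤ N / (2 * Real.pi) := by positivity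
    linarith
  have e1 : 𝓕⁻ ((Ioc (-(N / (2 * Real.pi))) (N / (2 * Real.pi))).indicator (𝓕 (expDamp c φ))) t =
      ∫ ξ in (-(N / (2 * Real.pi)))..(N / (2 * Real.pi)),
        Complex.exp ((2 * Real.pi * ξ : ℝ) * t * Complex.I) *
          laplace φ (c + (2 * Real.pi * ξ : ℝ) * Complex.I) := by
    rw [Real.fourierInv_eq', intervalIntegral.integral_of_le hA,
      ← integral_indicator measurableSet_Ioc]
    congr 1 with ξ
    by_cases h : ξ ∈ Ioc (-(N / (2 * Real.pi))) (N / (2 * Real.pi))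
    · rw [indicator_of_mem h, indicator_of_mem h, fourier_expDamp, smul_eq_mul]
      congr 2
      · simp
        ring
      · push_cast; ring
    · simp [h]
  have e2 := intervalIntegral.integral_comp_mul_left (a := -(N / (2 * Real.pi)))
    (b := N / (2 * Real.pi)) (fun y : ℝ => Complex.exp ((y : ℂ) * t * Complex.I) *
          laplace φ (c + (y : ℝ) * Complex.I)) hpi.ne'
  have hb : 2 * Real.pi * (N / (2 * Real.pi)) = N := by field_simp
  rw [mul_neg, hb] at e2
  rw [e1, e2, bromwich]
  have e3 : ∫ y in (-N)..N, Complex.exp ((c + y * Complex.I) * t) * F (c + y * Complex.I) *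
      Complex.I = ∫ y in (-N)..N, (Complex.I * Complex.exp (c * t)) *
        (Complex.exp ((y : ℂ) * t * Complex.I) * laplace φ (c + (y : ℝ) * Complex.I)) := by
    refine intervalIntegral.integral_congr_ae (hF.mono fun y hy _ => ?_)
    rw [hy, add_mul, Complex.exp_add, show (y : ℂ) * Complex.I * t = y * t * Complex.I by ring]
    ring
  rw [e3, intervalIntegral.integral_const_mul, Complex.real_smul]
  have : (Real.pi : ℂ) ≠ 0 := by exact_mod_cast Real.pi_ne_zero
  push_cast
  field_simp

/-- The Bromwich inversion formula holds in `L²` on bounded intervals. -/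
theorem MemExpBdd.tendsto_eLpNorm_bromwich {ω c : ℝ} (hc : ω < c) {φ : ℝ → ℂ}
    (h : MemExpBdd ω φ) {F : ℂ → ℂ}
    (hF : ∀ᵐ y : ℝ, F (c + y * Complex.I) = laplace φ (c + y * Complex.I)) (T : ℝ) :
    Tendsto (fun N : ℝ => eLpNorm (fun t => bromwich F c N t - φ t) 2
      (volume.restrict (Ioo 0 T))) atTop (𝓝 0) := by
  have hlim := (tendsto_eLpNorm_truncated_fourierInv (h.integrable_expDamp hc)
    (h.memLp_expDamp hc)).comp (tendsto_id.atTop_div_const (by positivity : 0 < 2 * Real.pi))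
  -- Undoing the damping multiplies by e^{ct}, which is at most e^{|c|T} on (0, T) whatever the sign
  -- of c.
  have hlim2 := ENNReal.Tendsto.const_mul (a := ENNReal.ofReal (Real.exp (|c| * T))) hlim
    (Or.inr ENNReal.ofReal_ne_top)
  rw [mul_zero] at hlim2
  refine tendsto_of_tendsto_of_tendsto_of_le_of_le' tendsto_const_nhds hlim2
    (Eventually.of_forall fun _ => zero_le) ?_
  filter_upwards [eventually_ge_atTop 0] with N hN
  refine le_trans ?_ (mul_le_mul_right (eLpNorm_mono_measure _ (Measure.restrict_le_self (s := Ioo 0 T))) _)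
  refine eLpNorm_le_mul_eLpNorm_of_ae_le_mul ?_ 2
  filter_upwards [ae_restrict_mem measurableSet_Ioo] with t ht
  have e : φ t = Real.exp (c * t) * expDamp c φ t := by
    rw [expDamp, indicator_of_mem (show t ∈ Ioi (0 : ℝ) from ht.1), ← mul_assoc,
      ← Complex.ofReal_mul, ← Real.exp_add]
    simp
  rw [bromwich_eq_fourierInv hF hN, e, ← mul_sub, norm_mul, Complex.norm_real, Real.norm_eq_abs,
    Real.abs_exp]
  simp only [id]
  have : c * t ≤ |c| * T := by
    calc c * t ≤ |c| * t := by gcongr; exacts [ht.1.le, le_abs_self c]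
      _ ≤ |c| * T := by gcongr; exact ht.2.le
  gcongr

/-- Uniqueness of the Laplace transform. -/
theorem MemExpBdd.ae_eq_of_laplace_eq {ω : ℝ} {φ ψ : ℝ → ℂ} (hφ : MemExpBdd ω φ)
    (hψ : MemExpBdd ω ψ) (h : ∀ s : ℂ, ω < s.re → laplace φ s = laplace ψ s) :
    φ =ᵐ[volume.restrict (Ioi (0 : ℝ))] ψ := by
  have hc : ω < ω + 1 := by linarith
  have hF : 𝓕 (expDamp (ω + 1) φ) = 𝓕 (expDamp (ω + 1) ψ) := by
    ext ξ
    rw [fourier_expDamp, fourier_expDamp, h]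
    simp
  have h1 := fourier_toLp_ae_eq (hφ.integrable_expDamp hc) (hφ.memLp_expDamp hc)
  have h2 := fourier_toLp_ae_eq (hψ.integrable_expDamp hc) (hψ.memLp_expDamp hc)
  rw [hF] at h1
  have h3 := (Lp.fourierTransformₗᵢ ℝ ℂ).injective (Lp.ext (h1.trans h2.symm))
  rw [MemLp.toLp_eq_toLp_iff] at h3
  rw [Filter.EventuallyEq, ae_restrict_iff' measurableSet_Ioi]
  filter_upwards [h3] with t ht h0
  rw [expDamp, expDamp, indicator_of_mem h0, indicator_of_mem h0] at ht
  exact mul_left_cancel₀ (by exact_mod_cast (Real.exp_pos _).ne') ht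

end NonlocalODE

/-! ### The Riemann–Lebesgue lemma and the Dirichlet integral -/

namespace NonlocalODE

/-- The Riemann-Lebesgue lemma for the sine transform. -/
theorem tendsto_integral_mul_sin {f : ℝ → ℂ} (hf : Integrable f) :
    Tendsto (fun l : ℝ => ∫ x, f x * (Real.sin (l * x) : ℂ)) atTop (𝓝 0) := by
  have h0 := Real.tendsto_integral_exp_smul_cocompact f
  have hpi : 0 < 2 * Real.pi := by positivity
  have ht : Tendsto (fun l : ℝ => l / (2 * Real.pi)) atTop atTop :=
    tendsto_id.atTop_div_const hpi
  have h1 := h0.comp (ht.mono_right atTop_le_cocompact)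
  have h2 := h0.comp ((tendsto_neg_atTop_atBot.comp ht).mono_right atBot_le_cocompact)
  have h3 := ((h2.sub h1).mul_const (-Complex.I / 2 : ℂ))
  rw [sub_zero, zero_mul] at h3
  refine h3.congr fun l => ?_
  have hint : ∀ w : ℝ, Integrable fun v : ℝ => Real.fourierChar (-(v * w)) • f v := fun w => by
    simpa [mul_comm] using (Real.fourierIntegral_convergent_iff (μ := volume) w).2 hf
  simp only [Function.comp_apply]
  rw [← integral_sub (hint _) (hint _), ← integral_mul_const]
  congr 1 with x
  rw [Circle.smul_def, Circle.smul_def, Real.fourierChar_apply, Real.fourierChar_apply]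
  have hpi' : (Real.pi : ℂ) ≠ 0 := by exact_mod_cast Real.pi_ne_zero
  have e1 : ((2 * Real.pi * -(x * -(l / (2 * Real.pi))) : ℝ) : ℂ) * Complex.I =
      (l * x : ℂ) * Complex.I := by
    push_cast
    field_simp
  have e2 : ((2 * Real.pi * -(x * (l / (2 * Real.pi))) : ℝ) : ℂ) * Complex.I =
      -(l * x : ℂ) * Complex.I := by
    push_cast
    field_simp
  rw [e1, e2, Complex.ofReal_sin, Complex.sin]
  push_cast
  simp only [smul_eq_mul]
  ring

/-- Makes 1/sin x − 1/x integrable on (0, π/2), so that replacing sin x by x in the Dirichlet kernel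
costs only a Riemann–Lebesgue term. The value of the constant is immaterial. -/
theorem inv_sin_sub_inv_bound {x : ℝ} (h0 : 0 < x) (h1 : x < Real.pi / 2) :
    |(Real.sin x)⁻¹ - x⁻¹| ≤ Real.pi := by
  have hs : 0 < Real.sin x := Real.sin_pos_of_pos_of_lt_pi h0 (by linarith)
  have hle : Real.sin x ≤ x := (Real.sin_lt h0).le
  have h2 : 2 / Real.pi * x ≤ Real.sin x := Real.mul_le_sin h0.le h1.le
  have hcos : 0 < Real.cos x := Real.cos_pos_of_mem_Ioo ⟨by linarith, h1⟩
  have h3 : x * Real.cos x ≤ Real.sin x := by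
    have := Real.lt_tan h0 h1
    rw [Real.tan_eq_sin_div_cos, lt_div_iff₀ hcos] at this
    exact this.le
  have h4 := Real.one_sub_sq_div_two_le_cos (x := x)
  have hpi := Real.pi_pos
  have h5 : x ≤ Real.pi / 2 * Real.sin x := by
    calc x = Real.pi / 2 * (2 / Real.pi * x) := by field_simp
      _ ≤ _ := by gcongr
  have hx2 : x < 2 := by linarith [Real.pi_lt_four]
  rw [inv_sub_inv hs.ne' h0.ne', abs_of_nonneg (div_nonneg (by linarith) (by positivity)),
    div_le_iff₀ (by positivity)]
  have h6 : x - Real.sin x ≤ x * (x ^ 2 / 2) := by nlinarith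
  have h7 : x * (x ^ 2 / 2) ≤ x * x := by nlinarith [mul_pos h0 h0]
  calc x - Real.sin x ≤ x * x := h6.trans h7
    _ ≤ Real.pi / 2 * Real.sin x * x := by gcongr
    _ ≤ Real.pi * (Real.sin x * x) := by nlinarith [mul_pos (mul_pos hpi hs) h0]

/-- The kernel is 1 + 2 Σ_{k=1}^n cos 2kx, and each cosine integrates to zero over [0, π/2]. -/
theorem exists_dirichlet_kernel (n : ℕ) : ∃ D : ℝ → ℝ, Continuous D ∧
    (∀ x, D x * Real.sin x = Real.sin ((2 * n + 1) * x)) ∧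
    ∫ x in (0 : ℝ)..Real.pi / 2, D x = Real.pi / 2 := by
  induction n with
  | zero => exact ⟨fun _ => 1, continuous_const, fun x => by simp, by simp⟩
  | succ n ih =>
    obtain ⟨D, hc, hD, hi⟩ := ih
    refine ⟨fun x => D x + 2 * Real.cos ((2 * n + 2) * x), by fun_prop, fun x => ?_, ?_⟩
    · rw [add_mul, hD]
      have h1 : Real.sin ((2 * ((n + 1 : ℕ) : ℝ) + 1) * x) =
          Real.sin ((2 * n + 2) * x + x) := by push_cast; ring_nf
      have h2 : Real.sin ((2 * n + 1) * x) = Real.sin ((2 * n + 2) * x - x) := by ring_nf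
      rw [h1, h2, Real.sin_add, Real.sin_sub]
      ring
    · rw [intervalIntegral.integral_add (hc.intervalIntegrable _ _)
        (Continuous.intervalIntegrable (by fun_prop) _ _), hi, intervalIntegral.integral_const_mul,
        intervalIntegral.integral_comp_mul_left (fun x => Real.cos x) (by positivity), integral_cos,
        show (2 * (n : ℝ) + 2) * (Real.pi / 2) = ((n + 1 : ℕ) : ℝ) * Real.pi by push_cast; ring,
        Real.sin_nat_mul_pi]
      simp

theorem integral_scaled_sinc {l : ℝ} (hl : 0 < l) (a b : ℝ) :
    ∫ u in a..b, l * Real.sinc (l * u) = ∫ u in (l * a)..(l * b), Real.sinc u := by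
  rw [intervalIntegral.integral_const_mul, intervalIntegral.integral_comp_mul_left _ hl.ne',
    smul_eq_mul, ← mul_assoc, mul_inv_cancel₀ hl.ne', one_mul]

theorem scaled_sinc_eq (l : ℝ) {u : ℝ} (hu : u ≠ 0) :
    l * Real.sinc (l * u) = Real.sin (l * u) * u⁻¹ := by
  rcases eq_or_ne l 0 with rfl | hl
  · simp
  · rw [Real.sinc_of_ne_zero (mul_ne_zero hl hu)]
    field_simp

/-- The integral of sin((2n+1)x)/sin x over [0, π/2] is π/2 for every n. Replacing sin x by x in the
denominator changes it by the sine transform of a bounded function, which tends to 0. -/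
theorem tendsto_integral_sinc_odd :
    Tendsto (fun n : ℕ => ∫ u in (0 : ℝ)..((2 * n + 1) * (Real.pi / 2)), Real.sinc u) atTop
      (𝓝 (Real.pi / 2)) := by
  have hpi := Real.pi_pos
  let k : ℝ → ℂ := (Ioo 0 (Real.pi / 2)).indicator fun x => (((Real.sin x)⁻¹ - x⁻¹ : ℝ) : ℂ)
  have hk : Integrable k := by
    refine (integrable_indicator_iff measurableSet_Ioo).2 ?_
    refine Measure.integrableOn_of_bounded (M := Real.pi) (by simp) (by fun_prop) ?_
    filter_upwards [ae_restrict_mem measurableSet_Ioo] with x hx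
    rw [Complex.norm_real]
    exact inv_sin_sub_inv_bound hx.1 hx.2
  have hlim := (tendsto_integral_mul_sin hk).comp (tendsto_atTop_add_const_right atTop (1 : ℝ)
    (tendsto_natCast_atTop_atTop.const_mul_atTop (two_pos : (0 : ℝ) < 2)))
  have key : ∀ n : ℕ, ∫ x, k x * (Real.sin ((2 * (n : ℝ) + 1) * x) : ℂ) =
      ((Real.pi / 2 - ∫ u in (0 : ℝ)..((2 * n + 1) * (Real.pi / 2)), Real.sinc u : ℝ) : ℂ) := by
    intro n
    obtain ⟨D, hc, hD, hi⟩ := exists_dirichlet_kernel n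
    have hn : (0 : ℝ) < 2 * n + 1 := by positivity
    have e1 := integral_scaled_sinc hn 0 (Real.pi / 2)
    rw [mul_zero] at e1
    rw [← e1]
    nth_rw 1 [← hi]
    have hsc : Continuous fun u : ℝ => (2 * (n : ℝ) + 1) * Real.sinc ((2 * n + 1) * u) :=
      continuous_const.mul (Real.continuous_sinc.comp (continuous_const.mul continuous_id))
    rw [← intervalIntegral.integral_sub (hc.intervalIntegrable _ _)
      (hsc.intervalIntegrable _ _),
      intervalIntegral.integral_of_le (by positivity), integral_Ioc_eq_integral_Ioo,
      ← integral_complex_ofReal, ← integral_indicator measurableSet_Ioo]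
    congr 1 with x
    by_cases hx : x ∈ Ioo 0 (Real.pi / 2)
    · have hs : Real.sin x ≠ 0 := (Real.sin_pos_of_pos_of_lt_pi hx.1 (by linarith [hx.2])).ne'
      simp only [k, indicator_of_mem hx]
      rw [← Complex.ofReal_mul, scaled_sinc_eq _ hx.1.ne', ← hD]
      congr 1
      field_simp
    · simp [k, hx]
  have h2 : Tendsto (fun n : ℕ => Real.pi / 2 -
      ∫ u in (0 : ℝ)..((2 * n + 1) * (Real.pi / 2)), Real.sinc u) atTop (𝓝 0) := by
    have h3 := (Complex.continuous_re.tendsto _).comp (hlim.congr key)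
    simpa [Function.comp_def, -Complex.ofReal_sub] using h3
  simpa using (h2.const_sub (Real.pi / 2))

/-- The Dirichlet integral. -/
theorem tendsto_integral_sinc :
    Tendsto (fun x : ℝ => ∫ u in (0 : ℝ)..x, Real.sinc u) atTop (𝓝 (Real.pi / 2)) := by
  have hpi := Real.pi_pos
  -- Both x and the odd multiple (2N + 1)π/2 lie in [Nπ, (N + 1)π], where |sinc| ≤ 1/(Nπ).
  let N : ℝ → ℕ := fun x => ⌊x / Real.pi⌋₊
  have hN : Tendsto N atTop atTop :=
    tendsto_nat_floor_atTop.comp (tendsto_id.atTop_div_const hpi)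
  have h1 := tendsto_integral_sinc_odd.comp hN
  have hii : ∀ a b : ℝ, IntervalIntegrable Real.sinc volume a b :=
    fun a b => Real.continuous_sinc.intervalIntegrable a b
  have h2 : Tendsto (fun x : ℝ => ∫ u in ((2 * (N x : ℝ) + 1) * (Real.pi / 2))..x, Real.sinc u)
      atTop (𝓝 0) := by
    have hb : Tendsto (fun x : ℝ => (N x * Real.pi)⁻¹ * Real.pi) atTop (𝓝 0) := by
      have := (((tendsto_natCast_atTop_atTop (R := ℝ)).comp hN).atTop_mul_const
        hpi).inv_tendsto_atTop.mul_const Real.pi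
      simpa using this
    refine squeeze_zero_norm' ?_ hb
    filter_upwards [eventually_ge_atTop Real.pi] with x hx
    have hx0 : 0 < x := hpi.trans_le hx
    have hN1 : (1 : ℝ) ≤ N x := by
      have : 1 ≤ N x := by
        rw [Nat.one_le_floor_iff, le_div_iff₀ hpi]
        simpa using hx
      exact_mod_cast this
    have hfl : (N x : ℝ) * Real.pi ≤ x := by
      rw [← le_div_iff₀ hpi]
      exact Nat.floor_le (by positivity)
    have hfu : x < ((N x : ℝ) + 1) * Real.pi := by
      rw [← div_lt_iff₀ hpi]
      exact Nat.lt_floor_add_one _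
    have hpos : 0 < (N x : ℝ) * Real.pi := by positivity
    have := intervalIntegral.norm_integral_le_of_norm_le_const (f := Real.sinc)
      (a := (2 * (N x : ℝ) + 1) * (Real.pi / 2)) (b := x) (C := (N x * Real.pi)⁻¹) (fun u hu => by
        have hu1 : (N x : ℝ) * Real.pi ≤ u := by
          refine le_trans ?_ hu.1.le
          refine le_min ?_ hfl
          nlinarith
        have hu0 : 0 < u := hpos.trans_le hu1
        rw [Real.sinc_of_ne_zero hu0.ne', norm_div, Real.norm_of_nonneg hu0.le, div_eq_mul_inv]
        calc ‖Real.sin u‖ * u⁻¹ ≤ 1 * (N x * Real.pi)⁻¹ := by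
              gcongr
              exact Real.abs_sin_le_one u
          _ = _ := one_mul _)
    refine this.trans ?_
    gcongr
    rw [abs_le]
    constructor <;> nlinarith
  have h3 := h1.add h2
  rw [add_zero] at h3
  refine h3.congr fun x => ?_
  exact intervalIntegral.integral_add_adjacent_intervals (hii _ _) (hii _ _)

theorem exists_bound_integral_sinc :
    ∃ B : ℝ, 0 ≤ B ∧ ∀ x : ℝ, 0 ≤ x → |∫ u in (0 : ℝ)..x, Real.sinc u| ≤ B := by
  have hpi := Real.pi_pos
  obtain ⟨X, hX⟩ := eventually_atTop.1
    ((tendsto_integral_sinc.abs).eventually (eventually_le_nhds (b := |Real.pi / 2| + 1)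
      (by linarith)))
  refine ⟨max (|Real.pi / 2| + 1) |X|, by positivity, fun x hx => ?_⟩
  rcases le_total X x with h | h
  · exact (hX x h).trans (le_max_left _ _)
  · refine le_trans ?_ (le_max_right _ _)
    have := intervalIntegral.norm_integral_le_of_norm_le_const (f := Real.sinc)
      (a := 0) (b := x) (C := 1) fun u _ => Real.abs_sinc_le_one u
    rw [Real.norm_eq_abs, one_mul, sub_zero, abs_of_nonneg hx] at this
    exact this.trans (h.trans (le_abs_self X))

end NonlocalODE

/-! ### The Dirichlet kernel against functions of bounded variation -/

namespace NonlocalODE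

/-- A superlevel set of a monotone function is a half-line. Its endpoint is clamped to [0, η], and
`a` itself is excluded because the half-line may be open or closed. -/
theorem Monotone.exists_threshold {h : ℝ → ℝ} (hh : Monotone h) {η : ℝ} (hη : 0 ≤ η) (y : ℝ) :
    ∃ a ∈ Icc 0 η, ∀ u ∈ Ioo 0 η, u ≠ a → (y < h u ↔ a < u) := by
  let S : Set ℝ := {u | u ∈ Icc 0 η ∧ (y < h u ∨ u = η)}
  have hne : S.Nonempty := ⟨η, right_mem_Icc.2 hη, Or.inr rfl⟩
  have hbd : BddBelow S := ⟨0, fun u hu => hu.1.1⟩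
  refine ⟨sInf S, ⟨le_csInf hne fun u hu => hu.1.1, csInf_le hbd ⟨right_mem_Icc.2 hη, Or.inr rfl⟩⟩,
    fun u hu hua => ⟨fun hy => ?_, fun hlt => ?_⟩⟩
  · exact lt_of_le_of_ne (csInf_le hbd ⟨Ioo_subset_Icc_self hu, Or.inl hy⟩) hua.symm
  · obtain ⟨v, hv, hvu⟩ := exists_lt_of_csInf_lt hne hlt
    rcases hv.2 with hv2 | rfl
    · exact hv2.trans_le (hh hvu.le)
    · exact absurd hu.2 (not_lt.2 hvu.le)

/-- A consequence of the second mean value theorem for integrals. -/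
theorem abs_integral_monotone_mul_le {h K : ℝ → ℝ} (hh : Monotone h) (hK : Continuous K)
    {η H C : ℝ} (hη : 0 ≤ η) (hH : 0 ≤ H) (h0 : ∀ u ∈ Ioo 0 η, 0 ≤ h u ∧ h u ≤ H)
    (hC : ∀ a ∈ Icc 0 η, |∫ u in a..η, K u| ≤ C) :
    |∫ u in (0 : ℝ)..η, h u * K u| ≤ H * C := by
  -- Layer cake: h(u) is the length of {y ∈ (0, H) : y < h(u)}. After Fubini, the inner integral at
  -- level y is ∫_a^η K with `a` the threshold of that level, hence at most C.
  let k : ℝ → ℝ → ℝ := fun u y => {z : ℝ × ℝ | z.2 < h z.1}.indicator (fun z => K z.1) (u, y)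
  have hset : MeasurableSet {z : ℝ × ℝ | z.2 < h z.1} :=
    measurableSet_lt measurable_snd (hh.measurable.comp measurable_fst)
  have hint : Integrable (Function.uncurry k)
      ((volume.restrict (Ioo 0 η)).prod (volume.restrict (Ioo 0 H))) := by
    have hK' : IntegrableOn K (Ioo 0 η) :=
      (hK.integrableOn_Icc (a := 0) (b := η)).mono_set Ioo_subset_Icc_self
    exact (Integrable.comp_fst hK' (volume.restrict (Ioo 0 H))).indicator hset
  have e1 : ∫ u in (0 : ℝ)..η, h u * K u = ∫ u in Ioo 0 η, ∫ y in Ioo 0 H, k u y := by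
    rw [intervalIntegral.integral_of_le hη, integral_Ioc_eq_integral_Ioo]
    refine setIntegral_congr_fun measurableSet_Ioo fun u hu => ?_
    obtain ⟨hu0, hu1⟩ := h0 u hu
    have : ∀ y ∈ Ioo 0 H, k u y = (Iio (h u)).indicator (fun _ => K u) y := fun y _ => rfl
    rw [setIntegral_congr_fun measurableSet_Ioo this, setIntegral_indicator measurableSet_Iio,
      setIntegral_const]
    have : Ioo 0 H ∩ Iio (h u) = Ioo 0 (h u) := by
      ext y
      simp only [mem_inter_iff, mem_Ioo, mem_Iio]
      exact ⟨fun hy => ⟨hy.1.1, hy.2⟩, fun hy => ⟨⟨hy.1, hy.2.trans_le hu1⟩, hy.2⟩⟩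
    rw [this, measureReal_def, Real.volume_Ioo, sub_zero, ENNReal.toReal_ofReal hu0, smul_eq_mul]
  have e2 : ∀ y, |∫ u in Ioo 0 η, k u y| ≤ C := fun y => by
    obtain ⟨a, ha, hay⟩ := Monotone.exists_threshold hh hη y
    refine le_trans (le_of_eq ?_) (hC a ha)
    congr 1
    rw [intervalIntegral.integral_of_le ha.2, integral_Ioc_eq_integral_Ioo,
      ← integral_indicator measurableSet_Ioo, ← integral_indicator measurableSet_Ioo]
    refine integral_congr_ae ?_
    have hne : ∀ᵐ u : ℝ, u ≠ a := by
      simp [ae_iff]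
    filter_upwards [hne] with u hu
    by_cases hu0 : u ∈ Ioo 0 η
    · rw [indicator_of_mem hu0]
      by_cases hau : a < u
      · have : (u, y) ∈ {z : ℝ × ℝ | z.2 < h z.1} := (hay u hu0 hu).2 hau
        rw [indicator_of_mem (show u ∈ Ioo a η from ⟨hau, hu0.2⟩)]
        exact indicator_of_mem this _
      · have : (u, y) ∉ {z : ℝ × ℝ | z.2 < h z.1} := fun hy => hau ((hay u hu0 hu).1 hy)
        rw [indicator_of_notMem (show u ∉ Ioo a η from fun h => hau h.1)]
        exact indicator_of_notMem this _
    · rw [indicator_of_notMem hu0,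
        indicator_of_notMem (show u ∉ Ioo a η from fun h => hu0 ⟨ha.1.trans_lt h.1, h.2⟩)]
  rw [e1, integral_integral_swap hint]
  refine (norm_integral_le_of_norm_le_const (μ := volume.restrict (Ioo 0 H)) (C := C)
    (f := fun y => ∫ u in Ioo 0 η, k u y) (Eventually.of_forall e2)).trans ?_
  rw [measureReal_restrict_apply_univ, measureReal_def, Real.volume_Ioo, sub_zero,
    ENNReal.toReal_ofReal hH, mul_comm]

theorem continuous_scaled_sinc (l : ℝ) : Continuous fun u : ℝ => l * Real.sinc (l * u) :=
  continuous_const.mul (Real.continuous_sinc.comp (continuous_const.mul continuous_id))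

theorem tendsto_integral_scaled_sinc {δ : ℝ} (hδ : 0 < δ) :
    Tendsto (fun l : ℝ => ∫ u in (0 : ℝ)..δ, l * Real.sinc (l * u)) atTop (𝓝 (Real.pi / 2)) := by
  refine (tendsto_integral_sinc.comp (tendsto_id.atTop_mul_const hδ)).congr' ?_
  filter_upwards [eventually_gt_atTop 0] with l hl
  rw [integral_scaled_sinc hl, mul_zero]
  rfl

/-- Rescaled, these are differences of two values of the sine integral, so one bound serves for all
l; the estimate near the peak of the kernel needs this uniformity. -/
theorem exists_bound_integral_scaled_sinc :
    ∃ B : ℝ, 0 ≤ B ∧ ∀ l : ℝ, 0 < l → ∀ η, ∀ a ∈ Icc 0 η,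
      |∫ u in a..η, l * Real.sinc (l * u)| ≤ B := by
  obtain ⟨B, hB0, hB⟩ := exists_bound_integral_sinc
  refine ⟨B + B, by positivity, fun l hl η a ha => ?_⟩
  have hii : ∀ a b : ℝ, IntervalIntegrable Real.sinc volume a b :=
    fun a b => Real.continuous_sinc.intervalIntegrable a b
  rw [integral_scaled_sinc hl, ← intervalIntegral.integral_interval_sub_left (hii 0 _) (hii 0 _)]
  exact (abs_sub _ _).trans (add_le_add (hB _ (mul_nonneg hl.le (ha.1.trans ha.2)))
    (hB _ (mul_nonneg hl.le ha.1)))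

/-- The Riemann-Lebesgue lemma for the Dirichlet kernel, away from its peak. -/
theorem tendsto_setIntegral_mul_scaled_sinc {g : ℝ → ℂ} {s : Set ℝ} (hs : MeasurableSet s)
    (hg : IntegrableOn g s) {η : ℝ} (hη : 0 < η) (hsη : ∀ u ∈ s, η ≤ |u|) :
    Tendsto (fun l : ℝ => ∫ u in s, g u * ((l * Real.sinc (l * u) : ℝ) : ℂ)) atTop (𝓝 0) := by
  have hint : Integrable (s.indicator fun u => g u * ((u⁻¹ : ℝ) : ℂ)) := by
    refine (integrable_indicator_iff hs).2 (Integrable.mono' (hg.norm.mul_const η⁻¹)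
      (hg.1.mul (by fun_prop)) ?_)
    filter_upwards [ae_restrict_mem hs] with u hu
    rw [norm_mul, Complex.norm_real, norm_inv, Real.norm_eq_abs]
    gcongr
    exact hsη u hu
  refine (tendsto_integral_mul_sin hint).congr fun l => ?_
  rw [← integral_indicator hs]
  congr 1 with u
  by_cases hu : u ∈ s
  · have : u ≠ 0 := fun h => by
      have := hsη u hu
      rw [h, abs_zero] at this
      linarith
    rw [indicator_of_mem hu, indicator_of_mem hu, scaled_sinc_eq l this]
    push_cast
    ring
  · simp [hu]

/-- Split off the constant P(0⁺), which contributes through the Dirichlet integral. The rest is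
nonnegative, increasing and small on (0, η), so the second mean value theorem bounds its
contribution uniformly in l; on (η, δ) Riemann–Lebesgue applies. -/
theorem tendsto_integral_monotone_mul_scaled_sinc {P : ℝ → ℝ} (hP : Monotone P) {δ : ℝ}
    (hδ : 0 < δ) :
    Tendsto (fun l : ℝ => ∫ u in (0 : ℝ)..δ, P u * (l * Real.sinc (l * u))) atTop
      (𝓝 (Real.pi / 2 * Function.rightLim P 0)) := by
  set L := Function.rightLim P 0 with hL
  obtain ⟨B, hB0, hB⟩ := exists_bound_integral_scaled_sinc
  have hfirst := (tendsto_integral_scaled_sinc hδ).mul_const L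
  have hh : Monotone fun u => P u - L := fun x y hxy => sub_le_sub_right (hP hxy) L
  suffices h : Tendsto (fun l : ℝ => ∫ u in (0 : ℝ)..δ, (P u - L) * (l * Real.sinc (l * u))) atTop
      (𝓝 0) by
    have := h.add hfirst
    rw [zero_add] at this
    refine this.congr fun l => ?_
    rw [← intervalIntegral.integral_mul_const, ← intervalIntegral.integral_add]
    · congr 1 with u
      ring
    · exact (hh.monotoneOn _).intervalIntegrable.mul_continuousOn
        (continuous_scaled_sinc l).continuousOn
    · exact ((continuous_scaled_sinc l).mul continuous_const).intervalIntegrable _ _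
  rw [Metric.tendsto_nhds]
  intro ε hε
  have hlim : Tendsto (fun u => (P u - L) * B) (𝓝[>] 0) (𝓝 0) := by
    have := ((hP.tendsto_rightLim 0).sub_const L).mul_const B
    simpa [hL] using this
  obtain ⟨η, hηε, hη0, hηδ⟩ := ((hlim.eventually (gt_mem_nhds (half_pos hε))).and
    (Ioo_mem_nhdsGT hδ)).exists
  have h0 : ∀ u ∈ Ioo 0 η, 0 ≤ P u - L ∧ P u - L ≤ P η - L := fun u hu =>
    ⟨sub_nonneg.2 (hP.rightLim_le hu.1), sub_le_sub_right (hP hu.2.le) L⟩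
  have hH : 0 ≤ P η - L := sub_nonneg.2 (hP.rightLim_le hη0)
  have hii : ∀ l a b, IntervalIntegrable (fun u => (P u - L) * (l * Real.sinc (l * u))) volume a b :=
    fun l a b => (hh.monotoneOn _).intervalIntegrable.mul_continuousOn
        (continuous_scaled_sinc l).continuousOn
  have htail : Tendsto (fun l : ℝ => ∫ u in η..δ, (P u - L) * (l * Real.sinc (l * u))) atTop
      (𝓝 0) := by
    have := tendsto_setIntegral_mul_scaled_sinc (g := fun u => ((P u - L : ℝ) : ℂ))
      (measurableSet_Ioc (a := η) (b := δ))
      ((intervalIntegrable_iff_integrableOn_Ioc_of_le hηδ.le).1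
        (hh.monotoneOn _).intervalIntegrable).ofReal hη0
      (fun u hu => hu.1.le.trans (le_abs_self u))
    have h2 := (Complex.continuous_re.tendsto _).comp this
    rw [Complex.zero_re] at h2
    refine h2.congr fun l => ?_
    rw [intervalIntegral.integral_of_le hηδ.le]
    simp only [Function.comp_apply, ← Complex.ofReal_mul]
    rw [integral_complex_ofReal, Complex.ofReal_re]
  filter_upwards [Metric.tendsto_nhds.1 htail _ (half_pos hε), eventually_gt_atTop 0] with l hl hl0
  rw [← intervalIntegral.integral_add_adjacent_intervals (hii l 0 η) (hii l η δ)]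
  rw [dist_zero_right] at hl ⊢
  have := abs_integral_monotone_mul_le hh (continuous_scaled_sinc l) hη0.le hH h0 (hB l hl0 η)
  calc _ ≤ _ := norm_add_le _ _
    _ < ε / 2 + ε / 2 := add_lt_add (this.trans_lt hηε) hl
    _ = ε := add_halves ε

/-- Jordan decomposition. Extended to the line, the two monotone functions have right limits at 0,
whose difference must be `L`; the value of h at 0 plays no part. -/
theorem tendsto_integral_real_bv_mul_scaled_sinc {h : ℝ → ℝ} {δ L : ℝ} (hδ : 0 < δ)
    (hh : BoundedVariationOn h (Icc 0 δ)) (hL : Tendsto h (𝓝[>] 0) (𝓝 L)) :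
    IntervalIntegrable h volume 0 δ ∧
    Tendsto (fun l : ℝ => ∫ u in (0 : ℝ)..δ, h u * (l * Real.sinc (l * u))) atTop
      (𝓝 (Real.pi / 2 * L)) := by
  have hext : ∀ p : ℝ → ℝ, MonotoneOn p (Icc 0 δ) → ∃ P, Monotone P ∧ EqOn p P (Icc 0 δ) :=
    fun p hp => hp.exists_monotone_extension
      ⟨p 0, by rintro _ ⟨u, hu, rfl⟩; exact hp (left_mem_Icc.2 hδ.le) hu hu.1⟩
      ⟨p δ, by rintro _ ⟨u, hu, rfl⟩; exact hp hu (right_mem_Icc.2 hδ.le) hu.2⟩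
  obtain ⟨p, q, hp, hq, rfl⟩ := hh.locallyBoundedVariationOn.exists_monotoneOn_sub_monotoneOn
  obtain ⟨P, hP, hpP⟩ := hext p hp
  obtain ⟨Q, hQ, hqQ⟩ := hext q hq
  have heq : ∀ u ∈ Icc 0 δ, (p - q) u = P u - Q u := fun u hu => by
    rw [Pi.sub_apply, hpP hu, hqQ hu]
  have hPi : ∀ {P : ℝ → ℝ}, Monotone P → IntervalIntegrable P volume 0 δ := fun hP =>
    (hP.monotoneOn _).intervalIntegrable
  have hL' : L = Function.rightLim P 0 - Function.rightLim Q 0 := by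
    refine tendsto_nhds_unique hL (((hP.tendsto_rightLim 0).sub (hQ.tendsto_rightLim 0)).congr' ?_)
    filter_upwards [Ioo_mem_nhdsGT hδ] with u hu using (heq u (Ioo_subset_Icc_self hu)).symm
  constructor
  · refine ((hPi hP).sub (hPi hQ)).congr_ae ?_
    filter_upwards [ae_restrict_mem measurableSet_uIoc] with u hu
    rw [uIoc_of_le hδ.le] at hu
    exact (heq u (Ioc_subset_Icc_self hu)).symm
  · have := (tendsto_integral_monotone_mul_scaled_sinc hP hδ).sub
      (tendsto_integral_monotone_mul_scaled_sinc hQ hδ)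
    rw [← mul_sub, ← hL'] at this
    refine this.congr fun l => ?_
    rw [← intervalIntegral.integral_sub
      ((hPi hP).mul_continuousOn (continuous_scaled_sinc l).continuousOn)
      ((hPi hQ).mul_continuousOn (continuous_scaled_sinc l).continuousOn)]
    refine intervalIntegral.integral_congr fun u hu => ?_
    rw [uIcc_of_le hδ.le] at hu
    simp only [heq u hu]
    ring

theorem intervalIntegrable_ofReal {f : ℝ → ℝ} {a b : ℝ} (hf : IntervalIntegrable f volume a b) :
    IntervalIntegrable (fun u => (f u : ℂ)) volume a b :=
  ⟨hf.1.ofReal, hf.2.ofReal⟩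

theorem tendsto_integral_bv_mul_scaled_sinc {h : ℝ → ℂ} {δ : ℝ} {L : ℂ} (hδ : 0 < δ)
    (hh : BoundedVariationOn h (Icc 0 δ)) (hL : Tendsto h (𝓝[>] 0) (𝓝 L)) :
    Tendsto (fun l : ℝ => ∫ u in (0 : ℝ)..δ, h u * ((l * Real.sinc (l * u) : ℝ) : ℂ)) atTop
      (𝓝 (Real.pi / 2 * L)) := by
  obtain ⟨hi1, h1⟩ := tendsto_integral_real_bv_mul_scaled_sinc hδ
    (Complex.reCLM.lipschitz.comp_boundedVariationOn hh)
    ((Complex.continuous_re.tendsto _).comp hL)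
  obtain ⟨hi2, h2⟩ := tendsto_integral_real_bv_mul_scaled_sinc hδ
    (Complex.imCLM.lipschitz.comp_boundedVariationOn hh)
    ((Complex.continuous_im.tendsto _).comp hL)
  have h3 := ((Complex.continuous_ofReal.tendsto _).comp h1).add
    (((Complex.continuous_ofReal.tendsto _).comp h2).mul_const Complex.I)
  have hval : ((Real.pi / 2 * L.re : ℝ) : ℂ) + ((Real.pi / 2 * L.im : ℝ) : ℂ) * Complex.I =
      Real.pi / 2 * L := by
    push_cast
    rw [mul_assoc, ← mul_add, Complex.re_add_im]
  rw [hval] at h3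
  refine h3.congr fun l => ?_
  have hc := (continuous_scaled_sinc l).continuousOn (s := uIcc 0 δ)
  replace hi1 : IntervalIntegrable (fun u => (h u).re) volume 0 δ := hi1
  replace hi2 : IntervalIntegrable (fun u => (h u).im) volume 0 δ := hi2
  simp only [Function.comp_apply, Complex.reCLM_apply, Complex.imCLM_apply]
  rw [← intervalIntegral.integral_ofReal, ← intervalIntegral.integral_ofReal,
    ← intervalIntegral.integral_mul_const, ← intervalIntegral.integral_add
      (intervalIntegrable_ofReal (hi1.mul_continuousOn hc))
      ((intervalIntegrable_ofReal (hi2.mul_continuousOn hc)).mul_const _)]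
  congr 1 with u
  conv_rhs => rw [← Complex.re_add_im (h u)]
  push_cast
  ring

end NonlocalODE

/-! ### Dirichlet–Jordan inversion -/

namespace NonlocalODE

section

open scoped FourierTransform

theorem fourier_indicator_exp {A : ℝ} (hA : 0 ≤ A) (t v : ℝ) :
    𝓕 ((Ioc (-A) A).indicator fun ξ : ℝ => Complex.exp ((2 * Real.pi * (ξ * t) : ℝ) * Complex.I)) v =
      ((2 * A * Real.sinc (2 * Real.pi * A * (t - v)) : ℝ) : ℂ) := by
  set a := 2 * Real.pi * (t - v) with ha
  have e1 : 𝓕 ((Ioc (-A) A).indicator fun ξ : ℝ =>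
      Complex.exp ((2 * Real.pi * (ξ * t) : ℝ) * Complex.I)) v =
      ∫ ξ in (-A)..A, Complex.exp ((a * ξ : ℝ) * Complex.I) := by
    rw [Real.fourier_real_eq_integral_exp_smul, intervalIntegral.integral_of_le (by linarith),
      ← integral_indicator measurableSet_Ioc]
    congr 1 with ξ
    by_cases h : ξ ∈ Ioc (-A) A
    · rw [indicator_of_mem h, indicator_of_mem h, smul_eq_mul, ← Complex.exp_add, ha]
      congr 1
      push_cast
      ring
    · simp [h]
  rw [e1]
  rcases eq_or_ne a 0 with h0 | h0
  · have : t - v = 0 := by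
      have := Real.pi_pos
      simpa [ha, this.ne'] using h0
    rw [h0, this]
    simp
    ring
  · have e2 := intervalIntegral.integral_comp_mul_left (a := -A) (b := A)
      (fun y : ℝ => Complex.exp ((y : ℂ) * Complex.I)) h0
    have e3 := integral_exp_mul_I_eq_sinc (a * A)
    rw [← mul_neg] at e3
    rw [e2, e3, Complex.real_smul, show 2 * Real.pi * A * (t - v) = a * A by rw [ha]; ring]
    have : (a : ℂ) ≠ 0 := by exact_mod_cast h0
    push_cast
    field_simp

/-- The truncated inverse Fourier integral as a convolution with the Dirichlet kernel. -/
theorem truncated_fourierInv_eq {g : ℝ → ℂ} (hg : Integrable g) {A : ℝ} (hA : 0 ≤ A) (t : ℝ) :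
    𝓕⁻ ((Ioc (-A) A).indicator (𝓕 g)) t = (1 / Real.pi : ℂ) *
      ∫ u, g (t + u) * ((2 * Real.pi * A * Real.sinc (2 * Real.pi * A * u) : ℝ) : ℂ) := by
  let k : ℝ → ℂ := (Ioc (-A) A).indicator fun ξ : ℝ =>
    Complex.exp ((2 * Real.pi * (ξ * t) : ℝ) * Complex.I)
  have hk : Integrable k :=
    (integrable_indicator_iff measurableSet_Ioc).2 (Continuous.integrableOn_Ioc (by fun_prop))
  -- The multiplication formula moves the transform from g to the truncated exponential, whose
  -- transform is the Dirichlet kernel.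
  have e0 := VectorFourier.integral_bilin_fourierIntegral_eq_flip (.mul ℂ ℂ) (L := innerₗ ℝ)
    Real.continuous_fourierChar continuous_inner hg hk
  have e : ∫ ξ, 𝓕 g ξ * k ξ = ∫ v, g v * 𝓕 k v := by simpa using! e0
  have e1 : 𝓕⁻ ((Ioc (-A) A).indicator (𝓕 g)) t = ∫ ξ, 𝓕 g ξ * k ξ := by
    rw [Real.fourierInv_eq']
    congr 1 with ξ
    by_cases h : ξ ∈ Ioc (-A) A
    · simp only [k, indicator_of_mem h, smul_eq_mul]
      rw [mul_comm]
      congr 4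
      simp [mul_comm]
    · simp [k, h]
  rw [e1, e, ← integral_add_left_eq_self _ t, ← integral_const_mul]
  congr 1 with u
  rw [fourier_indicator_exp hA, sub_add_cancel_left, mul_neg, Real.sinc_neg]
  have : (Real.pi : ℂ) ≠ 0 := by exact_mod_cast Real.pi_ne_zero
  push_cast
  field_simp

/-- **Dirichlet-Jordan**: the truncated Fourier inversion formula holds pointwise near which the
function is of bounded variation. -/
theorem tendsto_truncated_fourierInv_of_bv {g : ℝ → ℂ} (hg : Integrable g) {t δ : ℝ} (hδ : 0 < δ)
    (hbv : BoundedVariationOn g (Icc (t - δ) (t + δ))) {gl gr : ℂ}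
    (hl : Tendsto g (𝓝[<] t) (𝓝 gl)) (hr : Tendsto g (𝓝[>] t) (𝓝 gr)) :
    Tendsto (fun A : ℝ => 𝓕⁻ ((Ioc (-A) A).indicator (𝓕 g)) t) atTop (𝓝 ((gl + gr) / 2)) := by
  have hpi : (Real.pi : ℂ) ≠ 0 := by exact_mod_cast Real.pi_ne_zero
  -- The two halves of the peak contribute (π/2) g(t⁺) and, after reflection, (π/2) g(t⁻); beyond
  -- distance δ Riemann–Lebesgue applies.
  have hright := tendsto_integral_bv_mul_scaled_sinc (h := fun u => g (t + u)) (L := gr) hδ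
    (ne_top_of_le_ne_top hbv (eVariationOn.comp_le_of_monotoneOn g (fun u => t + u)
      (fun x _ y _ h => by simpa using h)
      (fun u hu => ⟨by linarith [hu.1], by linarith [hu.2]⟩)))
    (hr.comp (tendsto_nhdsWithin_iff.2 ⟨by
      have : Tendsto (fun u : ℝ => t + u) (𝓝 0) (𝓝 (t + 0)) :=
        (by fun_prop : Continuous fun u : ℝ => t + u).tendsto 0
      rw [add_zero] at this
      exact this.mono_left nhdsWithin_le_nhds, by
      filter_upwards [self_mem_nhdsWithin] with u hu
      simpa using hu⟩))
  have hleft := tendsto_integral_bv_mul_scaled_sinc (h := fun u => g (t - u)) (L := gl) hδ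
    (ne_top_of_le_ne_top hbv (eVariationOn.comp_le_of_antitoneOn g (fun u => t - u)
      (fun x _ y _ h => sub_le_sub_left h t)
      (fun u hu => ⟨by linarith [hu.2], by linarith [hu.1]⟩)))
    (hl.comp (tendsto_nhdsWithin_iff.2 ⟨by
      have : Tendsto (fun u : ℝ => t - u) (𝓝 0) (𝓝 (t - 0)) :=
        (by fun_prop : Continuous fun u : ℝ => t - u).tendsto 0
      rw [sub_zero] at this
      exact this.mono_left nhdsWithin_le_nhds, by
      filter_upwards [self_mem_nhdsWithin] with u hu
      simpa using hu⟩))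
  have hgt : Integrable fun u => g (t + u) := hg.comp_add_left t
  have houter := tendsto_setIntegral_mul_scaled_sinc (s := (Ioc (-δ) δ)ᶜ) measurableSet_Ioc.compl
    hgt.integrableOn hδ (fun u hu => by
      by_contra h
      rw [not_le, abs_lt] at h
      exact hu ⟨h.1, h.2.le⟩)
  have hsum := (((hleft.add hright).add houter).const_mul (1 / Real.pi : ℂ)).comp
    (tendsto_id.const_mul_atTop (by positivity : 0 < 2 * Real.pi))
  have hval : (1 / Real.pi : ℂ) * (Real.pi / 2 * gl + Real.pi / 2 * gr + 0) = (gl + gr) / 2 := by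
    field_simp
    ring
  rw [hval] at hsum
  refine hsum.congr' ?_
  filter_upwards [eventually_ge_atTop 0] with A hA
  rw [truncated_fourierInv_eq hg hA]
  simp only [Function.comp_apply, id]
  congr 1
  set l := 2 * Real.pi * A
  have hint : Integrable fun u => g (t + u) * ((l * Real.sinc (l * u) : ℝ) : ℂ) := by
    refine hgt.mul_bdd (c := |l|) (Complex.continuous_ofReal.comp
      (continuous_scaled_sinc l)).aestronglyMeasurable (Eventually.of_forall fun u => ?_)
    rw [Complex.norm_real, norm_mul]
    exact mul_le_of_le_one_right (norm_nonneg _) (Real.abs_sinc_le_one _)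
  rw [← integral_add_compl measurableSet_Ioc hint]
  congr 1
  rw [← intervalIntegral.integral_of_le (by linarith),
    ← intervalIntegral.integral_add_adjacent_intervals (a := -δ) (b := 0) (c := δ)
      hint.intervalIntegrable hint.intervalIntegrable]
  congr 1
  have := intervalIntegral.integral_comp_neg (a := 0) (b := δ)
    (fun u => g (t + u) * ((l * Real.sinc (l * u) : ℝ) : ℂ))
  rw [neg_zero] at this
  rw [← this]
  congr 1 with u
  rw [mul_neg, Real.sinc_neg, sub_eq_add_neg]

end

theorem boundedVariationOn_exp_mul (c a b : ℝ) :
    BoundedVariationOn (fun u : ℝ => Real.exp (-c * u)) (Icc a b) := by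
  rcases le_or_gt a b with hab | hab
  · have h1 : ContDiff ℝ 1 fun u : ℝ => Real.exp (-c * u) := by fun_prop
    obtain ⟨K, hK⟩ := h1.locallyLipschitz.locallyLipschitzOn.exists_lipschitzOnWith_of_compact
      (isCompact_Icc (a := a) (b := b))
    have := hK.locallyBoundedVariationOn a b (left_mem_Icc.2 hab) (right_mem_Icc.2 hab)
    rwa [inter_self] at this
  · rw [Icc_eq_empty (not_le.2 hab)]
    exact BoundedVariationOn.of_subsingleton subsingleton_empty

/-- The Bromwich inversion formula holds at points of local bounded variation. -/
theorem MemExpBdd.tendsto_bromwich_of_bvNear {ω c : ℝ} (hc : ω < c) {φ : ℝ → ℂ}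
    (h : MemExpBdd ω φ) {F : ℂ → ℂ}
    (hF : ∀ᵐ y : ℝ, F (c + y * Complex.I) = laplace φ (c + y * Complex.I)) {t : ℝ} (ht : 0 < t)
    (hbv : BVNear φ t) :
    ∃ φl φr : ℂ, Tendsto φ (𝓝[<] t) (𝓝 φl) ∧ Tendsto φ (𝓝[>] t) (𝓝 φr) ∧
      Tendsto (fun N : ℝ => bromwich F c N t) atTop (𝓝 ((φl + φr) / 2)) := by
  obtain ⟨δ₀, hδ₀, hbv₀⟩ := hbv
  -- With δ < t the neighbourhood stays in (0, ∞), where the damped function is e^{-cu}φ(u) and not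
  -- its extension by zero.
  obtain ⟨δ, hδ, hδδ, hδt⟩ : ∃ δ > 0, δ ≤ δ₀ ∧ δ < t :=
    ⟨min δ₀ (t / 2), by positivity, min_le_left _ _, (min_le_right _ _).trans_lt (by linarith)⟩
  have hbv : BoundedVariationOn φ (Icc (t - δ) (t + δ)) :=
    hbv₀.mono (Icc_subset_Icc (by linarith) (by linarith))
  obtain ⟨φl, hφl⟩ := hbv.exists_tendsto_left t
  obtain ⟨φr, hφr⟩ := hbv.exists_tendsto_right t
  have hl : Tendsto φ (𝓝[<] t) (𝓝 φl) := by
    refine hφl.mono_left (nhdsWithin_le_of_mem ?_)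
    filter_upwards [Ioo_mem_nhdsLT (show t - δ < t by linarith)] with u hu
    exact ⟨⟨hu.1.le, by linarith [hu.2]⟩, hu.2⟩
  have hr : Tendsto φ (𝓝[>] t) (𝓝 φr) := by
    refine hφr.mono_left (nhdsWithin_le_of_mem ?_)
    filter_upwards [Ioo_mem_nhdsGT (show t < t + δ by linarith)] with u hu
    exact ⟨⟨by linarith [hu.1], hu.2.le⟩, hu.1⟩
  refine ⟨φl, φr, hl, hr, ?_⟩
  have hev : ∀ u : ℝ, 0 < u → expDamp c φ u = Real.exp (-c * u) • φ u := fun u hu => by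
    rw [expDamp, indicator_of_mem (show u ∈ Ioi (0 : ℝ) from hu), Complex.real_smul]
  have hexp : Tendsto (fun u : ℝ => Real.exp (-c * u)) (𝓝 t) (𝓝 (Real.exp (-c * t))) :=
    (by fun_prop : Continuous fun u : ℝ => Real.exp (-c * u)).tendsto t
  have hpos : ∀ᶠ u in 𝓝 t, expDamp c φ u = Real.exp (-c * u) • φ u :=
    (eventually_gt_nhds ht).mono hev
  have hgl : Tendsto (expDamp c φ) (𝓝[<] t) (𝓝 (Real.exp (-c * t) • φl)) :=
    ((hexp.mono_left nhdsWithin_le_nhds).smul hl).congr'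
      ((hpos.filter_mono nhdsWithin_le_nhds).mono fun _ h => h.symm)
  have hgr : Tendsto (expDamp c φ) (𝓝[>] t) (𝓝 (Real.exp (-c * t) • φr)) :=
    ((hexp.mono_left nhdsWithin_le_nhds).smul hr).congr'
      ((hpos.filter_mono nhdsWithin_le_nhds).mono fun _ h => h.symm)
  have hgbv : BoundedVariationOn (expDamp c φ) (Icc (t - δ) (t + δ)) := by
    have := (boundedVariationOn_exp_mul c (t - δ) (t + δ)).smul hbv
    rw [BoundedVariationOn] at this ⊢
    rwa [eVariationOn.eq_of_eqOn (f' := (fun u : ℝ => Real.exp (-c * u)) • φ)]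
    intro u hu
    exact hev u (by linarith [hu.1])
  have hlim := ((tendsto_truncated_fourierInv_of_bv (h.integrable_expDamp hc) hδ hgbv hgl
    hgr).comp (tendsto_id.atTop_div_const (by positivity : 0 < 2 * Real.pi))).const_mul
      (Real.exp (c * t) : ℂ)
  have hval : (Real.exp (c * t) : ℂ) * ((Real.exp (-c * t) • φl + Real.exp (-c * t) • φr) / 2) =
      (φl + φr) / 2 := by
    rw [← smul_add, Complex.real_smul, mul_div_assoc, ← mul_assoc, ← Complex.ofReal_mul,
      ← Real.exp_add]
    simp
  rw [hval] at hlim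
  refine hlim.congr' ?_
  filter_upwards [eventually_ge_atTop 0] with N hN
  rw [bromwich_eq_fourierInv hF hN]
  rfl

end NonlocalODE

/-! ### Integrals along piecewise C¹ closed curves -/

namespace NonlocalODE

/-- As a subspace the set is discrete and second countable, hence countable. -/
theorem countable_of_forall_eventually_notMem {X : Type*} [TopologicalSpace X]
    [SecondCountableTopology X] {S : Set X} (h : ∀ x ∈ S, ∀ᶠ z in 𝓝[≠] x, z ∉ S) :
    S.Countable := by
  have : DiscreteTopology S := discreteTopology_subtype_iff.2 fun x hx => by
    rw [← disjoint_iff, disjoint_principal_right]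
    exact h x hx
  exact TopologicalSpace.separableSpace_iff_countable.1 inferInstance

theorem countable_diff_of_mem_codiscreteWithin {X : Type*} [TopologicalSpace X]
    [SecondCountableTopology X] {s U : Set X} (h : s ∈ codiscreteWithin U) :
    (U \ s).Countable := by
  refine countable_of_forall_eventually_notMem fun x hx => ?_
  filter_upwards [mem_codiscreteWithin_iff_forall_mem_nhdsNE.1 h x hx.1] with z hz hz'
  exact hz.elim hz'.2 fun h => h hz'.1

namespace PiecewiseC1

variable {σ : ℝ → ℂ}

theorem continuousOn (h : PiecewiseC1 σ) : ContinuousOn σ (Icc 0 1) := by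
  obtain ⟨k, τ, hτ, h0, h1, hk⟩ := h
  have : ∀ j ≤ k, ContinuousOn σ (Icc (τ 0) (τ j)) := by
    intro j
    induction j with
    | zero => intro _; simp
    | succ j ih =>
      intro hj
      rw [← Icc_union_Icc_eq_Icc (hτ (Nat.zero_le j)) (hτ (Nat.le_succ j))]
      exact (ih (by omega)).union_of_isClosed (hk j (by omega)).continuousOn isClosed_Icc
        isClosed_Icc
  simpa [h0, h1] using this k le_rfl

theorem exists_finite_hasDerivAt (h : PiecewiseC1 σ) :
    ∃ S : Set ℝ, S.Finite ∧ ∀ u ∈ Icc (0 : ℝ) 1 \ S, HasDerivAt σ (deriv σ u) u := by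
  obtain ⟨k, τ, hτ, h0, h1, hk⟩ := h
  refine ⟨τ '' Iic k, (finite_Iic k).image τ, fun u hu => ?_⟩
  have hne : ∀ j ≤ k, u ≠ τ j := fun j hj h => hu.2 ⟨j, hj, h.symm⟩
  have : ∀ j ≤ k, u < τ j → ∃ i < k, u ∈ Ioo (τ i) (τ (i + 1)) := by
    intro j
    induction j with
    | zero => intro _ hlt; rw [h0] at hlt; exact absurd hu.1.1 (not_le.2 hlt)
    | succ j ih =>
      intro hj hlt
      rcases lt_or_ge u (τ j) with hlt' | hge
      · exact ih (by omega) hlt'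
      · exact ⟨j, by omega, lt_of_le_of_ne hge (hne j (by omega)).symm, hlt⟩
  obtain ⟨i, hi, hui⟩ := this k le_rfl (lt_of_le_of_ne (h1 ▸ hu.1.2) (hne k le_rfl))
  exact (((hk i hi).differentiableOn one_ne_zero).differentiableAt
    (Icc_mem_nhds hui.1 hui.2)).hasDerivAt

theorem intervalIntegrable_deriv (h : PiecewiseC1 σ) :
    IntervalIntegrable (deriv σ) volume 0 1 := by
  obtain ⟨k, τ, hτ, h0, h1, hk⟩ := h
  have : IntervalIntegrable (deriv σ) volume (τ 0) (τ k) := by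
    refine IntervalIntegrable.trans_iterate fun j hj => ?_
    rcases (hτ (Nat.le_succ j)).eq_or_lt with he | hlt
    · rw [Nat.succ_eq_add_one] at he
      rw [he]
    · have hc : ContinuousOn (derivWithin σ (Icc (τ j) (τ (j + 1)))) (Icc (τ j) (τ (j + 1))) :=
        (hk j hj).continuousOn_derivWithin (uniqueDiffOn_Icc hlt) le_rfl
      have hle := hlt.le
      rw [intervalIntegrable_iff_integrableOn_Ioo_of_le hle]
      refine (hc.integrableOn_Icc.mono_set Ioo_subset_Icc_self).congr_fun (fun u hu => ?_)
        measurableSet_Ioo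
      exact derivWithin_of_mem_nhds (Icc_mem_nhds hu.1 hu.2)
  rwa [h0, h1] at this

theorem intervalIntegrable_mul_deriv (h : PiecewiseC1 σ) {g : ℂ → ℂ}
    (hg : ContinuousOn g (σ '' Icc 0 1)) :
    IntervalIntegrable (fun u => g (σ u) * deriv σ u) volume 0 1 := by
  refine h.intervalIntegrable_deriv.continuousOn_mul ?_
  rw [uIcc_of_le zero_le_one]
  exact hg.comp h.continuousOn (mapsTo_image _ _)

theorem contourIntegral_eq_sub (h : PiecewiseC1 σ) {g Φ : ℂ → ℂ}
    (hg : ContinuousOn g (σ '' Icc 0 1)) (hΦ : ∀ z ∈ σ '' Icc 0 1, HasDerivAt Φ (g z) z) :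
    contourIntegral g σ = Φ (σ 1) - Φ (σ 0) := by
  obtain ⟨S, hS, hd⟩ := h.exists_finite_hasDerivAt
  refine integral_eq_of_hasDerivAt_off_countable (fun u => Φ (σ u)) _ hS.countable ?_
    (fun u hu => ?_) (h.intervalIntegrable_mul_deriv hg)
  · rw [uIcc_of_le zero_le_one]
    have : ContinuousOn Φ (σ '' Icc 0 1) := fun z hz => (hΦ z hz).continuousAt.continuousWithinAt
    exact this.comp h.continuousOn (mapsTo_image _ _)
  · rw [min_eq_left zero_le_one, max_eq_right zero_le_one] at hu
    have hu' := Ioo_subset_Icc_self hu.1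
    exact (hΦ _ (mem_image_of_mem σ hu')).comp u (hd u ⟨hu', hu.2⟩)

/-- Contour integrals do not see countable sets. -/
theorem contourIntegral_congr (h : PiecewiseC1 σ) {g g' : ℂ → ℂ} {Z : Set ℂ} (hZ : Z.Countable)
    (hgg : ∀ z ∈ σ '' Icc 0 1, z ∉ Z → g z = g' z) :
    contourIntegral g σ = contourIntegral g' σ := by
  obtain ⟨S, hS, hd⟩ := h.exists_finite_hasDerivAt
  -- Where σ' ≠ 0 a level set of σ is discrete, hence countable; where σ' = 0 the integrand vanishes
  -- whatever `g` is.
  have hlevel : ∀ z : ℂ, {u | u ∈ Icc (0 : ℝ) 1 \ S ∧ σ u = z ∧ deriv σ u ≠ 0}.Countable :=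
    fun z => countable_of_forall_eventually_notMem fun u hu => by
      filter_upwards [(hd u hu.1).eventually_ne (c := z) hu.2.2] with v hv hv'
      exact hv hv'.2.1
  have hcount := (hZ.biUnion fun z _ => hlevel z).union hS.countable
  refine intervalIntegral.integral_congr_ae ?_
  filter_upwards [hcount.ae_notMem volume] with u hu hu01
  rw [uIoc_of_le zero_le_one] at hu01
  simp only [mem_union, mem_iUnion, not_or, not_exists] at hu
  by_cases hz : σ u ∈ Z
  · have : deriv σ u = 0 := by
      by_contra hne
      exact hu.1 _ hz ⟨⟨Ioc_subset_Icc_self hu01, hu.2⟩, rfl, hne⟩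
    simp [this]
  · rw [hgg _ (mem_image_of_mem σ (Ioc_subset_Icc_self hu01)) hz]

end PiecewiseC1

/-- The integral along the vertical segment from `c - ib` to `c + ib` followed by the curve `σ`. -/
noncomputable def closedIntegral (c b : ℝ) (σ : ℝ → ℂ) (g : ℂ → ℂ) : ℂ :=
  (∫ y in (-b)..b, g (c + y * Complex.I) * Complex.I) + contourIntegral g σ

/-- The points on the closed curve used in `closedIntegral`. -/
def curveSupport (c b : ℝ) (σ : ℝ → ℂ) : Set ℂ :=
  (fun y : ℝ => (c : ℂ) + y * Complex.I) '' Icc (-b) b ∪ σ '' Icc 0 1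

theorem windingNumber_eq (c b : ℝ) (σ : ℝ → ℂ) (a : ℂ) :
    windingNumber c b σ a =
      1 / (2 * Real.pi * Complex.I) * closedIntegral c b σ fun z => (z - a)⁻¹ := rfl

/-- `σ` is piecewise `C¹` and closes up the segment from `c - ib` to `c + ib`. -/
structure IsClosingCurve (c b : ℝ) (σ : ℝ → ℂ) : Prop where
  pos : 0 < b
  piecewiseC1 : PiecewiseC1 σ
  source : σ 0 = c + b * Complex.I
  target : σ 1 = c - b * Complex.I

theorem continuous_vertical (c : ℝ) : Continuous fun y : ℝ => (c : ℂ) + y * Complex.I := by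
  fun_prop

theorem ae_vertical_notMem {Z : Set ℂ} (hZ : Z.Countable) (c : ℝ) :
    ∀ᵐ y : ℝ, (c : ℂ) + y * Complex.I ∉ Z :=
  (hZ.preimage fun x y h => by simpa using h).ae_notMem volume

namespace IsClosingCurve

variable {c b : ℝ} {σ : ℝ → ℂ}

theorem isCompact_curveSupport (h : IsClosingCurve c b σ) : IsCompact (curveSupport c b σ) :=
  (isCompact_Icc.image (continuous_vertical c)).union
    (isCompact_Icc.image_of_continuousOn h.piecewiseC1.continuousOn)

theorem intervalIntegrable (h : IsClosingCurve c b σ) {g : ℂ → ℂ}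
    (hg : ContinuousOn g (curveSupport c b σ)) :
    IntervalIntegrable (fun y : ℝ => g (c + y * Complex.I) * Complex.I) volume (-b) b := by
  refine ContinuousOn.intervalIntegrable ?_
  rw [uIcc_of_le (by linarith [h.pos])]
  exact ((hg.mono subset_union_left).comp (continuous_vertical c).continuousOn
    (mapsTo_image _ _)).mul continuousOn_const

/-- The increments of the primitive along the segment and along σ cancel, since the curve is closed.
-/
theorem closedIntegral_eq_zero (h : IsClosingCurve c b σ) {g Φ : ℂ → ℂ}
    (hg : ContinuousOn g (curveSupport c b σ))
    (hΦ : ∀ z ∈ curveSupport c b σ, HasDerivAt Φ (g z) z) : closedIntegral c b σ g = 0 := by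
  have e1 : ∫ y in (-b)..b, g (c + y * Complex.I) * Complex.I =
      Φ (c + b * Complex.I) - Φ (c + (-b : ℝ) * Complex.I) := by
    refine intervalIntegral.integral_eq_sub_of_hasDerivAt
      (f := fun y : ℝ => Φ (c + y * Complex.I)) (fun y hy => ?_) (h.intervalIntegrable hg)
    rw [uIcc_of_le (by linarith [h.pos])] at hy
    have h1 : HasDerivAt (fun y : ℝ => (c : ℂ) + y * Complex.I) Complex.I y := by
      simpa using ((Complex.ofRealCLM.hasDerivAt (x := y)).mul_const Complex.I).const_add (c : ℂ)
    exact (hΦ _ (Or.inl (mem_image_of_mem _ hy))).comp y h1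
  rw [closedIntegral, e1, h.piecewiseC1.contourIntegral_eq_sub (hg.mono subset_union_right)
    fun z hz => hΦ z (Or.inr hz), h.source, h.target]
  push_cast
  ring_nf

theorem closedIntegral_congr (h : IsClosingCurve c b σ) {g g' : ℂ → ℂ} {Z : Set ℂ}
    (hZ : Z.Countable) (hgg : ∀ z ∈ curveSupport c b σ, z ∉ Z → g z = g' z) :
    closedIntegral c b σ g = closedIntegral c b σ g' := by
  rw [closedIntegral, closedIntegral,
    h.piecewiseC1.contourIntegral_congr hZ fun z hz => hgg z (Or.inr hz)]
  congr 1
  refine intervalIntegral.integral_congr_ae ?_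
  filter_upwards [ae_vertical_notMem hZ c] with y hy hyb
  rw [uIoc_of_le (by linarith [h.pos])] at hyb
  rw [hgg _ (Or.inl (mem_image_of_mem _ (Ioc_subset_Icc_self hyb))) hy]

theorem closedIntegral_add (h : IsClosingCurve c b σ) {g g' : ℂ → ℂ}
    (hg : ContinuousOn g (curveSupport c b σ)) (hg' : ContinuousOn g' (curveSupport c b σ)) :
    closedIntegral c b σ (fun z => g z + g' z) =
      closedIntegral c b σ g + closedIntegral c b σ g' := by
  simp only [closedIntegral, contourIntegral, add_mul]
  rw [intervalIntegral.integral_add (h.intervalIntegrable hg) (h.intervalIntegrable hg'),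
    intervalIntegral.integral_add
      (h.piecewiseC1.intervalIntegrable_mul_deriv (hg.mono subset_union_right))
      (h.piecewiseC1.intervalIntegrable_mul_deriv (hg'.mono subset_union_right))]
  ring

theorem _root_.NonlocalODE.closedIntegral_const_mul (c b : ℝ) (σ : ℝ → ℂ) (a : ℂ) (g : ℂ → ℂ) :
    closedIntegral c b σ (fun z => a * g z) = a * closedIntegral c b σ g := by
  simp only [closedIntegral, contourIntegral, mul_assoc]
  rw [intervalIntegral.integral_const_mul, intervalIntegral.integral_const_mul]
  ring

theorem closedIntegral_sum (h : IsClosingCurve c b σ) {ι : Type*} (s : Finset ι) {g : ι → ℂ → ℂ}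
    (hg : ∀ i ∈ s, ContinuousOn (g i) (curveSupport c b σ)) :
    closedIntegral c b σ (fun z => ∑ i ∈ s, g i z) = ∑ i ∈ s, closedIntegral c b σ (g i) := by
  classical
  induction s using Finset.induction_on with
  | empty => simp [closedIntegral, contourIntegral]
  | insert i s hi ih =>
    simp only [Finset.sum_insert hi]
    rw [h.closedIntegral_add (hg i (by simp))
      (continuousOn_finsetSum s fun j hj => hg j (by simp [hj])),
      ih fun j hj => hg j (by simp [hj])]

/-- Cauchy's theorem in a disc, where every holomorphic function has a primitive; the shape of σ is
then irrelevant. -/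
theorem closedIntegral_eq_zero_of_differentiableOn_ball (h : IsClosingCurve c b σ) {g : ℂ → ℂ}
    {ρ : ℝ} (hK : curveSupport c b σ ⊆ Metric.ball 0 ρ)
    (hg : DifferentiableOn ℂ g (Metric.ball 0 ρ)) : closedIntegral c b σ g = 0 := by
  obtain ⟨Φ, hΦ⟩ := hg.isExactOn_ball
  exact h.closedIntegral_eq_zero (hg.continuousOn.mono hK) fun z hz => hΦ z (hK hz)

/-- The residue of `e^{tz} (z - a)^{-k-1}`, weighted by the winding number. -/
theorem closedIntegral_exp_mul_inv_pow (h : IsClosingCurve c b σ) {a : ℂ}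
    (ha : a ∉ curveSupport c b σ) (t : ℂ) (k : ℕ) :
    closedIntegral c b σ (fun z => Complex.exp (t * z) * ((z - a) ^ (k + 1))⁻¹) =
      2 * Real.pi * Complex.I * windingNumber c b σ a *
        (t ^ k / k.factorial * Complex.exp (t * a)) := by
  have hne : ∀ z ∈ curveSupport c b σ, z - a ≠ 0 := fun z hz h0 =>
    ha (sub_eq_zero.1 h0 ▸ hz)
  have hcont : ∀ k : ℕ, ContinuousOn (fun z => Complex.exp (t * z) * ((z - a) ^ (k + 1))⁻¹)
      (curveSupport c b σ) := fun k =>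
    (by fun_prop : ContinuousOn (fun z => Complex.exp (t * z)) _).mul
      (ContinuousOn.inv₀ (by fun_prop) fun z hz => pow_ne_zero _ (hne z hz))
  induction k with
  | zero =>
    have hpi : (2 * Real.pi * Complex.I : ℂ) ≠ 0 := by simp [Real.pi_ne_zero]
    have hexp : Differentiable ℂ fun z => Complex.exp (t * z) := by fun_prop
    -- e^{tz}/(z − a) is e^{ta}/(z − a) plus this entire function, and the integral of the first
    -- term is the winding number up to constants.
    have hE : Differentiable ℂ (dslope (fun z => Complex.exp (t * z)) a) := by
      rw [← differentiableOn_univ, Complex.differentiableOn_dslope univ_mem, differentiableOn_univ]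
      exact hexp
    obtain ⟨ρ, hρ⟩ := h.isCompact_curveSupport.isBounded.subset_ball 0
    have h1 := h.closedIntegral_eq_zero_of_differentiableOn_ball hρ hE.differentiableOn
    have e : closedIntegral c b σ (fun z => Complex.exp (t * z) * ((z - a) ^ (0 + 1))⁻¹) =
        closedIntegral c b σ (fun z => Complex.exp (t * a) * (z - a)⁻¹ +
          dslope (fun z => Complex.exp (t * z)) a z) := by
      refine h.closedIntegral_congr countable_empty fun z hz _ => ?_
      have hz' := hne z hz
      rw [dslope_of_ne _ (sub_ne_zero.1 hz'), slope_def_field, zero_add, pow_one]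
      field_simp
      ring
    rw [e, h.closedIntegral_add _ hE.continuous.continuousOn, h1, closedIntegral_const_mul,
      windingNumber_eq]
    · field_simp
      simp
    · exact continuousOn_const.mul (ContinuousOn.inv₀ (by fun_prop) hne)
  | succ k ih =>
    -- Integration by parts: the derivative of e^{tz}(z − a)^{-(k+1)} integrates to zero, which
    -- relates the pole of order k + 2 to that of order k + 1.
    have h1 : closedIntegral c b σ (fun z =>
        t * (Complex.exp (t * z) * ((z - a) ^ (k + 1))⁻¹) +
          (-(k + 1 : ℂ)) * (Complex.exp (t * z) * ((z - a) ^ (k + 1 + 1))⁻¹)) = 0 := by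
      refine h.closedIntegral_eq_zero
        (Φ := fun z => Complex.exp (t * z) * ((z - a) ^ (k + 1))⁻¹)
        ((continuousOn_const.mul (hcont k)).add (continuousOn_const.mul (hcont (k + 1))))
        fun z hz => ?_
      have hz' := hne z hz
      have d1 : HasDerivAt (fun z => Complex.exp (t * z)) (Complex.exp (t * z) * (t * 1)) z :=
        ((hasDerivAt_id z).const_mul t).cexp
      have d2 : HasDerivAt (fun z => (z - a) ^ (k + 1)) (((k + 1 : ℕ) : ℂ) * (z - a) ^ k) z := by
        simpa using ((hasDerivAt_id' z).sub_const a).fun_pow (k + 1)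
      refine (d1.fun_mul (d2.fun_inv (pow_ne_zero _ hz'))).congr_deriv ?_
      push_cast
      field_simp
      ring
    have hc1 : ContinuousOn (fun z => t * (Complex.exp (t * z) * ((z - a) ^ (k + 1))⁻¹))
        (curveSupport c b σ) := continuousOn_const.mul (hcont k)
    have hc2 : ContinuousOn
        (fun z => (-(k + 1 : ℂ)) * (Complex.exp (t * z) * ((z - a) ^ (k + 1 + 1))⁻¹))
        (curveSupport c b σ) := continuousOn_const.mul (hcont (k + 1))
    rw [h.closedIntegral_add hc1 hc2, closedIntegral_const_mul, closedIntegral_const_mul, ih] at h1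
    have hk : (k + 1 : ℂ) ≠ 0 := by exact_mod_cast Nat.succ_ne_zero k
    have hkf : (k.factorial : ℂ) ≠ 0 := by exact_mod_cast Nat.factorial_ne_zero k
    rw [Nat.factorial_succ]
    push_cast
    field_simp
    field_simp at h1
    linear_combination -h1

end IsClosingCurve

end NonlocalODE

/-! ### Principal parts and the residue theorem -/

namespace NonlocalODE

/-- Writing g(z) = g(a) + (z − a) · `dslope g a z` peels off the top power and lowers the exponent
by one. The condition m = k + 1 singles out the top coefficient and is vacuous for m = 0. -/
theorem exists_inv_pow_mul_eq {g : ℂ → ℂ} {a : ℂ} (hg : AnalyticAt ℂ g a) (m : ℕ) :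
    ∃ (α : ℕ → ℂ) (h : ℂ → ℂ), AnalyticAt ℂ h a ∧ (∀ k, m = k + 1 → α k = g a) ∧
      ∀ᶠ z in 𝓝[≠] a,
        ((z - a) ^ m)⁻¹ * g z = (∑ k ∈ Finset.range m, α k * ((z - a) ^ (k + 1))⁻¹) + h z := by
  induction m generalizing g with
  | zero => exact ⟨0, g, hg, by simp, by simp⟩
  | succ m ih =>
    obtain ⟨q, hq⟩ := hg
    obtain ⟨α, h, hh, -, he⟩ := ih hq.has_fpower_series_dslope_fslope.analyticAt
    refine ⟨Function.update α m (g a), h, hh, fun k hk => ?_, ?_⟩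
    · obtain rfl : m = k := by omega
      simp
    · filter_upwards [he, self_mem_nhdsWithin] with z hz hza
      have hz' : z - a ≠ 0 := sub_ne_zero.2 hza
      have e : ((z - a) ^ (m + 1))⁻¹ * g z =
          ((z - a) ^ m)⁻¹ * dslope g a z + g a * ((z - a) ^ (m + 1))⁻¹ := by
        rw [dslope_of_ne _ hza, slope_def_field]
        field_simp
        ring
      rw [e, hz, Finset.sum_range_succ, Function.update_self]
      have : ∑ k ∈ Finset.range m, Function.update α m (g a) k * ((z - a) ^ (k + 1))⁻¹ =
          ∑ k ∈ Finset.range m, α k * ((z - a) ^ (k + 1))⁻¹ :=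
        Finset.sum_congr rfl fun k hk => by
          rw [Function.update_of_ne (Finset.mem_range.1 hk).ne]
      rw [this]
      ring

/-- The principal part at `a` with coefficients `α`. -/
noncomputable def principalPart (a : ℂ) (m : ℕ) (α : ℕ → ℂ) (z : ℂ) : ℂ :=
  ∑ k ∈ Finset.range m, α k * ((z - a) ^ (k + 1))⁻¹

theorem analyticAt_principalPart {a z : ℂ} (h : z ≠ a) (m : ℕ) (α : ℕ → ℂ) :
    AnalyticAt ℂ (principalPart a m α) z := by
  unfold principalPart
  refine Finset.analyticAt_fun_sum _ fun k _ => analyticAt_const.mul (AnalyticAt.inv ?_ ?_)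
  · fun_prop
  · exact pow_ne_zero _ (sub_ne_zero.2 h)

theorem meromorphic_principalPart (a : ℂ) (m : ℕ) (α : ℕ → ℂ) :
    Meromorphic (principalPart a m α) := by
  intro z
  unfold principalPart
  fun_prop

/-- The top coefficient is the value at a of the nonvanishing factor (z − a)^m G(z); this makes the
degree of `residuePoly` exact. -/
theorem exists_principalPart {G : ℂ → ℂ} {a : ℂ} {m : ℕ} (hG : MeromorphicAt G a)
    (hm : meromorphicOrderAt G a = ((-(m : ℤ) : ℤ) : WithTop ℤ)) :
    ∃ (α : ℕ → ℂ) (h : ℂ → ℂ), AnalyticAt ℂ h a ∧ (∀ k, m = k + 1 → α k ≠ 0) ∧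
      ∀ᶠ z in 𝓝[≠] a, G z = principalPart a m α z + h z := by
  obtain ⟨g, hg, hga, he⟩ := (meromorphicOrderAt_eq_int_iff hG).1 hm
  obtain ⟨α, h, hh, hα, he'⟩ := exists_inv_pow_mul_eq hg m
  refine ⟨α, h, hh, fun k hk => hα k hk ▸ hga, ?_⟩
  filter_upwards [he, he'] with z h1 h2
  rw [h1, zpow_neg, zpow_natCast, smul_eq_mul, h2, principalPart]

/-- The coefficient of `e^{at}` in the residue of `e^{tz} principalPart a m α z`. -/
noncomputable def residuePoly (m : ℕ) (α : ℕ → ℂ) : Polynomial ℂ :=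
  ∑ k ∈ Finset.range m, Polynomial.C (α k / k.factorial) * Polynomial.X ^ k

theorem eval_residuePoly (m : ℕ) (α : ℕ → ℂ) (t : ℂ) :
    (residuePoly m α).eval t = ∑ k ∈ Finset.range m, α k * (t ^ k / k.factorial) := by
  simp only [residuePoly, Polynomial.eval_finsetSum, Polynomial.eval_mul, Polynomial.eval_C,
    Polynomial.eval_pow, Polynomial.eval_X]
  exact Finset.sum_congr rfl fun k _ => by ring

theorem degree_residuePoly {m : ℕ} {α : ℕ → ℂ} (hm : 1 ≤ m) (hα : ∀ k, m = k + 1 → α k ≠ 0) :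
    (residuePoly m α).degree = ((m - 1 : ℕ) : WithBot ℕ) := by
  obtain ⟨k, rfl⟩ : ∃ k, m = k + 1 := ⟨m - 1, by omega⟩
  rw [residuePoly, Finset.sum_range_succ, Nat.add_sub_cancel]
  have hk : α k / k.factorial ≠ 0 :=
    div_ne_zero (hα k rfl) (by exact_mod_cast k.factorial_ne_zero)
  rw [Polynomial.degree_add_eq_right_of_degree_lt, Polynomial.degree_C_mul_X_pow _ hk]
  rw [Polynomial.degree_C_mul_X_pow _ hk]
  rw [Finset.sum_range]
  exact Polynomial.degree_sum_fin_lt fun j : Fin k => α j / (j : ℕ).factorial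

/-- Removing singularities of a meromorphic function. -/
theorem exists_analyticAt_eventuallyEq {G : ℂ → ℂ} (hG : Meromorphic G) :
    ∃ H : ℂ → ℂ, (∀ z, 0 ≤ meromorphicOrderAt G z → AnalyticAt ℂ H z) ∧
      (∀ z, H =ᶠ[𝓝[≠] z] G) ∧ ∃ Z : Set ℂ, Z.Countable ∧ ∀ z ∉ Z, H z = G z := by
  have hG' : MeromorphicOn G univ := fun z _ => hG z
  -- The normal form is analytic wherever the order is nonnegative, and it differs from `G` only off
  -- a codiscrete set, that is, at countably many points.
  refine ⟨toMeromorphicNFOn G univ, fun z hz => ?_,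
    fun z => hG'.toMeromorphicNFOn_eq_self_on_nhdsNE (mem_univ z), _,
    countable_diff_of_mem_codiscreteWithin (toMeromorphicNFOn_eqOn_codiscrete hG'), ?_⟩
  · rw [← (meromorphicNFOn_toMeromorphicNFOn G univ
      (mem_univ z)).meromorphicOrderAt_nonneg_iff_analyticAt,
      meromorphicOrderAt_toMeromorphicNFOn hG' (mem_univ z)]
    exact hz
  · intro z hz
    by_contra hne
    exact hz ⟨mem_univ z, fun h => hne h.symm⟩

/-- A meromorphic function has only finitely many non-analytic points in a compact disc, so finitely
many principal parts need to be subtracted there. -/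
theorem finite_setOf_pole_mem_ball {G : ℂ → ℂ} (hG : Meromorphic G) {p : ℕ → ℂ}
    (hp : Function.Injective p) (hneg : ∀ i, meromorphicOrderAt G (p i) < 0) (ρ : ℝ) :
    {i | p i ∈ Metric.ball (0 : ℂ) ρ}.Finite := by
  have hG' : MeromorphicOn G (Metric.closedBall 0 ρ) := fun z _ => hG z
  have hfin := (isCompact_closedBall (0 : ℂ) ρ).finite_sdiff_of_mem_codiscreteWithin
    hG'.analyticAt_mem_codiscreteWithin
  refine (hfin.preimage hp.injOn).subset fun i hi => ?_
  exact ⟨Metric.ball_subset_closedBall hi,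
    fun ha => absurd (AnalyticAt.meromorphicOrderAt_nonneg ha) (not_le.2 (hneg i))⟩

/-- The residue theorem for `e^{tz} G(z)`. -/
theorem IsClosingCurve.closedIntegral_exp_mul_eq {c b : ℝ} {σ : ℝ → ℂ} (h : IsClosingCurve c b σ)
    {G : ℂ → ℂ} (hG : Meromorphic G) {p : ℕ → ℂ} {m : ℕ → ℕ} (hp : Function.Injective p)
    (hneg : ∀ i, meromorphicOrderAt G (p i) < 0)
    (hpole : ∀ z, meromorphicOrderAt G z < 0 → ∃ i, z = p i)
    {α : ℕ → ℕ → ℂ} {g : ℕ → ℂ → ℂ} (hg : ∀ i, AnalyticAt ℂ (g i) (p i))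
    (hα : ∀ i, ∀ᶠ z in 𝓝[≠] (p i), G z = principalPart (p i) (m i) (α i) z + g i z)
    (hpσ : ∀ i, p i ∉ curveSupport c b σ) {n : ℕ}
    (hw1 : ∀ i < n, windingNumber c b σ (p i) = 1)
    (hw0 : ∀ i, n ≤ i → windingNumber c b σ (p i) = 0) (t : ℝ) :
    closedIntegral c b σ (fun z => Complex.exp (t * z) * G z) =
      2 * Real.pi * Complex.I * expSum (fun i => residuePoly (m i) (α i)) p n t := by
  classical
  have hbdd : Bornology.IsBounded (curveSupport c b σ ∪ p '' Iio n) :=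
    h.isCompact_curveSupport.isBounded.union ((finite_Iio n).image p).isBounded
  obtain ⟨ρ, hρ⟩ := hbdd.subset_ball 0
  have hK : curveSupport c b σ ⊆ Metric.ball 0 ρ := subset_union_left.trans hρ
  -- All poles in the disc, not only the first n: only then does the remainder have nothing but
  -- removable singularities there. The extra ones drop out by winding number 0.
  set I := (finite_setOf_pole_mem_ball hG hp hneg ρ).toFinset with hI
  have memI : ∀ i, i ∈ I ↔ p i ∈ Metric.ball (0 : ℂ) ρ := fun i => by simp [hI]
  set pp : ℕ → ℂ → ℂ := fun i => principalPart (p i) (m i) (α i) with hpp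
  set H0 : ℂ → ℂ := fun z => G z - ∑ i ∈ I, pp i z with hH0
  have hH0m : Meromorphic H0 := by
    intro z
    have : ∀ i ∈ I, MeromorphicAt (pp i) z := fun i _ => meromorphic_principalPart _ _ _ z
    exact (hG z).fun_sub (MeromorphicAt.fun_sum this)
  have hord : ∀ z ∈ Metric.ball (0 : ℂ) ρ, 0 ≤ meromorphicOrderAt H0 z := by
    intro z hz
    by_cases hzp : ∃ i, z = p i
    · obtain ⟨i, rfl⟩ := hzp
      refine (MeromorphicAt.meromorphicOrderAt_nonneg_iff (hH0m _)).2
        ⟨fun z => g i z - ∑ j ∈ I.erase i, pp j z, ?_, ?_⟩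
      · refine (hg i).fun_sub (Finset.analyticAt_fun_sum _ fun j hj => ?_)
        exact analyticAt_principalPart (fun h => (Finset.ne_of_mem_erase hj) (hp h).symm) _ _
      · filter_upwards [hα i] with z hz'
        simp only [hH0]
        rw [hz', ← Finset.add_sum_erase _ _ ((memI i).2 hz)]
        ring
    · have h0 : 0 ≤ meromorphicOrderAt G z := not_lt.1 fun h => hzp (hpole z h)
      obtain ⟨k, hk, he⟩ := (MeromorphicAt.meromorphicOrderAt_nonneg_iff (hG z)).1 h0
      refine (MeromorphicAt.meromorphicOrderAt_nonneg_iff (hH0m _)).2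
        ⟨fun z => k z - ∑ j ∈ I, pp j z, ?_, ?_⟩
      · refine hk.fun_sub (Finset.analyticAt_fun_sum _ fun j hj => ?_)
        exact analyticAt_principalPart (fun h => hzp ⟨j, h⟩) _ _
      · filter_upwards [he] with z hz'
        simp only [hH0]
        rw [hz']
  -- The values of `H0` at its removable singularities are arbitrary. Correcting them changes it on
  -- a countable set only, which closed integrals ignore even if the curve meets it.
  obtain ⟨H, hHan, -, Z, hZ, hHZ⟩ := exists_analyticAt_eventuallyEq hH0m
  have hHd : DifferentiableOn ℂ H (Metric.ball 0 ρ) := fun z hz =>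
    (hHan z (hord z hz)).differentiableAt.differentiableWithinAt
  have hexp : Differentiable ℂ fun z => Complex.exp (t * z) := by fun_prop
  have hEH : DifferentiableOn ℂ (fun z => Complex.exp (t * z) * H z) (Metric.ball 0 ρ) :=
    hexp.differentiableOn.fun_mul hHd
  have hterm : ∀ i k, ContinuousOn
      (fun z => α i k * (Complex.exp (t * z) * ((z - p i) ^ (k + 1))⁻¹)) (curveSupport c b σ) := by
    intro i k
    refine continuousOn_const.mul (hexp.continuous.continuousOn.mul
      (ContinuousOn.inv₀ (by fun_prop) fun z hz => pow_ne_zero _ (sub_ne_zero.2 ?_)))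
    rintro rfl
    exact hpσ i hz
  have hinner : ∀ i, ContinuousOn (fun z => ∑ k ∈ Finset.range (m i),
      α i k * (Complex.exp (t * z) * ((z - p i) ^ (k + 1))⁻¹)) (curveSupport c b σ) :=
    fun i => continuousOn_finsetSum _ fun k _ => hterm i k
  have e : closedIntegral c b σ (fun z => Complex.exp (t * z) * G z) =
      closedIntegral c b σ (fun z => Complex.exp (t * z) * H z + ∑ i ∈ I,
        ∑ k ∈ Finset.range (m i), α i k * (Complex.exp (t * z) * ((z - p i) ^ (k + 1))⁻¹)) := by
    refine h.closedIntegral_congr hZ fun z _ hz => ?_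
    have : G z = H z + ∑ i ∈ I, pp i z := by rw [hHZ z hz, hH0]; ring
    rw [this, mul_add, Finset.mul_sum]
    congr 1
    refine Finset.sum_congr rfl fun i _ => ?_
    simp only [hpp, principalPart]
    rw [Finset.mul_sum]
    exact Finset.sum_congr rfl fun k _ => by ring
  rw [e, h.closedIntegral_add (hEH.continuousOn.mono hK)
    (continuousOn_finsetSum _ fun i _ => hinner i),
    h.closedIntegral_eq_zero_of_differentiableOn_ball hK hEH, zero_add,
    h.closedIntegral_sum _ fun i _ => hinner i]
  have hterm_eq : ∀ i, closedIntegral c b σ (fun z => ∑ k ∈ Finset.range (m i),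
      α i k * (Complex.exp (t * z) * ((z - p i) ^ (k + 1))⁻¹)) =
      2 * Real.pi * Complex.I * (windingNumber c b σ (p i) *
        ((residuePoly (m i) (α i)).eval (t : ℂ) * Complex.exp (p i * t))) := by
    intro i
    rw [h.closedIntegral_sum _ fun k _ => hterm i k, eval_residuePoly, Finset.sum_mul,
      Finset.mul_sum, Finset.mul_sum]
    refine Finset.sum_congr rfl fun k _ => ?_
    rw [closedIntegral_const_mul, h.closedIntegral_exp_mul_inv_pow (hpσ i), mul_comm (p i) (t : ℂ)]
    ring
  have hsub : Finset.range n ⊆ I := fun i hi =>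
    (memI i).2 (hρ (Or.inr (mem_image_of_mem p (Finset.mem_range.1 hi))))
  rw [Finset.sum_congr rfl fun i _ => hterm_eq i, ← Finset.mul_sum, expSum,
    ← Finset.sum_subset hsub]
  · refine congrArg _ (Finset.sum_congr rfl fun i hi => ?_)
    rw [hw1 i (Finset.mem_range.1 hi), one_mul]
  · intro i _ hi
    rw [hw0 i (not_lt.1 fun h => hi (Finset.mem_range.2 h)), zero_mul]

theorem HasPoles.notMem_curveSupport {ω b : ℝ} {f r : ℂ → ℂ} {p : ℕ → ℂ} {m : ℕ → ℕ} {n : ℕ}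
    {σ : ℝ → ℂ} (hp : HasPoles ω f r p m) (hσ : IsEnclosingCurve ω b p n σ) (i : ℕ) :
    p i ∉ curveSupport ω b σ := by
  rintro (⟨y, -, hy⟩ | ⟨u, hu, hy⟩)
  · have := hp.2.2.2.1 i
    rw [← hy] at this
    simp at this
  · exact hσ.2.2.2.2.2.1 u hu i hy

/-- The closed integral is the Bromwich segment at abscissa ω plus the integral along σ_n, so by the
residue theorem the difference is exactly 1/(2πi) times the latter. -/
theorem tendsto_expSum_sub_bromwich {ω : ℝ} {f r : ℂ → ℂ} {p : ℕ → ℂ} {m : ℕ → ℕ} {b : ℕ → ℝ}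
    {σ : ℕ → ℝ → ℂ} (hp : HasPoles ω f r p m) (hσ : ∀ n, IsEnclosingCurve ω (b n) p n (σ n))
    {α : ℕ → ℕ → ℂ} {g : ℕ → ℂ → ℂ} (hg : ∀ i, AnalyticAt ℂ (g i) (p i))
    (hα : ∀ i, ∀ᶠ z in 𝓝[≠] (p i), r z / f z = principalPart (p i) (m i) (α i) z + g i z)
    {t : ℝ} (hlim : Tendsto (fun n => contourIntegral
      (fun s => Complex.exp (t * s) * (r s / f s)) (σ n)) atTop (𝓝 0)) :
    Tendsto (fun n => expSum (fun i => residuePoly (m i) (α i)) p n t -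
      bromwich (fun s => r s / f s) ω (b n) t) atTop (𝓝 0) := by
  have hpi : (2 * Real.pi * Complex.I : ℂ) ≠ 0 := by simp [Real.pi_ne_zero]
  have hneg : ∀ i, meromorphicOrderAt (fun s => r s / f s) (p i) < 0 := fun i => by
    rw [hp.2.2.2.2.2.1 i]
    have := hp.2.2.2.2.1 i
    exact_mod_cast (by omega : -(m i : ℤ) < 0)
  have key : ∀ n, expSum (fun i => residuePoly (m i) (α i)) p n t -
      bromwich (fun s => r s / f s) ω (b n) t = 1 / (2 * Real.pi * Complex.I) *
        contourIntegral (fun s => Complex.exp (t * s) * (r s / f s)) (σ n) := by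
    intro n
    have hc : IsClosingCurve ω (b n) (σ n) :=
      ⟨(hσ n).1, (hσ n).2.1, (hσ n).2.2.1, (hσ n).2.2.2.1⟩
    have := hc.closedIntegral_exp_mul_eq hp.1 hp.2.1 hneg hp.2.2.2.2.2.2 hg hα
      (hp.notMem_curveSupport (hσ n)) (hσ n).2.2.2.2.2.2.1 (hσ n).2.2.2.2.2.2.2 t
    have e : expSum (fun i => residuePoly (m i) (α i)) p n t = 1 / (2 * Real.pi * Complex.I) *
        closedIntegral ω (b n) (σ n) (fun z => Complex.exp (t * z) * (r z / f z)) := by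
      rw [this]
      field_simp
    rw [e, closedIntegral, bromwich, mul_add]
    simp only [mul_comm (t : ℂ)]
    ring
  simp only [key]
  simpa using hlim.const_mul (1 / (2 * Real.pi * Complex.I))

end NonlocalODE

/-! ### Moving the line of integration -/

namespace NonlocalODE

variable {ω c t : ℝ} {F : ℂ → ℂ}

/-- Cauchy's theorem on the rectangle [ω, c] × [−N, N], with mere continuity up to the edge and a
countable exceptional set, which will be the zeros of f. -/
theorem bromwich_sub_bromwich (hc : ω ≤ c) (hF : ContinuousOn F {s : ℂ | ω ≤ s.re})
    {Z : Set ℂ} (hZ : Z.Countable)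
    (hd : ∀ z : ℂ, ω < z.re → z ∉ Z → DifferentiableAt ℂ F z) (N t : ℝ) :
    bromwich F ω N t - bromwich F c N t = 1 / (2 * Real.pi * Complex.I) *
      ((∫ x in ω..c, Complex.exp ((x + (-N : ℝ) * Complex.I) * t) *
          F (x + (-N : ℝ) * Complex.I)) -
        ∫ x in ω..c, Complex.exp ((x + N * Complex.I) * t) * F (x + N * Complex.I)) := by
  have hexp : Differentiable ℂ fun s : ℂ => Complex.exp (s * t) := by fun_prop
  have key := Complex.integral_boundary_rect_eq_zero_of_differentiable_on_off_countable
    (fun s => Complex.exp (s * t) * F s) (ω + (-N : ℝ) * Complex.I) (c + N * Complex.I) Z hZ ?_ ?_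
  · simp only [Complex.add_re, Complex.add_im, Complex.mul_re, Complex.mul_im, Complex.ofReal_re,
      Complex.ofReal_im, Complex.I_re, Complex.I_im, mul_zero, mul_one, sub_zero,
      add_zero, zero_add, smul_eq_mul] at key
    simp only [bromwich, intervalIntegral.integral_mul_const]
    linear_combination (-(1 / (2 * Real.pi * Complex.I)) : ℂ) * key
  · refine hexp.continuous.continuousOn.mul (hF.mono fun z hz => ?_)
    have := hz.1
    simp only [Complex.add_re, Complex.mul_re, Complex.ofReal_re,
      Complex.ofReal_im, Complex.I_re, Complex.I_im, mul_zero, mul_one, sub_zero,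
      add_zero, mem_preimage, uIcc_of_le hc] at this
    exact this.1
  · intro z hz
    have := hz.1.1
    simp only [Complex.add_re, Complex.mul_re, Complex.ofReal_re,
      Complex.ofReal_im, Complex.I_re, Complex.I_im, mul_zero, mul_one, sub_zero,
      add_zero, mem_preimage, min_eq_left hc] at this
    exact (hexp z).fun_mul (hd z this.1 hz.2)

/-- The line of integration may be moved to the edge of the half-plane of holomorphy. -/
theorem tendsto_bromwich_sub_bromwich (hc : ω ≤ c) (hF : ContinuousOn F {s : ℂ | ω ≤ s.re})
    {Z : Set ℂ} (hZ : Z.Countable)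
    (hd : ∀ z : ℂ, ω < z.re → z ∉ Z → DifferentiableAt ℂ F z)
    (h0 : Tendsto F (Bornology.cobounded ℂ ⊓ 𝓟 {s : ℂ | ω ≤ s.re}) (𝓝 0)) (ht : 0 < t) :
    Tendsto (fun N : ℝ => bromwich F ω N t - bromwich F c N t) atTop (𝓝 0) := by
  have key : ∀ k : ℝ, k = 1 ∨ k = -1 → Tendsto (fun N : ℝ => ∫ x in ω..c,
      Complex.exp ((x + (k * N : ℝ) * Complex.I) * t) * F (x + (k * N : ℝ) * Complex.I))
      atTop (𝓝 0) := by
    intro k hk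
    rw [Metric.tendsto_nhds]
    intro ε hε
    -- Makes the bound on a horizontal edge at most ε/2; the summand 1 keeps the denominator
    -- positive when c = ω.
    set δ : ℝ := ε / (2 * (Real.exp (c * t) * (|c - ω| + 1))) with hδ
    have hE := Real.exp_pos (c * t)
    have hpos : 0 < Real.exp (c * t) * (|c - ω| + 1) := by positivity
    have hδ0 : 0 < δ := by positivity
    have h1 := (Metric.tendsto_nhds.1 h0) δ hδ0
    rw [eventually_inf_principal,
      (Metric.hasBasis_cobounded_compl_closedBall (0 : ℂ)).eventually_iff] at h1
    obtain ⟨M, -, hM⟩ := h1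
    filter_upwards [eventually_gt_atTop M, eventually_gt_atTop 0] with N hN hN0
    rw [dist_zero_right]
    have hb : ∀ x ∈ uIoc ω c, ‖Complex.exp ((x + (k * N : ℝ) * Complex.I) * t) *
        F (x + (k * N : ℝ) * Complex.I)‖ ≤ Real.exp (c * t) * δ := by
      intro x hx
      rw [uIoc_of_le hc] at hx
      have him : ((x : ℂ) + (k * N : ℝ) * Complex.I).im = k * N := by simp
      have hre : ((x : ℂ) + (k * N : ℝ) * Complex.I).re = x := by simp
      have habs : |k * N| = N := by rcases hk with rfl | rfl <;> simp [abs_of_pos hN0]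
      have hn : M < ‖(x : ℂ) + (k * N : ℝ) * Complex.I‖ := by
        refine hN.trans_le ?_
        have := Complex.abs_im_le_norm ((x : ℂ) + (k * N : ℝ) * Complex.I)
        rwa [him, habs] at this
      have h2 := hM (x := (x : ℂ) + (k * N : ℝ) * Complex.I) (by simpa using hn)
        (by rw [mem_ofPred_eq, hre]; exact hx.1.le)
      rw [dist_zero_right] at h2
      rw [norm_mul, Complex.norm_exp]
      refine mul_le_mul (Real.exp_le_exp.2 ?_) h2.le (norm_nonneg _) hE.le
      rw [Complex.re_mul_ofReal, hre]
      exact mul_le_mul_of_nonneg_right hx.2 ht.le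
    refine (intervalIntegral.norm_integral_le_of_norm_le_const hb).trans_lt ?_
    have : Real.exp (c * t) * δ * (|c - ω| + 1) = ε / 2 := by
      rw [hδ]; field_simp
    have h3 : Real.exp (c * t) * δ * |c - ω| ≤ Real.exp (c * t) * δ * (|c - ω| + 1) := by
      gcongr; linarith
    linarith
  have h := ((key (-1) (Or.inr rfl)).sub (key 1 (Or.inl rfl))).const_mul
    (1 / (2 * Real.pi * Complex.I))
  simp only [sub_zero, mul_zero, neg_mul, one_mul] at h
  exact h.congr fun N => (bromwich_sub_bromwich hc hF hZ hd N t).symm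

theorem bromwich_congr_of_countable {F G : ℂ → ℂ} {Z : Set ℂ} (hZ : Z.Countable)
    (h : ∀ z ∉ Z, F z = G z) (c N t : ℝ) : bromwich F c N t = bromwich G c N t := by
  rw [bromwich, bromwich]
  congr 1
  refine intervalIntegral.integral_congr_ae ?_
  filter_upwards [ae_vertical_notMem hZ c] with y hy _
  rw [h _ hy]

/-- With its removable singularities filled in, `G` is analytic on the closed half-plane, and the
decay bound survives by continuity. -/
theorem tendsto_bromwich_sub_bromwich_of_meromorphic {G : ℂ → ℂ} (hG : Meromorphic G)
    (hord : ∀ z : ℂ, ω ≤ z.re → 0 ≤ meromorphicOrderAt G z)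
    (hgrowth : ∃ C q M : ℝ, 0 < q ∧ ∀ s : ℂ, ω ≤ s.re → M ≤ ‖s‖ → ‖G s‖ ≤ C / ‖s‖ ^ q)
    (hc : ω ≤ c) (ht : 0 < t) :
    Tendsto (fun N : ℝ => bromwich G ω N t - bromwich G c N t) atTop (𝓝 0) := by
  obtain ⟨H, hHan, hHG, Z, hZ, hHZ⟩ := exists_analyticAt_eventuallyEq hG
  obtain ⟨C, q, M, hq, hb⟩ := hgrowth
  have hbH : ∀ z : ℂ, ω ≤ z.re → M < ‖z‖ → 0 < ‖z‖ → ‖H z‖ ≤ C / ‖z‖ ^ q := by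
    intro z hz hM h0
    -- Approaching z from the right stays in the half-plane and avoids z, so `H z` is a limit of
    -- values of `G`.
    have ht : Tendsto (fun ε : ℝ => z + ε) (𝓝[>] 0) (𝓝[≠] z) := by
      refine tendsto_nhdsWithin_iff.2 ⟨?_, ?_⟩
      · have : Continuous fun ε : ℝ => z + ε := by fun_prop
        simpa using (this.tendsto 0).mono_left nhdsWithin_le_nhds
      · filter_upwards [self_mem_nhdsWithin] with ε hε
        have : (ε : ℂ) ≠ 0 := by exact_mod_cast (ne_of_gt hε)
        simpa using this
    have ht' : Tendsto (fun ε : ℝ => z + ε) (𝓝[>] 0) (𝓝 z) := ht.mono_right nhdsWithin_le_nhds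
    have hn : Tendsto (fun ε : ℝ => ‖z + ε‖) (𝓝[>] 0) (𝓝 ‖z‖) := ht'.norm
    refine le_of_tendsto_of_tendsto ((hHan z (hord z hz)).continuousAt.tendsto.comp ht').norm
      (tendsto_const_nhds.div (hn.rpow_const (Or.inl h0.ne')) (Real.rpow_pos_of_pos h0 q).ne') ?_
    filter_upwards [ht.eventually (hHG z), hn.eventually (lt_mem_nhds hM),
      self_mem_nhdsWithin] with ε h1 h2 h3
    rw [Function.comp_apply, h1]
    refine hb _ ?_ h2.le
    have : (0 : ℝ) < ε := h3
    simp only [Complex.add_re, Complex.ofReal_re]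
    linarith
  have h0 : Tendsto H (Bornology.cobounded ℂ ⊓ 𝓟 {s : ℂ | ω ≤ s.re}) (𝓝 0) := by
    have hlim : Tendsto (fun z : ℂ => C / ‖z‖ ^ q)
        (Bornology.cobounded ℂ ⊓ 𝓟 {s : ℂ | ω ≤ s.re}) (𝓝 0) :=
      (((tendsto_rpow_atTop hq).comp tendsto_norm_cobounded_atTop).const_div_atTop C).mono_left
        inf_le_left
    refine squeeze_zero_norm' ?_ hlim
    rw [eventually_inf_principal]
    filter_upwards [tendsto_norm_cobounded_atTop.eventually_gt_atTop M,
      tendsto_norm_cobounded_atTop.eventually_gt_atTop 0] with z h1 h2 hz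
    exact hbH z hz h1 h2
  have := tendsto_bromwich_sub_bromwich (F := H) hc
    (fun z hz => (hHan z (hord z hz)).continuousAt.continuousWithinAt) countable_empty
    (fun z hz _ => (hHan z (hord z hz.le)).differentiableAt) h0 ht
  refine this.congr fun N => ?_
  rw [bromwich_congr_of_countable hZ hHZ, bromwich_congr_of_countable hZ hHZ]

end NonlocalODE

/-! ### Convergence in measure, and the equation on the half-plane -/

namespace NonlocalODE

theorem TendstoInMeasure.add {α ι E : Type*} [MeasurableSpace α] {μ : Measure α}
    [SeminormedAddCommGroup E] {l : Filter ι} {f f' : ι → α → E} {g g' : α → E}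
    (hf : TendstoInMeasure μ f l g) (hf' : TendstoInMeasure μ f' l g') :
    TendstoInMeasure μ (fun i x => f i x + f' i x) l (fun x => g x + g' x) := by
  intro ε hε
  have hε2 : 0 < ε / 2 := ENNReal.half_pos hε.ne'
  have h := (hf _ hε2).add (hf' _ hε2)
  rw [add_zero] at h
  refine tendsto_of_tendsto_of_tendsto_of_le_of_le tendsto_const_nhds h (fun _ => zero_le)
    fun i => (measure_mono fun x hx => ?_).trans (measure_union_le _ _)
  by_contra hne
  simp only [mem_union, mem_ofPred_eq, not_or, not_le] at hne
  have := (edist_add_add_le (f i x) (f' i x) (g x) (g' x)).trans_lt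
    (ENNReal.add_lt_add hne.1 hne.2)
  rw [ENNReal.add_halves] at this
  exact not_le.2 this hx

theorem TendstoInMeasure.sub {α ι E : Type*} [MeasurableSpace α] {μ : Measure α}
    [SeminormedAddCommGroup E] {l : Filter ι} {f f' : ι → α → E} {g g' : α → E}
    (hf : TendstoInMeasure μ f l g) (hf' : TendstoInMeasure μ f' l g') :
    TendstoInMeasure μ (fun i x => f i x - f' i x) l (fun x => g x - g' x) := by
  have : TendstoInMeasure μ (fun i x => -f' i x) l (fun x => -g' x) := fun ε hε => by
    simpa only [edist_neg_neg] using hf' ε hε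
  simpa only [sub_eq_add_neg] using TendstoInMeasure.add hf this

variable {ω : ℝ} {f r g : ℂ → ℂ} {J φ ψ : ℝ → ℂ}

theorem MemWidder.congr {h h' : ℝ → ℂ} (H : MemWidder ω h) (he : EqOn h' h (Ioi ω)) :
    MemWidder ω h' := by
  obtain ⟨h1, M, hM⟩ := H
  refine ⟨h1.congr he, M, fun n s hs => ?_⟩
  have : h' =ᶠ[𝓝 s] h := he.eventuallyEq_of_mem (Ioi_mem_nhds hs)
  rw [this.iteratedDeriv_eq n]
  exact hM n s hs

/-- If f vanished near z, the quotient would be 0 there, as division by zero gives 0, and its order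
would be ⊤. But finiteness of the order propagates over the whole plane from the pole `p 0`. -/
theorem HasPoles.eventually_ne_zero {p : ℕ → ℂ} {m : ℕ → ℕ} (hp : HasPoles ω f r p m) {z : ℂ}
    (hf : AnalyticAt ℂ f z) : ∀ᶠ w in 𝓝[≠] z, f w ≠ 0 := by
  refine hf.eventually_eq_zero_or_eventually_ne_zero.resolve_left fun h0 => ?_
  have htop : meromorphicOrderAt (fun s => r s / f s) z = ⊤ := by
    rw [meromorphicOrderAt_eq_top_iff]
    filter_upwards [h0.filter_mono nhdsWithin_le_nhds] with w hw
    simp [hw]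
  refine hp.1.exists_meromorphicOrderAt_ne_top_iff_forall.1 ⟨p 0, ?_⟩ z htop
  rw [hp.2.2.2.2.2.1 0]
  exact WithTop.coe_ne_top

/-- The hypotheses on the symbol `f` that are used: it is holomorphic on `Re s > ω`
and has isolated zeros there. -/
structure IsSymbol (ω : ℝ) (f : ℂ → ℂ) : Prop where
  analyticOnNhd : AnalyticOnNhd ℂ f {s : ℂ | ω < s.re}
  eventually_ne : ∀ z : ℂ, ω < z.re → ∀ᶠ w in 𝓝[≠] z, f w ≠ 0

namespace IsSymbol

theorem countable_zeros (hf : IsSymbol ω f) : {z : ℂ | ω < z.re ∧ f z = 0}.Countable :=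
  countable_of_forall_eventually_notMem fun z hz => by
    filter_upwards [hf.eventually_ne z hz.1] with w hw h
    exact hw h.2

/-- Identity theorem: the real points just to the right of ω + 1 are not zeros of f, and they
accumulate at ω + 1. -/
theorem eqOn_zero (hf : IsSymbol ω f) {A : ℂ → ℂ} (hA : AnalyticOnNhd ℂ A {s : ℂ | ω < s.re})
    (h : ∀ x : ℝ, ω < x → f x ≠ 0 → A x = 0) {z : ℂ} (hz : ω < z.re) : A z = 0 := by
  have h0 : ω < ((ω + 1 : ℝ) : ℂ).re := by simp
  refine hA.eqOn_zero_of_preconnected_of_frequently_eq_zero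
    (convex_halfSpace_re_gt ω).isPreconnected (z₀ := ((ω + 1 : ℝ) : ℂ)) h0 ?_ hz
  have ht : Tendsto (fun x : ℝ => (x : ℂ)) (𝓝[>] (ω + 1)) (𝓝[≠] ((ω + 1 : ℝ) : ℂ)) := by
    refine tendsto_nhdsWithin_iff.2 ⟨?_, ?_⟩
    · exact (Complex.continuous_ofReal.tendsto _).mono_left nhdsWithin_le_nhds
    · filter_upwards [self_mem_nhdsWithin] with x hx
      have : x ≠ ω + 1 := ne_of_gt hx
      simpa using fun h => this (by exact_mod_cast h)
  refine ht.frequently (Eventually.frequently ?_)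
  filter_upwards [ht.eventually (hf.eventually_ne _ h0), self_mem_nhdsWithin] with x hx hx'
  have : ω + 1 < x := hx'
  exact h x (by linarith) hx

theorem eqOn_zero' (hf : IsSymbol ω f) {A : ℂ → ℂ} (hA : AnalyticOnNhd ℂ A {s : ℂ | ω < s.re})
    (h : ∀ s : ℂ, ω < s.re → f s ≠ 0 → A s = 0) {z : ℂ} (hz : ω < z.re) : A z = 0 :=
  hf.eqOn_zero hA (fun x hx => h x (by simpa using hx)) hz

/-- Widder's theorem inverts the quotient on the real ray only. The function f 𝓛φ − g is holomorphic
even at the zeros of f, so the identity theorem extends the equality to the half-plane. -/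
theorem exists_isInverseLaplaceQuot (hf : IsSymbol ω f)
    (hg : AnalyticOnNhd ℂ g {s : ℂ | ω < s.re}) (hgf : QuotMemWidder ω g f) :
    ∃ φ, IsInverseLaplaceQuot ω g f φ := by
  obtain ⟨h, hh, he⟩ := hgf
  obtain ⟨φ, hφ, hL⟩ := hh.exists_laplace_eq
  refine ⟨φ, hφ, fun s hs hfs => ?_⟩
  have := hf.eqOn_zero ((hf.analyticOnNhd.mul hφ.analyticOnNhd_laplace).sub hg)
    (fun x hx hfx => ?_) hs
  · rw [eq_div_iff hfs, mul_comm]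
    exact sub_eq_zero.1 this
  · simp only [Pi.sub_apply]
    rw [hL x hx, he x hx hfx]
    field_simp
    ring

theorem mul_laplace_eq (hf : IsSymbol ω f) (hg : AnalyticOnNhd ℂ g {s : ℂ | ω < s.re})
    (hφ : IsInverseLaplaceQuot ω g f φ) {s : ℂ} (hs : ω < s.re) : f s * laplace φ s = g s := by
  refine sub_eq_zero.1 (hf.eqOn_zero'
    ((hf.analyticOnNhd.mul hφ.1.analyticOnNhd_laplace).sub hg) (fun x hx hfx => ?_) hs)
  simp only [Pi.sub_apply]
  rw [hφ.2 x hx hfx]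
  field_simp
  ring

/-- The Widder condition in `IsSolution` is automatic: f 𝓛φ − r is 𝓛J on the ray, and the easy half
of Widder's theorem applies to J. What remains is f 𝓛φ = 𝓛J + r, which extends from the ray to the
half-plane. -/
theorem isSolution_iff (hf : IsSymbol ω f) (hr : Differentiable ℂ r) (hJ : MemExpBdd ω J) :
    IsSolution ω f r J φ ↔ IsInverseLaplaceQuot ω (fun s => laplace J s + r s) f φ := by
  have hrA : AnalyticOnNhd ℂ r {s : ℂ | ω < s.re} := fun z _ => hr.analyticAt z
  constructor
  · rintro ⟨hφ, -, -, hL⟩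
    refine ⟨hφ, fun s hs hfs => ?_⟩
    have := hf.eqOn_zero (((hf.analyticOnNhd.mul hφ.analyticOnNhd_laplace).sub hrA).sub
      hJ.analyticOnNhd_laplace) (fun x hx _ => ?_) hs
    · simp only [Pi.sub_apply] at this
      rw [eq_div_iff hfs]
      linear_combination this
    · simp only [Pi.sub_apply]
      rw [hL x hx, sub_self]
  · intro h
    have e : ∀ x : ℝ, ω < x → laplace J x = f x * laplace φ x - r x := fun x hx => by
      rw [hf.mul_laplace_eq (hJ.analyticOnNhd_laplace.add hrA) h (by simpa using hx),
        Pi.add_apply, add_sub_cancel_right]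
    exact ⟨h.1, hJ.memWidder_laplace.congr fun x hx => (e x hx).symm, hJ, e⟩

theorem ae_eq (hf : IsSymbol ω f) (hφ : IsInverseLaplaceQuot ω g f φ)
    (hψ : IsInverseLaplaceQuot ω g f ψ) : φ =ᵐ[volume.restrict (Ioi (0 : ℝ))] ψ := by
  refine hφ.1.ae_eq_of_laplace_eq hψ.1 fun s hs => sub_eq_zero.1 ?_
  refine hf.eqOn_zero' (hφ.1.analyticOnNhd_laplace.sub hψ.1.analyticOnNhd_laplace)
    (fun x hx hfx => ?_) hs
  rw [Pi.sub_apply, hφ.2 x hx hfx, hψ.2 x hx hfx, sub_self]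

theorem ae_vertical_ne_zero (hf : IsSymbol ω f) {c : ℝ} (hc : ω < c) :
    ∀ᵐ y : ℝ, f (c + y * Complex.I) ≠ 0 := by
  filter_upwards [ae_vertical_notMem hf.countable_zeros c] with y hy h0
  exact hy ⟨by simpa using hc, h0⟩

theorem ae_vertical_eq (hf : IsSymbol ω f) (hφ : IsInverseLaplaceQuot ω g f φ) {c : ℝ}
    (hc : ω < c) :
    ∀ᵐ y : ℝ, g (c + y * Complex.I) / f (c + y * Complex.I) = laplace φ (c + y * Complex.I) := by
  filter_upwards [hf.ae_vertical_ne_zero hc] with y hy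
  exact (hφ.2 _ (by simpa using hc) hy).symm

end IsSymbol

theorem bromwich_congr_ae {F G : ℂ → ℂ} {c : ℝ}
    (h : ∀ᵐ y : ℝ, F (c + y * Complex.I) = G (c + y * Complex.I)) (N t : ℝ) :
    bromwich F c N t = bromwich G c N t := by
  rw [bromwich, bromwich]
  congr 1
  refine intervalIntegral.integral_congr_ae ?_
  filter_upwards [h] with y hy _
  rw [hy]

theorem MemExpBdd.continuous_laplace_vertical (hφ : MemExpBdd ω φ) {c : ℝ} (hc : ω < c) :
    Continuous fun y : ℝ => laplace φ (c + y * Complex.I) := by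
  rw [continuous_iff_continuousAt]
  intro y
  exact (hφ.analyticOnNhd_laplace _ (by simpa using hc)).continuousAt.comp
    (f := fun y : ℝ => (c : ℂ) + y * Complex.I) (continuous_vertical c).continuousAt

theorem MemExpBdd.continuous_bromwich (hφ : MemExpBdd ω φ) {c : ℝ} (hc : ω < c) (N : ℝ) :
    Continuous fun t => bromwich (laplace φ) c N t := by
  have h := hφ.continuous_laplace_vertical hc
  refine continuous_const.mul
    (intervalIntegral.continuous_parametric_intervalIntegral_of_continuous' ?_ _ _)
  have h2 := h.comp (continuous_snd (X := ℝ) (Y := ℝ))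
  simp only [Function.uncurry_def]
  refine (Continuous.mul ?_ h2).mul continuous_const
  fun_prop

theorem MemExpBdd.tendstoInMeasure_bromwich (hφ : MemExpBdd ω φ) {c : ℝ} (hc : ω < c)
    {b : ℕ → ℝ} (hb : Tendsto b atTop atTop) (T : ℝ) :
    TendstoInMeasure (volume.restrict (Ioo 0 T)) (fun n => bromwich (laplace φ) c (b n)) atTop
      φ :=
  tendstoInMeasure_of_tendsto_eLpNorm two_ne_zero
    (fun n => (hφ.continuous_bromwich hc (b n)).aestronglyMeasurable)
    (hφ.1.mono_measure (Measure.restrict_mono Ioo_subset_Ioi_self le_rfl))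
    ((hφ.tendsto_eLpNorm_bromwich hc (ae_of_all _ fun _ => rfl) T).comp hb)

theorem continuous_expSum (P : ℕ → Polynomial ℂ) (p : ℕ → ℂ) (n : ℕ) :
    Continuous (expSum P p n) := by
  unfold expSum
  refine continuous_finsetSum _ fun i _ => Continuous.mul ?_ (by fun_prop)
  exact (P i).continuous.comp Complex.continuous_ofReal

theorem MemExpBdd.bromwich_sub (hφ : MemExpBdd ω φ) (hψ : MemExpBdd ω ψ) {c : ℝ} (hc : ω < c)
    (N t : ℝ) :
    bromwich (fun s => laplace φ s - laplace ψ s) c N t =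
      bromwich (laplace φ) c N t - bromwich (laplace ψ) c N t := by
  have hint : ∀ χ : ℝ → ℂ, MemExpBdd ω χ → IntervalIntegrable (fun y : ℝ =>
      Complex.exp ((c + y * Complex.I) * t) * laplace χ (c + y * Complex.I) * Complex.I)
      volume (-N) N := fun χ hχ => by
    have := hχ.continuous_laplace_vertical hc
    refine Continuous.intervalIntegrable ?_ _ _
    fun_prop
  rw [bromwich, bromwich, bromwich, ← mul_sub,
    ← intervalIntegral.integral_sub (hint φ hφ) (hint ψ hψ)]
  congr 2
  ext y
  ring

theorem iUnion_Ioo_zero_natCast : ⋃ k : ℕ, Ioo (0 : ℝ) k = Ioi 0 := by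
  ext t
  simp only [mem_iUnion, mem_Ioo, mem_Ioi, exists_and_left, and_iff_left_iff_imp]
  exact fun _ => exists_nat_gt t

end NonlocalODE

/-! ### The main theorem -/

theorem mainTheorem3
    (R ω : ℝ) (f r : ℂ → ℂ) (J : ℝ → ℂ)
    (hf : NonlocalODE.ClassGamma R ω f)
    (hr : Differentiable ℂ r)
    (hJ : NonlocalODE.MemExpBdd ω J)
    (hJr : NonlocalODE.QuotMemWidder ω (fun s => NonlocalODE.laplace J s + r s) f)
    (hJf : NonlocalODE.QuotMemWidder ω (NonlocalODE.laplace J) f)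
    (p : ℕ → ℂ) (m : ℕ → ℕ)
    (hp : NonlocalODE.HasPoles ω f r p m)
    (hgrowth : ∃ C q M : ℝ, 0 < q ∧ ∀ s : ℂ, ω ≤ s.re → M ≤ ‖s‖ → ‖r s / f s‖ ≤ C / ‖s‖ ^ q)
    (b : ℕ → ℝ) (σ : ℕ → ℝ → ℂ)
    (hσ : ∀ n, NonlocalODE.IsEnclosingCurve ω (b n) p n (σ n))
    (hb : Tendsto b atTop atTop)
    (hlim : ∀ t : ℝ, 0 < t →
      Tendsto (fun n => NonlocalODE.contourIntegral
        (fun s => Complex.exp (t * s) * (r s / f s)) (σ n)) atTop (𝓝 0)) :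
    -- the equation has a unique solution, given by the explicit formula
    (∃ φ, NonlocalODE.IsSolution ω f r J φ) ∧
    (∀ φ φ', NonlocalODE.IsSolution ω f r J φ → NonlocalODE.IsSolution ω f r J φ' →
      φ =ᵐ[volume.restrict (Ioi (0 : ℝ))] φ') ∧
    (∀ φ, NonlocalODE.IsSolution ω f r J φ →
      NonlocalODE.IsInverseLaplaceQuot ω (fun s => NonlocalODE.laplace J s + r s) f φ) ∧
    (∃ ψ, NonlocalODE.IsInverseLaplaceQuot ω (NonlocalODE.laplace J) f ψ) ∧
    ∃ P : ℕ → Polynomial ℂ,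
      (∀ i, (P i).degree = ((m i - 1 : ℕ) : WithBot ℕ)) ∧
      -- at every `t > 0`, the series and the Bromwich integral of `r / f` are equiconvergent
      (∀ c : ℝ, ω ≤ c → ∀ t : ℝ, 0 < t →
        Tendsto (fun n => NonlocalODE.expSum P p n t -
          NonlocalODE.bromwich (fun s => r s / f s) c (b n) t) atTop (𝓝 0)) ∧
      -- the line `Re s = ω` may be used for `𝓛(J) / f` whenever that makes sense
      (∀ F : ℂ → ℂ, ContinuousOn F {s : ℂ | ω ≤ s.re} →
        (∀ s : ℂ, ω < s.re → f s ≠ 0 → F s = NonlocalODE.laplace J s / f s) →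
        Tendsto F (Bornology.cobounded ℂ ⊓ 𝓟 {s : ℂ | ω ≤ s.re}) (𝓝 0) →
        ∀ c : ℝ, ω < c → ∀ t : ℝ, 0 < t →
          Tendsto (fun N : ℝ => NonlocalODE.bromwich F ω N t -
            NonlocalODE.bromwich (fun s => NonlocalODE.laplace J s / f s) c N t)
            atTop (𝓝 0)) ∧
      ∀ φ ψ : ℝ → ℂ, NonlocalODE.IsSolution ω f r J φ →
        NonlocalODE.IsInverseLaplaceQuot ω (NonlocalODE.laplace J) f ψ →
        ∀ c : ℝ, ω < c →
          -- convergence on bounded intervals, without regularity of the solution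
          (∀ T : ℝ, 0 < T →
            Tendsto (fun N : ℝ => eLpNorm (fun t =>
              NonlocalODE.bromwich (fun s => NonlocalODE.laplace J s / f s) c N t - ψ t) 2
              (volume.restrict (Ioo 0 T))) atTop (𝓝 0) ∧
            TendstoInMeasure (volume.restrict (Ioo 0 T)) (NonlocalODE.expSum P p) atTop
              (fun t => φ t - ψ t)) ∧
          -- the formula at almost every point at which both of its terms converge
          (∀ᵐ t ∂(volume.restrict (Ioi (0 : ℝ))), ∀ B S : ℂ,
            Tendsto (fun N : ℝ => NonlocalODE.bromwich
              (fun s => NonlocalODE.laplace J s / f s) c N t) atTop (𝓝 B) →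
            Tendsto (fun n => NonlocalODE.expSum P p n t) atTop (𝓝 S) →
            φ t = B + S) ∧
          -- convergence, and the formula, at every point of local bounded variation
          (∀ t : ℝ, 0 < t → NonlocalODE.BVNear φ t → NonlocalODE.BVNear ψ t →
            ∃ B S φl φr : ℂ,
              Tendsto (fun N : ℝ => NonlocalODE.bromwich
                (fun s => NonlocalODE.laplace J s / f s) c N t) atTop (𝓝 B) ∧
              Tendsto (fun n => NonlocalODE.expSum P p n t) atTop (𝓝 S) ∧
              Tendsto φ (𝓝[<] t) (𝓝 φl) ∧ Tendsto φ (𝓝[>] t) (𝓝 φr) ∧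
              (φl + φr) / 2 = B + S) := by
  have hS : NonlocalODE.IsSymbol ω f :=
    ⟨fun z hz => hf.2.2 z (Or.inr hz), fun z hz => hp.eventually_ne_zero (hf.2.2 z (Or.inr hz))⟩
  have hLJ := hJ.analyticOnNhd_laplace
  have hrA : AnalyticOnNhd ℂ r {s : ℂ | ω < s.re} := fun z _ => hr.analyticAt z
  have hsol := fun φ => hS.isSolution_iff (φ := φ) hr hJ
  -- The polynomials come from the principal parts of r/f alone, before any t, φ or ψ is introduced.
  choose α g hg hα0 hα using fun i =>
    NonlocalODE.exists_principalPart (hp.1 (p i)) (hp.2.2.2.2.2.1 i)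
  have hzero := fun (t : ℝ) (ht : 0 < t) =>
    NonlocalODE.tendsto_expSum_sub_bromwich hp hσ hg hα (hlim t ht)
  have hord : ∀ z : ℂ, ω ≤ z.re → 0 ≤ meromorphicOrderAt (fun s => r s / f s) z := by
    intro z hz
    by_contra hneg
    obtain ⟨i, rfl⟩ := hp.2.2.2.2.2.2 z (not_le.1 hneg)
    exact not_le.2 (hp.2.2.2.1 i) hz
  -- The contour hypothesis gives the case c = ω; the decay of r/f moves the line to c.
  have hequi : ∀ c : ℝ, ω ≤ c → ∀ t : ℝ, 0 < t → Tendsto (fun n =>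
      NonlocalODE.expSum (fun i => NonlocalODE.residuePoly (m i) (α i)) p n t -
        NonlocalODE.bromwich (fun s => r s / f s) c (b n) t) atTop (𝓝 0) := by
    intro c hc t ht
    have h1 := (NonlocalODE.tendsto_bromwich_sub_bromwich_of_meromorphic hp.1 hord hgrowth hc
      ht).comp hb
    have h2 := (hzero t ht).add h1
    rw [add_zero] at h2
    exact h2.congr fun n => by simp
  refine ⟨?_, ?_, fun φ hφ => (hsol φ).1 hφ, hS.exists_isInverseLaplaceQuot hLJ hJf,
    fun i => NonlocalODE.residuePoly (m i) (α i),
    fun i => NonlocalODE.degree_residuePoly (hp.2.2.2.2.1 i) (hα0 i), hequi, ?_, ?_⟩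
  · obtain ⟨φ, hφ⟩ := hS.exists_isInverseLaplaceQuot (hLJ.add hrA) hJr
    exact ⟨φ, (hsol φ).2 hφ⟩
  · exact fun φ φ' h h' => hS.ae_eq ((hsol φ).1 h) ((hsol φ').1 h')
  · intro F hF hFeq hF0 c hc t ht
    refine (NonlocalODE.tendsto_bromwich_sub_bromwich hc.le hF hS.countable_zeros
      (fun z hz hzZ => ?_) hF0 ht).congr fun N => ?_
    · have hfz : f z ≠ 0 := fun h => hzZ ⟨hz, h⟩
      have hd : DifferentiableAt ℂ (fun s => NonlocalODE.laplace J s / f s) z :=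
        (hLJ z hz).differentiableAt.fun_div (hS.analyticOnNhd z hz).differentiableAt hfz
      refine hd.congr_of_eventuallyEq ?_
      filter_upwards [(NonlocalODE.isOpen_re_gt ω).mem_nhds hz,
        (hS.analyticOnNhd z hz).continuousAt.eventually_ne hfz] with w hw hfw
      exact hFeq w hw hfw
    · congr 1
      refine NonlocalODE.bromwich_congr_ae ?_ N t
      filter_upwards [hS.ae_vertical_ne_zero hc] with y hy
      exact hFeq _ (by simpa using hc) hy
  · intro φ ψ hφ hψ c hc
    replace hφ := (hsol φ).1 hφ
    have eψ : ∀ N t, NonlocalODE.bromwich (fun s => NonlocalODE.laplace J s / f s) c N t =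
        NonlocalODE.bromwich (NonlocalODE.laplace ψ) c N t :=
      NonlocalODE.bromwich_congr_ae (hS.ae_vertical_eq hψ hc)
    -- This is (𝓛J + r)/f − 𝓛J/f = r/f; equality almost everywhere on the line suffices and
    -- disregards the zeros of f on it.
    have er : ∀ N t, NonlocalODE.bromwich (fun s => r s / f s) c N t =
        NonlocalODE.bromwich (NonlocalODE.laplace φ) c N t -
          NonlocalODE.bromwich (NonlocalODE.laplace ψ) c N t := by
      intro N t
      rw [← hφ.1.bromwich_sub hψ.1 hc]
      refine NonlocalODE.bromwich_congr_ae ?_ N t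
      filter_upwards [hS.ae_vertical_eq hψ hc, hS.ae_vertical_eq hφ hc] with y h1 h2
      rw [← h1, ← h2, add_div, add_sub_cancel_left]
    have hmeas : ∀ T : ℝ, TendstoInMeasure (volume.restrict (Ioo 0 T))
        (NonlocalODE.expSum (fun i => NonlocalODE.residuePoly (m i) (α i)) p) atTop
        (fun t => φ t - ψ t) := by
      intro T
      have h1 := hφ.1.tendstoInMeasure_bromwich hc hb T
      have h2 := hψ.1.tendstoInMeasure_bromwich hc hb T
      -- Pointwise convergence to 0 on an interval of finite measure implies convergence in measure.
      have h3 : TendstoInMeasure (volume.restrict (Ioo 0 T)) (fun n t =>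
          NonlocalODE.expSum (fun i => NonlocalODE.residuePoly (m i) (α i)) p n t -
            NonlocalODE.bromwich (fun s => r s / f s) c (b n) t) atTop (fun _ => 0) := by
        refine tendstoInMeasure_of_tendsto_ae (fun n => ?_) ?_
        · simp only [er]
          exact ((NonlocalODE.continuous_expSum _ _ _).sub ((hφ.1.continuous_bromwich hc _).sub
            (hψ.1.continuous_bromwich hc _))).aestronglyMeasurable
        · exact (ae_restrict_mem measurableSet_Ioo).mono fun t ht => hequi c hc.le t ht.1
      have h4 := NonlocalODE.TendstoInMeasure.add h3
        (NonlocalODE.TendstoInMeasure.sub h1 h2)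
      refine (h4.congr_left fun n => ae_of_all _ fun t => ?_).congr_right
        (ae_of_all _ fun t => zero_add _)
      simp only [er]
      ring
    refine ⟨fun T _ => ⟨hψ.1.tendsto_eLpNorm_bromwich hc (hS.ae_vertical_eq hψ hc) T, hmeas T⟩,
      ?_, ?_⟩
    -- On each (0, k), convergence in measure provides subsequences converging almost everywhere,
    -- which identify the pointwise limits wherever these exist.
    · rw [← NonlocalODE.iUnion_Ioo_zero_natCast, ae_restrict_iUnion_iff]
      intro k
      obtain ⟨ns, hns, h1⟩ := (hmeas k).exists_seq_tendsto_ae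
      obtain ⟨ms, hms, h2⟩ := (hψ.1.tendstoInMeasure_bromwich hc
        tendsto_natCast_atTop_atTop (k : ℝ)).exists_seq_tendsto_ae
      filter_upwards [h1, h2] with t h1 h2 B S hB hS
      simp only [eψ] at hB
      rw [tendsto_nhds_unique (hB.comp (tendsto_natCast_atTop_atTop.comp hms.tendsto_atTop)) h2,
        tendsto_nhds_unique (hS.comp hns.tendsto_atTop) h1]
      ring
    · intro t ht hbφ hbψ
      obtain ⟨φl, φr, hl, hr', hB⟩ := hφ.1.tendsto_bromwich_of_bvNear hc
        (ae_of_all _ fun _ => rfl) ht hbφ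
      obtain ⟨ψl, ψr, -, -, hB'⟩ := hψ.1.tendsto_bromwich_of_bvNear hc
        (ae_of_all _ fun _ => rfl) ht hbψ
      refine ⟨(ψl + ψr) / 2, (φl + φr) / 2 - (ψl + ψr) / 2, φl, φr, ?_, ?_, hl, hr', by ring⟩
      · simpa only [eψ] using hB'
      -- The Bromwich integrals of 𝓛φ and 𝓛ψ converge separately, so that of r/f converges along
      -- b_n, and equiconvergence forces the series to converge to the difference.
      · have h := (hequi c hc.le t ht).add ((hB.sub hB').comp hb)
        rw [zero_add] at h
        refine h.congr fun n => ?_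
        simp only [Function.comp_apply, er]
        ring
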